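/- Let $\mathcal X$, $\mathcal V$ be measurable spaces, $\kappa:\mathcal X\times\mathcal X\to\mathbb R$ a kernel, $\psi:\mathcal X\times\mathcal V\to\mathbb R$ a measurable feature map, $\mu$ a probability distribution on $\mathcal V$ and $b>0$. Assume that $\psi$ is unbiased and bounded, that is, $$\kappa(x,x')=\int_{\mathcal V}\psi(x;v)\,\psi(x';v)\,d\mu(v)\quad\text{for all }x,x'\in\mathcal X,$$ and, for every $x\in\mathcal X$, $\psi(x;v)^2\le b$ for $\mu$-almost every $v$. Let $n,s\ge 1$ be integers and $\delta\in(0,1)$, with $s\ge 2$ or $\delta\le\frac12$, and let $$\lambda\ \ge\ \frac{2b}{\sqrt n}\,\log^{1/2}\!\Big(\frac s\delta\Big).$$ Let the training inputs $x_1,\dots,x_n$ be i.i.d. from a probability distribution $\rho$ on $\mathcal X$, with arbitrary random real targets $\mathbf y=(y_1,\dots,y_n)$. Let $\mathbf K=[\kappa(x_i,x_j)]_{ij}\in\mathbb R^{n\times n}$. The kernel ridge regression (KRR) prediction at $x'$ is $$f_\lambda(x')=\mathbf k'^{T}(\mathbf K+n\lambda\mathbf I_n)^{-1}\mathbf y,\qquad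 k'_i=\kappa(x',x_i).$$ For $V=(v_1,\dots,v_s)$ put $\boldsymbol\psi(x;V)=s^{-1/2}(\psi(x;v_1),\dots,\psi(x;v_s))\in\mathbb R^s$. The random feature (RFM-KRR) prediction $\tilde f_\lambda(x';V)$ is the prediction of ridge regression with the features $\boldsymbol\psi(\cdot\,;V)$ and parameter $\lambda$, i.e. $\tilde f_\lambda(x';V)=\tilde{\mathbf k}'^{T}(\tilde{\mathbf K}+n\lambda\mathbf I_n)^{-1}\mathbf y$ with $\tilde K_{ij}=\boldsymbol\psi(x_i;V)^T\boldsymbol\psi(x_j;V)$ and $\tilde k'_i=\boldsymbol\psi(x_i;V)^T\boldsymbol\psi(x';V)$. Then, with probability at least $1-\delta$ over the training data, $$\mathbb E_{x',V}\Big[\big(\tilde f_\lambda(x';V)-f_\lambda(x')\big)^2\Big]\ \le\ \frac{4b}{s}\,\Big\|\mathbf K^{1/2}(\mathbf K+n\lambda\mathbf I_n)^{-1}\mathbf y\Big\|_2^2 ,$$ where the expectation is over a test point $x'\sim\rho$ and $V=(v_1,\dots,v_s)\sim\mu^{\otimes s}$, independent of each other and of the training data. -/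

import Mathlib

open MeasureTheory ProbabilityTheory Matrix
open scoped MatrixOrder RealInnerProductSpace

/-- The kernel matrix `K = [κ (xᵢ, xⱼ)]` of the training inputs `x₁, …, xₙ`. -/
def kernelMatrix {𝒳 : Type*} {n : ℕ} (κ : 𝒳 → 𝒳 → ℝ) (x : Fin n → 𝒳) :
    Matrix (Fin n) (Fin n) ℝ :=
  Matrix.of fun i j => κ (x i) (x j)

/-- The dual coefficients `(K + n lam I)⁻¹ y` of kernel ridge regression. -/
noncomputable def dualCoeff {𝒳 : Type*} {n : ℕ} (κ : 𝒳 → 𝒳 → ℝ) (lam : ℝ)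
    (x : Fin n → 𝒳) (y : Fin n → ℝ) : Fin n → ℝ :=
  (kernelMatrix κ x + ((n : ℝ) * lam) • (1 : Matrix (Fin n) (Fin n) ℝ))⁻¹ *ᵥ y

/-- The prediction `k'ᵀ (K + n lam I)⁻¹ y`, `k'ᵢ = κ (x', xᵢ)`, of kernel ridge regression at the
test point `x'`. It is the prediction of the minimizer of the regularized least-squares objective
over any feature space of `κ`, see `krrPredict_spec`. -/
noncomputable def krrPredict {𝒳 : Type*} {n : ℕ} (κ : 𝒳 → 𝒳 → ℝ) (lam : ℝ)
    (x : Fin n → 𝒳) (y : Fin n → ℝ) (x' : 𝒳) : ℝ :=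
  (fun i => κ x' (x i)) ⬝ᵥ dualCoeff κ lam x y

/-- The random feature vector `s^{-1/2} (ψ (x; v₁), …, ψ (x; vₛ)) ∈ ℝˢ`. -/
noncomputable def featureVector {𝒳 𝒱 : Type*} {s : ℕ} (ψ : 𝒳 → 𝒱 → ℝ) (V : Fin s → 𝒱)
    (x : 𝒳) : EuclideanSpace ℝ (Fin s) :=
  WithLp.toLp 2 fun p => (1 / √(s : ℝ)) * ψ x (V p)

/-- The approximate kernel: inner products of the random feature vectors. -/
noncomputable def rfmKernel {𝒳 𝒱 : Type*} {s : ℕ} (ψ : 𝒳 → 𝒱 → ℝ) (V : Fin s → 𝒱)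
    (x x' : 𝒳) : ℝ :=
  ⟪featureVector ψ V x, featureVector ψ V x'⟫

/-- The prediction at `x'` of ridge regression on the random feature vectors, in its dual form
`k̃'ᵀ (K̃ + n lam I)⁻¹ y`. It is `ψ(x')ᵀ w` for the minimizer `w ∈ ℝˢ` of the regularized
least-squares objective, see `rfmPredict_spec`. -/
noncomputable def rfmPredict {𝒳 𝒱 : Type*} {n s : ℕ} (ψ : 𝒳 → 𝒱 → ℝ) (lam : ℝ)
    (x : Fin n → 𝒳) (y : Fin n → ℝ) (V : Fin s → 𝒱) (x' : 𝒳) : ℝ :=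
  krrPredict (rfmKernel ψ V) lam x y x'

/-- `‖K^{1/2} (K + n lam I)⁻¹ y‖₂²`, with the positive semidefinite square root of `K` and the
Euclidean norm. -/
noncomputable def krrComplexity {𝒳 : Type*} {n : ℕ} (κ : 𝒳 → 𝒳 → ℝ) (lam : ℝ)
    (x : Fin n → 𝒳) (y : Fin n → ℝ) : ℝ :=
  ‖WithLp.toLp 2 (CFC.sqrt (kernelMatrix κ x) *ᵥ dualCoeff κ lam x y)‖ ^ 2

/-- The ridge regression objective `n⁻¹ ∑ᵢ (⟪φ(xᵢ), β⟫ - yᵢ)² + lam ‖β‖²` in a feature space. -/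
noncomputable def ridgeObjective {𝒳 H : Type*} [NormedAddCommGroup H] [InnerProductSpace ℝ H]
    {n : ℕ} (φ : 𝒳 → H) (lam : ℝ) (x : Fin n → 𝒳) (y : Fin n → ℝ) (β : H) : ℝ :=
  (1 / (n : ℝ)) * ∑ i, (⟪φ (x i), β⟫ - y i) ^ 2 + lam * ‖β‖ ^ 2

theorem kernelMatrix_posSemidef {𝒳 H : Type*} [NormedAddCommGroup H] [InnerProductSpace ℝ H]
    {n : ℕ} (φ : 𝒳 → H) (x : Fin n → 𝒳) :
    (kernelMatrix (fun a b => ⟪φ a, φ b⟫) x).PosSemidef :=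
  Matrix.posSemidef_gram ℝ (fun i => φ (x i))

theorem dualCoeff_eq {𝒳 H : Type*} [NormedAddCommGroup H] [InnerProductSpace ℝ H]
    {n : ℕ} (hn : 0 < n) (φ : 𝒳 → H) {lam : ℝ} (hlam : 0 < lam) (x : Fin n → 𝒳) (y : Fin n → ℝ)
    (i : Fin n) :
    ⟪φ (x i), ∑ j, dualCoeff (fun a b => ⟪φ a, φ b⟫) lam x y j • φ (x j)⟫
      + (n : ℝ) * lam * dualCoeff (fun a b => ⟪φ a, φ b⟫) lam x y i = y i := by
  have hn' : (0 : ℝ) < n := by exact_mod_cast hn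
  set A := kernelMatrix (fun a b => ⟪φ a, φ b⟫) x +
    ((n : ℝ) * lam) • (1 : Matrix (Fin n) (Fin n) ℝ) with hA
  have hpd : A.PosDef :=
    Matrix.PosDef.posSemidef_add (kernelMatrix_posSemidef φ x)
      (Matrix.PosDef.one.smul (mul_pos hn' hlam))
  have h : A *ᵥ dualCoeff (fun a b => ⟪φ a, φ b⟫) lam x y = y := by
    unfold dualCoeff
    rw [← hA, Matrix.mulVec_mulVec, Matrix.mul_nonsing_inv _ ((Matrix.isUnit_iff_isUnit_det A).1 hpd.isUnit),
      Matrix.one_mulVec]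
  have hi := congrFun h i
  rw [hA, Matrix.add_mulVec, Matrix.smul_mulVec, Matrix.one_mulVec] at hi
  rw [← hi]
  simp [kernelMatrix, Matrix.mulVec, dotProduct, inner_sum, inner_smul_right, mul_comm]

/-- In every feature space of the kernel, the ridge regression objective has a minimizer, and the
prediction of every minimizer is `krrPredict`. -/
theorem krrPredict_spec {𝒳 H : Type*} [NormedAddCommGroup H] [InnerProductSpace ℝ H]
    {n : ℕ} (hn : 0 < n) (φ : 𝒳 → H) {lam : ℝ} (hlam : 0 < lam) (x : Fin n → 𝒳)
    (y : Fin n → ℝ) :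
    (∃ β, IsMinOn (ridgeObjective φ lam x y) Set.univ β) ∧
      ∀ β, IsMinOn (ridgeObjective φ lam x y) Set.univ β →
        ∀ x', ⟪φ x', β⟫ = krrPredict (fun a b => ⟪φ a, φ b⟫) lam x y x' := by
  have hn' : (0 : ℝ) < n := by exact_mod_cast hn
  set a := dualCoeff (fun a b => ⟪φ a, φ b⟫) lam x y with ha
  set β₀ : H := ∑ j, a j • φ (x j) with hβ₀
  have key : ∀ h : H, ridgeObjective φ lam x y (β₀ + h) = ridgeObjective φ lam x y β₀ +
      ((1 / (n : ℝ)) * ∑ i, ⟪φ (x i), h⟫ ^ 2 + lam * ‖h‖ ^ 2) := by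
    intro h
    have h1 : ∀ i, (⟪φ (x i), β₀ + h⟫ - y i) ^ 2 = (⟪φ (x i), β₀⟫ - y i) ^ 2 +
        ⟪φ (x i), h⟫ ^ 2 + (-2 * (n : ℝ) * lam) * (a i * ⟪φ (x i), h⟫) := by
      intro i
      have := dualCoeff_eq hn φ hlam x y i
      rw [← ha, ← hβ₀] at this
      rw [inner_add_right, ← this]
      ring
    have h2 : ∑ i, a i * ⟪φ (x i), h⟫ = ⟪β₀, h⟫ := by
      rw [hβ₀, sum_inner]
      simp [inner_smul_left]
    have h3 : ‖β₀ + h‖ ^ 2 = ‖β₀‖ ^ 2 + 2 * ⟪β₀, h⟫ + ‖h‖ ^ 2 := norm_add_sq_real β₀ h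
    unfold ridgeObjective
    simp only [h1, h3, Finset.sum_add_distrib, ← Finset.mul_sum, h2]
    field_simp
    ring
  have hpred : ∀ x', ⟪φ x', β₀⟫ = krrPredict (fun a b => ⟪φ a, φ b⟫) lam x y x' := by
    intro x'
    simp [krrPredict, ← ha, hβ₀, dotProduct, inner_sum, inner_smul_right, mul_comm]
  have hnn : ∀ h : H, 0 ≤ (1 / (n : ℝ)) * ∑ i, ⟪φ (x i), h⟫ ^ 2 :=
    fun h => mul_nonneg (by positivity) (Finset.sum_nonneg fun i _ => sq_nonneg _)
  refine ⟨⟨β₀, fun β _ => ?_⟩, fun β hβ x' => ?_⟩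
  · have h := key (β - β₀)
    rw [add_sub_cancel] at h
    change ridgeObjective φ lam x y β₀ ≤ ridgeObjective φ lam x y β
    rw [h]
    have := hnn (β - β₀)
    have : 0 ≤ lam * ‖β - β₀‖ ^ 2 := by positivity
    linarith
  · have h := key (β - β₀)
    rw [add_sub_cancel] at h
    have hle : ridgeObjective φ lam x y β ≤ ridgeObjective φ lam x y β₀ := hβ (Set.mem_univ β₀)
    have h0 := hnn (β - β₀)
    have h1 : lam * ‖β - β₀‖ ^ 2 ≤ 0 := by linarith
    have h2 : ‖β - β₀‖ = 0 := by
      by_contra hne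
      have : 0 < lam * ‖β - β₀‖ ^ 2 := by positivity
      linarith
    have h3 : β = β₀ := sub_eq_zero.mp (norm_eq_zero.mp h2)
    rw [h3, hpred]

/-- `rfmPredict` is the prediction of ridge regression in `ℝˢ` on the random feature vectors. -/
theorem rfmPredict_spec {𝒳 𝒱 : Type*} {n s : ℕ} (hn : 0 < n) (ψ : 𝒳 → 𝒱 → ℝ) {lam : ℝ}
    (hlam : 0 < lam) (x : Fin n → 𝒳) (y : Fin n → ℝ) (V : Fin s → 𝒱) :
    (∃ w, IsMinOn (ridgeObjective (featureVector ψ V) lam x y) Set.univ w) ∧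
      ∀ w, IsMinOn (ridgeObjective (featureVector ψ V) lam x y) Set.univ w →
        ∀ x', ⟪featureVector ψ V x', w⟫ = rfmPredict ψ lam x y V x' :=
  krrPredict_spec hn (featureVector ψ V) hlam x y

/-! Truncating and scaling the features reduces the theorem to `|ψ| ≤ 1`, with `lam / b` in place of
`lam`. Let α = (K + nλI)⁻¹y and g = ∑ᵢ αᵢ ψ(xᵢ; ·). Then f_λ(z) = ∫ g ψ(z; ·) dμ, and ∫ g² dμ = αᵀKα
is the complexity on the right-hand side. Put k(z) = s⁻¹ ∑_q g(v_q) ψ(z; v_q). Ridge regression on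
the random features reproduces k exactly from the targets k(xᵢ) + nλαᵢ, whereas yᵢ = f_λ(xᵢ) + nλαᵢ.
By linearity the prediction error is the residual left when the fluctuation a = k - f_λ is itself
fitted from its values at the sample (`rfmPredict_sub_krrPredict`).

The fluctuation satisfies E a(z)² ≤ s⁻¹ ∫ g² at every z. If the population covariance of the random
features exceeds the empirical one by at most 2λ, then the fit has L²(ρ) norm at most the empirical
norm of a. So the squared residual is at most 2‖a‖² in L²(ρ) plus 2‖a‖² in the empirical norm, which
is the source of the factor 4/s. For λ ≥ 1/2 the covariance condition is automatic.

For λ < 1/2 the covariance excess is governed by the deviations T(v, w) of the empirical inner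
products of pairs of features (`featureDev`). Hoeffding's lemma and a Gaussian linearization bound
the exponential moments of n T² (`integral_exp_mul_sampleDev_sq_le_two`). Markov's inequality then
gives the event `devMoment ≤ 4 / δ` of probability at least 1 - δ, which involves the training
inputs only. On that event the data are fixed and V is the only randomness besides the test point.
Jensen's inequality bounds the excess beyond 2λ by a variable X of small second moment
(`sqrt_mean_sq_le_devExcess`).

The remaining difficulty is that X and a depend on the same V. Split g = g₁ + g₂, where g₂ lives on
the set of features whose exponential moments reach a threshold Θ. On the support of g₁ these
moments stay below Θ, and a sharper residual bound with leading constant 1 + 1 leaves room for error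
terms (`integral_ridgeRes_sq_le`). The support of g₂ has tiny measure, so interactions between
different features are negligible. The residual of a single feature is treated by a leave-one-out
formula (`ridgeRes_feature`): including a feature among the regressors shrinks its own residual,
which gives a constant below 4 by an amount of order 1/s. The total is a quadratic form in the norms
of g₁ and g₂, bounded by 4 times the sum of their squares (`error_constants_le`). -/

/-! ### Calculus of bounded measurable functions. -/

/-- Bounded measurable real functions. -/
def BddMeas {α : Type*} [MeasurableSpace α] (f : α → ℝ) : Prop :=
  Measurable f ∧ ∃ C, ∀ a, |f a| ≤ C

namespace BddMeas

variable {α β : Type*} [MeasurableSpace α] [MeasurableSpace β] {f g : α → ℝ}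

theorem const (c : ℝ) : BddMeas (fun _ : α => c) := ⟨measurable_const, |c|, fun _ => le_rfl⟩

theorem add (hf : BddMeas f) (hg : BddMeas g) : BddMeas (fun a => f a + g a) := by
  obtain ⟨hf, C, hC⟩ := hf
  obtain ⟨hg, D, hD⟩ := hg
  exact ⟨hf.add hg, C + D, fun a => (abs_add_le _ _).trans (add_le_add (hC a) (hD a))⟩

theorem neg (hf : BddMeas f) : BddMeas (fun a => -f a) := by
  obtain ⟨hf, C, hC⟩ := hf
  exact ⟨hf.neg, C, fun a => by rw [abs_neg]; exact hC a⟩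

theorem sub (hf : BddMeas f) (hg : BddMeas g) : BddMeas (fun a => f a - g a) := by
  simpa [sub_eq_add_neg] using hf.add hg.neg

theorem mul (hf : BddMeas f) (hg : BddMeas g) : BddMeas (fun a => f a * g a) := by
  obtain ⟨hf, C, hC⟩ := hf
  obtain ⟨hg, D, hD⟩ := hg
  refine ⟨hf.mul hg, C * D, fun a => ?_⟩
  rw [abs_mul]
  exact mul_le_mul (hC a) (hD a) (abs_nonneg _) ((abs_nonneg _).trans (hC a))

theorem const_mul (c : ℝ) (hf : BddMeas f) : BddMeas (fun a => c * f a) := (const c).mul hf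

theorem pow (hf : BddMeas f) (n : ℕ) : BddMeas (fun a => f a ^ n) := by
  induction n with
  | zero => simpa using const (α := α) 1
  | succ k ih => simpa [pow_succ] using ih.mul hf

theorem abs (hf : BddMeas f) : BddMeas (fun a => |f a|) := by
  obtain ⟨hf, C, hC⟩ := hf
  exact ⟨hf.abs, C, fun a => by rw [abs_abs]; exact hC a⟩

theorem sum {ι : Type*} (s : Finset ι) {f : ι → α → ℝ} (hf : ∀ i, BddMeas (f i)) :
    BddMeas (fun a => ∑ i ∈ s, f i a) := by
  classical
  induction s using Finset.induction_on with
  | empty => simpa using const (α := α) 0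
  | insert i s hi ih => simpa [Finset.sum_insert hi] using (hf i).add ih

theorem comp {h : β → α} (hf : BddMeas f) (hh : Measurable h) : BddMeas (fun b => f (h b)) := by
  obtain ⟨hf, C, hC⟩ := hf
  exact ⟨hf.comp hh, C, fun b => hC _⟩

theorem exp (hf : BddMeas f) : BddMeas (fun a => Real.exp (f a)) := by
  obtain ⟨hf, C, hC⟩ := hf
  refine ⟨hf.exp, Real.exp C, fun a => ?_⟩
  rw [Real.abs_exp]
  exact Real.exp_le_exp.2 ((le_abs_self _).trans (hC a))

theorem sqrt (hf : BddMeas f) : BddMeas (fun a => √(f a)) := by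
  obtain ⟨hf, C, hC⟩ := hf
  refine ⟨hf.sqrt, √C, fun a => ?_⟩
  rw [abs_of_nonneg (Real.sqrt_nonneg _)]
  exact Real.sqrt_le_sqrt ((le_abs_self _).trans (hC a))

theorem indicator (hf : BddMeas f) {A : Set α} (hA : MeasurableSet A) :
    BddMeas (A.indicator f) := by
  obtain ⟨hf, C, hC⟩ := hf
  refine ⟨hf.indicator hA, C, fun a => ?_⟩
  by_cases ha : a ∈ A
  · simpa [ha] using hC a
  · simpa [ha] using (abs_nonneg _).trans (hC a)

theorem integrable (hf : BddMeas f) (μ : Measure α) [IsFiniteMeasure μ] : Integrable f μ := by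
  obtain ⟨hf, C, hC⟩ := hf
  exact Integrable.of_bound hf.aestronglyMeasurable C (Filter.Eventually.of_forall hC)

theorem integral_left {f : α × β → ℝ} (hf : BddMeas f) (μ : Measure β) [IsProbabilityMeasure μ] :
    BddMeas (fun a => ∫ b, f (a, b) ∂μ) := by
  obtain ⟨hf, C, hC⟩ := hf
  refine ⟨(hf.stronglyMeasurable.integral_prod_right' (ν := μ)).measurable, C, fun a => ?_⟩
  have := norm_integral_le_of_norm_le_const (μ := μ) (f := fun b => f (a, b)) (C := C)
    (Filter.Eventually.of_forall fun b => hC (a, b))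
  simpa using this

end BddMeas

/-! ### Cauchy–Schwarz and triangle inequalities in L² of a probability measure. -/

section L2

variable {α : Type*} [MeasurableSpace α] (μ : Measure α) [IsProbabilityMeasure μ] {f g : α → ℝ}

theorem abs_integral_mul_le_sqrt (hf : BddMeas f) (hg : BddMeas g) :
    |∫ a, f a * g a ∂μ| ≤ √(∫ a, f a ^ 2 ∂μ) * √(∫ a, g a ^ 2 ∂μ) := by
  have hF : 0 ≤ ∫ a, f a ^ 2 ∂μ := integral_nonneg fun a => sq_nonneg _
  have key : ∀ t : ℝ, 0 ≤ (∫ a, g a ^ 2 ∂μ) * (t * t) + (2 * ∫ a, f a * g a ∂μ) * t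
      + ∫ a, f a ^ 2 ∂μ := by
    intro t
    have h : 0 ≤ ∫ a, (f a + t * g a) ^ 2 ∂μ := integral_nonneg fun a => sq_nonneg _
    have e : (fun a => (f a + t * g a) ^ 2) =
        fun a => (t * t) * g a ^ 2 + (2 * t) * (f a * g a) + f a ^ 2 := by
      funext a; ring
    rw [e, integral_add (((hg.pow 2).const_mul _).add ((hf.mul hg).const_mul _)|>.integrable μ)
      ((hf.pow 2).integrable μ), integral_add ((hg.pow 2).const_mul _ |>.integrable μ)
      ((hf.mul hg).const_mul _ |>.integrable μ), integral_const_mul, integral_const_mul] at h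
    linarith
  have hd := discrim_le_zero key
  rw [← Real.sqrt_mul hF]
  apply Real.abs_le_sqrt
  unfold discrim at hd
  nlinarith

theorem integral_mul_le_sqrt (hf : BddMeas f) (hg : BddMeas g) :
    ∫ a, f a * g a ∂μ ≤ √(∫ a, f a ^ 2 ∂μ) * √(∫ a, g a ^ 2 ∂μ) :=
  (le_abs_self _).trans (abs_integral_mul_le_sqrt μ hf hg)

theorem sq_integral_le (hf : BddMeas f) : (∫ a, f a ∂μ) ^ 2 ≤ ∫ a, f a ^ 2 ∂μ := by
  have h := abs_integral_mul_le_sqrt μ hf (BddMeas.const 1)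
  simp only [mul_one, one_pow, integral_const, probReal_univ, smul_eq_mul, Real.sqrt_one] at h
  calc (∫ a, f a ∂μ) ^ 2 = |∫ a, f a ∂μ| ^ 2 := (sq_abs _).symm
    _ ≤ √(∫ a, f a ^ 2 ∂μ) ^ 2 := by gcongr
    _ = _ := Real.sq_sqrt (integral_nonneg fun a => sq_nonneg _)

theorem integral_abs_le_sqrt (hf : BddMeas f) : ∫ a, |f a| ∂μ ≤ √(∫ a, f a ^ 2 ∂μ) := by
  apply Real.le_sqrt_of_sq_le
  simpa using sq_integral_le μ hf.abs

theorem integral_add_sq_le_two (hf : BddMeas f) (hg : BddMeas g) :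
    ∫ a, (f a - g a) ^ 2 ∂μ ≤ 2 * ∫ a, f a ^ 2 ∂μ + 2 * ∫ a, g a ^ 2 ∂μ := by
  rw [← integral_const_mul, ← integral_const_mul, ← integral_add
    ((hf.pow 2).const_mul 2 |>.integrable μ) ((hg.pow 2).const_mul 2 |>.integrable μ)]
  refine integral_mono ((hf.sub hg).pow 2 |>.integrable μ)
    (((hf.pow 2).const_mul 2).add ((hg.pow 2).const_mul 2) |>.integrable μ) fun a => ?_
  nlinarith [sq_nonneg (f a + g a)]

theorem sqrt_integral_sub_sq_le (hf : BddMeas f) (hg : BddMeas g) :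
    √(∫ a, (f a - g a) ^ 2 ∂μ) ≤ √(∫ a, f a ^ 2 ∂μ) + √(∫ a, g a ^ 2 ∂μ) := by
  have hF : 0 ≤ ∫ a, f a ^ 2 ∂μ := integral_nonneg fun a => sq_nonneg _
  have hG : 0 ≤ ∫ a, g a ^ 2 ∂μ := integral_nonneg fun a => sq_nonneg _
  apply Real.sqrt_le_iff.2 ⟨by positivity, ?_⟩
  have e : (fun a => (f a - g a) ^ 2) =
      fun a => f a ^ 2 - 2 * (f a * g a) + g a ^ 2 := by
    funext a; ring
  rw [e, integral_add ((hf.pow 2).sub ((hf.mul hg).const_mul 2) |>.integrable μ)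
    ((hg.pow 2).integrable μ), integral_sub ((hf.pow 2).integrable μ)
    ((hf.mul hg).const_mul 2 |>.integrable μ), integral_const_mul]
  have := (abs_le.1 (abs_integral_mul_le_sqrt μ hf hg)).1
  rw [add_sq, Real.sq_sqrt hF, Real.sq_sqrt hG]
  linarith

end L2

/-! ### Independence in product measures by resampling one coordinate. -/

section Resample

variable {ι 𝒱 : Type*} [DecidableEq ι] [MeasurableSpace 𝒱]

theorem measurable_update_pair (r : ι) :
    Measurable (fun q : (ι → 𝒱) × 𝒱 => Function.update q.1 r q.2) := by
  refine measurable_pi_lambda _ fun i => ?_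
  by_cases h : i = r
  · subst h; simpa using measurable_snd
  · simp only [Function.update_of_ne h]
    exact (measurable_pi_apply i).comp measurable_fst

variable [Fintype ι] (μ : Measure 𝒱) [IsProbabilityMeasure μ]

/-- Replacing one coordinate by an independent copy preserves a product measure. -/
theorem measurePreserving_update (r : ι) :
    MeasurePreserving (fun q : (ι → 𝒱) × 𝒱 => Function.update q.1 r q.2)
      ((Measure.pi fun _ : ι => μ).prod μ) (Measure.pi fun _ : ι => μ) := by
  refine ⟨measurable_update_pair r, ?_⟩
  symm
  refine Measure.pi_eq fun B hB => ?_
  rw [Measure.map_apply (measurable_update_pair r) (MeasurableSet.univ_pi hB)]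
  have : (fun q : (ι → 𝒱) × 𝒱 => Function.update q.1 r q.2) ⁻¹' (Set.univ.pi B) =
      (Set.univ.pi (Function.update B r Set.univ)) ×ˢ (B r) := by
    ext ⟨V, v⟩
    simp only [Set.mem_preimage, Set.mem_pi, Set.mem_univ, forall_true_left, Set.mem_prod]
    constructor
    · intro h
      refine ⟨fun i => ?_, by simpa using h r⟩
      by_cases hi : i = r
      · subst hi; simp
      · simpa [hi] using h i
    · rintro ⟨h, hr⟩ i
      by_cases hi : i = r
      · subst hi; simpa using hr
      · simpa [hi] using h i
  rw [this, Measure.prod_prod, Measure.pi_pi, ← Finset.mul_prod_erase _ _ (Finset.mem_univ r),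
    ← Finset.mul_prod_erase Finset.univ (fun i => μ (B i)) (Finset.mem_univ r)]
  simp only [Function.update_self, measure_univ, one_mul]
  rw [mul_comm]
  congr 1
  refine Finset.prod_congr rfl fun i hi => ?_
  rw [Function.update_of_ne (Finset.ne_of_mem_erase hi)]

/-- This is the form in which independence of the coordinates of V is used throughout: once
coordinate r is a fresh variable, factors that ignore it come out of the inner integral, with no
need to split the product space. -/
theorem integral_pi_resample (r : ι) {F : (ι → 𝒱) → ℝ} (hF : BddMeas F) :
    ∫ V, F V ∂(Measure.pi fun _ : ι => μ) =
      ∫ V, ∫ v, F (Function.update V r v) ∂μ ∂(Measure.pi fun _ : ι => μ) := by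
  have h := measurePreserving_update μ r
  rw [← h.map_eq, integral_map h.measurable.aemeasurable hF.1.aestronglyMeasurable, h.map_eq]
  exact integral_prod _ ((hF.comp h.measurable).integrable _)

theorem integral_pi_eval (r : ι) {k : 𝒱 → ℝ} (hk : BddMeas k) :
    ∫ V, k (V r) ∂(Measure.pi fun _ : ι => μ) = ∫ v, k v ∂μ := by
  rw [integral_pi_resample μ r (F := fun V => k (V r)) (hk.comp (measurable_pi_apply r))]
  simp

theorem integral_pi_eval_mul (r : ι) {k : 𝒱 → ℝ} (hk : BddMeas k) {F : (ι → 𝒱) → ℝ}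
    (hF : BddMeas F) (hFr : ∀ V v, F (Function.update V r v) = F V) :
    ∫ V, k (V r) * F V ∂(Measure.pi fun _ : ι => μ) =
      (∫ v, k v ∂μ) * ∫ V, F V ∂(Measure.pi fun _ : ι => μ) := by
  rw [integral_pi_resample μ r (F := fun V => k (V r) * F V)
    ((hk.comp (measurable_pi_apply r)).mul hF)]
  simp only [Function.update_self, hFr, integral_mul_const]
  rw [integral_const_mul]

theorem integral_pi_eval_pair {p r : ι} (hpr : p ≠ r) {k : 𝒱 × 𝒱 → ℝ} (hk : BddMeas k) :
    ∫ V, k (V p, V r) ∂(Measure.pi fun _ : ι => μ) = ∫ v, ∫ w, k (v, w) ∂μ ∂μ := by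
  rw [integral_pi_resample μ r (F := fun V => k (V p, V r))
    (hk.comp ((measurable_pi_apply p).prodMk (measurable_pi_apply r)))]
  simp only [Function.update_self, Function.update_of_ne hpr]
  exact integral_pi_eval μ p (k := fun v => ∫ w, k (v, w) ∂μ) (hk.integral_left μ)

theorem integral_pi_eq_zero_of_resample (r : ι) {F : (ι → 𝒱) → ℝ} (hF : BddMeas F)
    (h : ∀ V, ∫ v, F (Function.update V r v) ∂μ = 0) :
    ∫ V, F V ∂(Measure.pi fun _ : ι => μ) = 0 := by
  rw [integral_pi_resample μ r hF]
  simp [h]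

end Resample

theorem integral_sum_sq_of_orthogonal {α ι : Type*} [Fintype ι] [MeasurableSpace α] (P : Measure α)
    [IsProbabilityMeasure P] {Y : ι → α → ℝ} (hY : ∀ i, BddMeas (Y i))
    (h0 : ∀ i j, i ≠ j → ∫ a, Y i a * Y j a ∂P = 0) :
    ∫ a, (∑ i, Y i a) ^ 2 ∂P = ∑ i, ∫ a, Y i a ^ 2 ∂P := by
  have e : (fun a => (∑ i, Y i a) ^ 2) = fun a => ∑ i, ∑ j, Y i a * Y j a := by
    funext a; rw [sq, Finset.sum_mul_sum]
  rw [e, integral_finsetSum _ fun i _ =>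
    (BddMeas.sum Finset.univ fun j => (hY i).mul (hY j)).integrable P]
  refine Finset.sum_congr rfl fun i _ => ?_
  rw [integral_finsetSum _ fun j _ => ((hY i).mul (hY j)).integrable P,
    Finset.sum_eq_single i (fun j _ hj => h0 i j hj.symm) (by simp)]
  simp [sq]

/-! ### Algebra and energy inequalities of ridge regression on finitely many features. -/

section Ridge

variable {𝒳 : Type*} {n s : ℕ}

theorem rfmKernel_eq {𝒱 : Type*} (ψ : 𝒳 → 𝒱 → ℝ) (V : Fin s → 𝒱) (x x' : 𝒳) :
    rfmKernel ψ V x x' = (s : ℝ)⁻¹ * ∑ p, ψ x (V p) * ψ x' (V p) := by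
  have h : (√(s : ℝ))⁻¹ * (√(s : ℝ))⁻¹ = (s : ℝ)⁻¹ := by
    rw [← mul_inv, Real.mul_self_sqrt (Nat.cast_nonneg s)]
  simp only [rfmKernel, featureVector, PiLp.inner_apply, Real.inner_apply, one_div, Finset.mul_sum]
  refine Finset.sum_congr rfl fun p _ => ?_
  rw [← h]
  ring

/-- The coefficients, in the features `φ`, of the ridge regression of the targets `η`. -/
noncomputable def ridgeCoef (φ : 𝒳 → Fin s → ℝ) (lam : ℝ) (x : Fin n → 𝒳) (η : Fin n → ℝ)
    (p : Fin s) : ℝ :=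
  ∑ j, φ (x j) p * dualCoeff (rfmKernel φ id) lam x η j

/-- The ridge regression of the targets `η` on the features `s^{-1/2} φ`. -/
noncomputable def ridgeFit (φ : 𝒳 → Fin s → ℝ) (lam : ℝ) (x : Fin n → 𝒳) (η : Fin n → ℝ)
    (x' : 𝒳) : ℝ :=
  (s : ℝ)⁻¹ * ∑ p, φ x' p * ridgeCoef φ lam x η p

/-- The residual of the ridge regression of a function from its values at the points `x`. -/
noncomputable def ridgeRes (φ : 𝒳 → Fin s → ℝ) (lam : ℝ) (x : Fin n → 𝒳) (a : 𝒳 → ℝ)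
    (x' : 𝒳) : ℝ :=
  a x' - ridgeFit φ lam x (fun i => a (x i)) x'

theorem ridgeFit_eq_krrPredict (φ : 𝒳 → Fin s → ℝ) (lam : ℝ) (x : Fin n → 𝒳) (η : Fin n → ℝ)
    (x' : 𝒳) : krrPredict (rfmKernel φ id) lam x η x' = ridgeFit φ lam x η x' := by
  simp only [krrPredict, dotProduct, ridgeFit, ridgeCoef, rfmKernel_eq, id, Finset.mul_sum,
    Finset.sum_mul]
  rw [Finset.sum_comm]
  refine Finset.sum_congr rfl fun p _ => Finset.sum_congr rfl fun j _ => ?_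
  ring

theorem dualCoeff_add (κ : 𝒳 → 𝒳 → ℝ) (lam : ℝ) (x : Fin n → 𝒳) (η η' : Fin n → ℝ) :
    dualCoeff κ lam x (fun i => η i + η' i) = dualCoeff κ lam x η + dualCoeff κ lam x η' :=
  Matrix.mulVec_add _ η η'

theorem dualCoeff_smul (κ : 𝒳 → 𝒳 → ℝ) (lam : ℝ) (x : Fin n → 𝒳) (r : ℝ) (η : Fin n → ℝ) :
    dualCoeff κ lam x (fun i => r * η i) = r • dualCoeff κ lam x η :=
  Matrix.mulVec_smul _ r η

theorem ridgeFit_add (φ : 𝒳 → Fin s → ℝ) (lam : ℝ) (x : Fin n → 𝒳) (η η' : Fin n → ℝ) (x' : 𝒳) :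
    ridgeFit φ lam x (fun i => η i + η' i) x' =
      ridgeFit φ lam x η x' + ridgeFit φ lam x η' x' := by
  simp only [ridgeFit, ridgeCoef, dualCoeff_add, Pi.add_apply, mul_add, Finset.sum_add_distrib]

theorem ridgeFit_smul (φ : 𝒳 → Fin s → ℝ) (lam : ℝ) (x : Fin n → 𝒳) (r : ℝ) (η : Fin n → ℝ)
    (x' : 𝒳) : ridgeFit φ lam x (fun i => r * η i) x' = r * ridgeFit φ lam x η x' := by
  simp only [ridgeFit, ridgeCoef, dualCoeff_smul, Pi.smul_apply, smul_eq_mul, Finset.mul_sum]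
  refine Finset.sum_congr rfl fun p _ => Finset.sum_congr rfl fun j _ => ?_
  ring

theorem ridgeRes_add (φ : 𝒳 → Fin s → ℝ) (lam : ℝ) (x : Fin n → 𝒳) (a a' : 𝒳 → ℝ) (x' : 𝒳) :
    ridgeRes φ lam x (fun z => a z + a' z) x' =
      ridgeRes φ lam x a x' + ridgeRes φ lam x a' x' := by
  simp only [ridgeRes, ridgeFit_add]
  ring

theorem ridgeRes_smul (φ : 𝒳 → Fin s → ℝ) (lam : ℝ) (x : Fin n → 𝒳) (r : ℝ) (a : 𝒳 → ℝ) (x' : 𝒳) :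
    ridgeRes φ lam x (fun z => r * a z) x' = r * ridgeRes φ lam x a x' := by
  simp only [ridgeRes, ridgeFit_smul]
  ring

theorem ridgeRes_sub (φ : 𝒳 → Fin s → ℝ) (lam : ℝ) (x : Fin n → 𝒳) (a a' : 𝒳 → ℝ) (x' : 𝒳) :
    ridgeRes φ lam x (fun z => a z - a' z) x' =
      ridgeRes φ lam x a x' - ridgeRes φ lam x a' x' := by
  have h := ridgeRes_smul φ lam x (-1) a' x'
  have h' := ridgeRes_add φ lam x a (fun z => -1 * a' z) x'
  rw [h] at h'
  simpa [sub_eq_add_neg] using h'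

theorem ridgeRes_sum {ι : Type*} (S : Finset ι) (φ : 𝒳 → Fin s → ℝ) (lam : ℝ) (x : Fin n → 𝒳)
    (a : ι → 𝒳 → ℝ) (x' : 𝒳) :
    ridgeRes φ lam x (fun z => ∑ i ∈ S, a i z) x' = ∑ i ∈ S, ridgeRes φ lam x (a i) x' := by
  classical
  induction S using Finset.induction_on with
  | empty => simpa using ridgeRes_smul φ lam x 0 (fun _ => 0) x'
  | insert i S hi ih => simp only [Finset.sum_insert hi, ridgeRes_add, ih]

theorem isUnit_det_regularized (hn : 0 < n) (φ : 𝒳 → Fin s → ℝ) {lam : ℝ} (hlam : 0 < lam)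
    (x : Fin n → 𝒳) :
    IsUnit (kernelMatrix (rfmKernel φ id) x +
      ((n : ℝ) * lam) • (1 : Matrix (Fin n) (Fin n) ℝ)).det := by
  have hn' : (0 : ℝ) < n := by exact_mod_cast hn
  exact (Matrix.isUnit_iff_isUnit_det _).1 (Matrix.PosDef.posSemidef_add
    (kernelMatrix_posSemidef (featureVector φ id) x)
      (Matrix.PosDef.one.smul (mul_pos hn' hlam))).isUnit

theorem kernelMatrix_mulVec (φ : 𝒳 → Fin s → ℝ) (x : Fin n → 𝒳) (ω : Fin n → ℝ) (i : Fin n) :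
    (kernelMatrix (rfmKernel φ id) x *ᵥ ω) i =
      (s : ℝ)⁻¹ * ∑ p, φ (x i) p * ∑ j, φ (x j) p * ω j := by
  simp only [kernelMatrix, Matrix.mulVec, dotProduct, Matrix.of_apply, rfmKernel_eq, id,
    Finset.mul_sum, Finset.sum_mul]
  rw [Finset.sum_comm]
  refine Finset.sum_congr rfl fun p _ => Finset.sum_congr rfl fun j _ => ?_
  ring

theorem ridgeFit_add_dualCoeff (hn : 0 < n) (φ : 𝒳 → Fin s → ℝ) {lam : ℝ} (hlam : 0 < lam)
    (x : Fin n → 𝒳) (η : Fin n → ℝ) (i : Fin n) :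
    ridgeFit φ lam x η (x i) + (n : ℝ) * lam * dualCoeff (rfmKernel φ id) lam x η i = η i := by
  have h : (kernelMatrix (rfmKernel φ id) x + ((n : ℝ) * lam) • (1 : Matrix (Fin n) (Fin n) ℝ)) *ᵥ
      dualCoeff (rfmKernel φ id) lam x η = η := by
    rw [dualCoeff, Matrix.mulVec_mulVec, Matrix.mul_nonsing_inv _
      (isUnit_det_regularized hn φ hlam x), Matrix.one_mulVec]
  have hi := congrFun h i
  rw [Matrix.add_mulVec, Matrix.smul_mulVec, Matrix.one_mulVec, Pi.add_apply,
    kernelMatrix_mulVec] at hi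
  simpa [ridgeFit, ridgeCoef] using hi

/-- The regularized system is invertible, so dual coefficients can be identified by exhibiting a
solution. Both the leave-one-out formula and the exact reproduction of the Monte Carlo approximation
are obtained this way. -/
theorem dualCoeff_eq_of_solves (hn : 0 < n) (φ : 𝒳 → Fin s → ℝ) {lam : ℝ} (hlam : 0 < lam)
    (x : Fin n → 𝒳) (η ω : Fin n → ℝ)
    (h : ∀ i, (s : ℝ)⁻¹ * ∑ p, φ (x i) p * ∑ j, φ (x j) p * ω j + (n : ℝ) * lam * ω i = η i) :
    dualCoeff (rfmKernel φ id) lam x η = ω := by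
  have hη : (kernelMatrix (rfmKernel φ id) x + ((n : ℝ) * lam) • (1 : Matrix (Fin n) (Fin n) ℝ)) *ᵥ
      ω = η := by
    funext i
    rw [Matrix.add_mulVec, Matrix.smul_mulVec, Matrix.one_mulVec, Pi.add_apply,
      kernelMatrix_mulVec, ← h i]
    simp
  rw [dualCoeff, ← hη, Matrix.mulVec_mulVec, Matrix.nonsing_inv_mul _
      (isUnit_det_regularized hn φ hlam x), Matrix.one_mulVec]

/-- Both sides equal ωᵀK̃ω for the dual coefficients ω, which is the squared norm of the fitted
weight vector. -/
theorem sum_dualCoeff_mul_ridgeFit (φ : 𝒳 → Fin s → ℝ) (lam : ℝ) (x : Fin n → 𝒳)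
    (η : Fin n → ℝ) :
    ∑ i, dualCoeff (rfmKernel φ id) lam x η i * ridgeFit φ lam x η (x i) =
      (s : ℝ)⁻¹ * ∑ p, ridgeCoef φ lam x η p ^ 2 := by
  simp only [ridgeFit, Finset.mul_sum]
  rw [Finset.sum_comm]
  refine Finset.sum_congr rfl fun p _ => ?_
  calc ∑ i, dualCoeff (rfmKernel φ id) lam x η i *
        ((s : ℝ)⁻¹ * (φ (x i) p * ridgeCoef φ lam x η p)) =
      (s : ℝ)⁻¹ * ridgeCoef φ lam x η p *
        ∑ i, φ (x i) p * dualCoeff (rfmKernel φ id) lam x η i := by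
        rw [Finset.mul_sum]; exact Finset.sum_congr rfl fun i _ => by ring
    _ = _ := by rw [← ridgeCoef]; ring

/-- The empirical energy inequalities of a ridge regression. -/
theorem ridge_energy (hn : 0 < n) (φ : 𝒳 → Fin s → ℝ) {lam : ℝ} (hlam : 0 < lam)
    (x : Fin n → 𝒳) (η : Fin n → ℝ) {X : ℝ} (hX : 0 ≤ X) :
    ((n : ℝ)⁻¹ * ∑ i, ridgeFit φ lam x η (x i) ^ 2 +
        (2 + 4 * X) * lam * ((s : ℝ)⁻¹ * ∑ p, ridgeCoef φ lam x η p ^ 2) ≤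
      (1 + X) * ((n : ℝ)⁻¹ * ∑ i, η i ^ 2)) ∧
    ((n : ℝ)⁻¹ * ∑ i, ridgeFit φ lam x η (x i) ^ 2 -
        2 * ((n : ℝ)⁻¹ * ∑ i, η i * ridgeFit φ lam x η (x i)) +
        (6 + 4 * X) * lam * ((s : ℝ)⁻¹ * ∑ p, ridgeCoef φ lam x η p ^ 2) ≤
      (1 + X) * ((n : ℝ)⁻¹ * ∑ i, η i ^ 2)) ∧
    4 * lam * ((s : ℝ)⁻¹ * ∑ p, ridgeCoef φ lam x η p ^ 2) ≤ (n : ℝ)⁻¹ * ∑ i, η i ^ 2 := by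
  have hn' : (0 : ℝ) < n := by exact_mod_cast hn
  set ω := dualCoeff (rfmKernel φ id) lam x η
  set F := fun i => ridgeFit φ lam x η (x i) with hF
  have hη : ∀ i, η i = F i + n * lam * ω i := fun i =>
    (ridgeFit_add_dualCoeff hn φ hlam x η i).symm
  have hN : ∑ i, ω i * F i = (s : ℝ)⁻¹ * ∑ p, ridgeCoef φ lam x η p ^ 2 :=
    sum_dualCoeff_mul_ridgeFit φ lam x η
  rw [← hN]
  set N := ∑ i, ω i * F i
  set A := ∑ i, F i ^ 2 with hA
  set B := ∑ i, ω i ^ 2 with hB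
  have hB0 : 0 ≤ B := Finset.sum_nonneg fun i _ => sq_nonneg _
  have hA0 : 0 ≤ A := Finset.sum_nonneg fun i _ => sq_nonneg _
  have e1 : ∑ i, η i ^ 2 = A + 2 * (n * lam) * N + (n * lam) ^ 2 * B := by
    simp only [hA, hB, N, Finset.mul_sum, ← Finset.sum_add_distrib]
    exact Finset.sum_congr rfl fun i _ => by rw [hη i]; ring
  have e2 : ∑ i, η i * F i = A + (n * lam) * N := by
    simp only [hA, N, Finset.mul_sum, ← Finset.sum_add_distrib]
    exact Finset.sum_congr rfl fun i _ => by rw [hη i]; ring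
  -- With η = F + nλω, the three inequalities differ from equalities by nonnegative multiples of ‖F
  -- - nλω‖², ‖nλω‖² and ‖F‖².
  have e3 : 0 ≤ A - 2 * (n * lam) * N + (n * lam) ^ 2 * B := by
    have : A - 2 * (n * lam) * N + (n * lam) ^ 2 * B = ∑ i, (F i - n * lam * ω i) ^ 2 := by
      simp only [hA, hB, N, Finset.mul_sum, ← Finset.sum_add_distrib, ← Finset.sum_sub_distrib]
      exact Finset.sum_congr rfl fun i _ => by ring
    rw [this]
    exact Finset.sum_nonneg fun i _ => sq_nonneg _
  have hN0 : 0 ≤ N := by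
    rw [hN]; positivity
  have hXe := mul_nonneg hX e3
  have hBB : 0 ≤ (n * lam) ^ 2 * B := by positivity
  have hl : lam = (n : ℝ)⁻¹ * (n * lam) := by field_simp
  have hnn : (0 : ℝ) ≤ (n : ℝ)⁻¹ := by positivity
  rw [e1, e2]
  refine ⟨?_, ?_, ?_⟩
  · have : (1 + X) * ((n : ℝ)⁻¹ * (A + 2 * (n * lam) * N + (n * lam) ^ 2 * B)) -
        ((n : ℝ)⁻¹ * A + (2 + 4 * X) * lam * N) =
        (n : ℝ)⁻¹ * (X * (A - 2 * (n * lam) * N + (n * lam) ^ 2 * B) + (n * lam) ^ 2 * B) := by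
      field_simp; ring
    have h2 := mul_nonneg hnn (add_nonneg hXe hBB)
    linarith
  · have : (1 + X) * ((n : ℝ)⁻¹ * (A + 2 * (n * lam) * N + (n * lam) ^ 2 * B)) -
        ((n : ℝ)⁻¹ * A - 2 * ((n : ℝ)⁻¹ * (A + (n * lam) * N)) + (6 + 4 * X) * lam * N) =
        (n : ℝ)⁻¹ * (X * (A - 2 * (n * lam) * N + (n * lam) ^ 2 * B) +
          (A - 2 * (n * lam) * N + (n * lam) ^ 2 * B) + A) := by
      field_simp; ring
    have h2 := mul_nonneg hnn (add_nonneg (add_nonneg hXe e3) hA0)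
    linarith
  · have : (n : ℝ)⁻¹ * (A + 2 * (n * lam) * N + (n * lam) ^ 2 * B) - 4 * lam * N =
        (n : ℝ)⁻¹ * (A - 2 * (n * lam) * N + (n * lam) ^ 2 * B) := by
      field_simp; ring
    have h2 := mul_nonneg hnn e3
    linarith

theorem ridgeFit_sq_le (φ : 𝒳 → Fin s → ℝ) (lam : ℝ) (x : Fin n → 𝒳) (η : Fin n → ℝ)
    (x' : 𝒳) (hφ : ∀ p, |φ x' p| ≤ 1) :
    ridgeFit φ lam x η x' ^ 2 ≤ (s : ℝ)⁻¹ * ∑ p, ridgeCoef φ lam x η p ^ 2 := by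
  rcases Nat.eq_zero_or_pos s with hs | hs
  · subst hs; simp [ridgeFit]
  have hs' : (0 : ℝ) < s := by exact_mod_cast hs
  have h := Finset.sum_mul_sq_le_sq_mul_sq Finset.univ (fun p => φ x' p) (ridgeCoef φ lam x η)
  have h1 : ∑ p, φ x' p ^ 2 ≤ s := by
    calc ∑ p, φ x' p ^ 2 ≤ ∑ p : Fin s, (1 : ℝ) :=
          Finset.sum_le_sum fun p _ => (sq_le_one_iff_abs_le_one _).2 (hφ p)
      _ = s := by simp
  have h0 : 0 ≤ ∑ p, ridgeCoef φ lam x η p ^ 2 := Finset.sum_nonneg fun i _ => sq_nonneg _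
  have h2 := h.trans (mul_le_mul_of_nonneg_right h1 h0)
  rw [ridgeFit, mul_pow]
  calc ((s : ℝ)⁻¹) ^ 2 * (∑ p, φ x' p * ridgeCoef φ lam x η p) ^ 2 ≤
      ((s : ℝ)⁻¹) ^ 2 * (s * ∑ p, ridgeCoef φ lam x η p ^ 2) := by gcongr
    _ = _ := by field_simp

end Ridge

theorem mean_sq_le {𝒳 : Type*} {n : ℕ} {x : Fin n → 𝒳} (hn : 0 < n) {a : 𝒳 → ℝ} {M : ℝ}
    (hM : ∀ z, |a z| ≤ M) : (n : ℝ)⁻¹ * ∑ i, a (x i) ^ 2 ≤ M ^ 2 := by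
  have hn' : (0 : ℝ) < n := by exact_mod_cast hn
  calc (n : ℝ)⁻¹ * ∑ i, a (x i) ^ 2 ≤ (n : ℝ)⁻¹ * ∑ _i : Fin n, M ^ 2 := by
        refine mul_le_mul_of_nonneg_left (Finset.sum_le_sum fun i _ => ?_) (by positivity)
        rw [← sq_abs]
        exact pow_le_pow_left₀ (abs_nonneg _) (hM _) 2
    _ = M ^ 2 := by simp; field_simp

/-! ### Ridge residuals in L²(ρ) under a bound on the covariance excess. -/

section RidgeL2

variable {𝒳 : Type*} [MeasurableSpace 𝒳] {n s : ℕ}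

/-- The difference between the inner products in `L²(ρ)` and in `L²` of the empirical measure
of the points `x`. -/
noncomputable def sampleDev (ρ : Measure 𝒳) (x : Fin n → 𝒳) (h k : 𝒳 → ℝ) : ℝ :=
  ∫ z, h z * k z ∂ρ - (n : ℝ)⁻¹ * ∑ i, h (x i) * k (x i)

/-- The population covariance of the features `s^{-1/2} φ` exceeds the empirical one by at most
`(2 + 4 X) lam`. -/
def CovExcessLE (ρ : Measure 𝒳) (φ : 𝒳 → Fin s → ℝ) (lam : ℝ) (x : Fin n → 𝒳) (X : ℝ) : Prop :=
  ∀ c : Fin s → ℝ, ∫ z, ((s : ℝ)⁻¹ * ∑ p, φ z p * c p) ^ 2 ∂ρ ≤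
    (n : ℝ)⁻¹ * ∑ i, ((s : ℝ)⁻¹ * ∑ p, φ (x i) p * c p) ^ 2 +
      (2 + 4 * X) * lam * ((s : ℝ)⁻¹ * ∑ p, c p ^ 2)

variable (ρ : Measure 𝒳) {φ : 𝒳 → Fin s → ℝ} {lam X : ℝ}
  {x : Fin n → 𝒳}

theorem bddMeas_ridgeFit (hφ : ∀ p, BddMeas fun z => φ z p) (η : Fin n → ℝ) :
    BddMeas (ridgeFit φ lam x η) :=
  (BddMeas.sum Finset.univ fun p => (hφ p).mul (BddMeas.const _)).const_mul _

theorem bddMeas_ridgeRes (hφ : ∀ p, BddMeas fun z => φ z p) {a : 𝒳 → ℝ} (ha : BddMeas a) :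
    BddMeas (ridgeRes φ lam x a) :=
  ha.sub (bddMeas_ridgeFit hφ _)

/-- The multiple `(2 + 4 * X) * lam` of the coefficient norm allowed in `CovExcessLE` is exactly
what the first inequality of `ridge_energy` can pay for. -/
theorem integral_ridgeFit_sq_le (hn : 0 < n) (hlam : 0 < lam) (hX : 0 ≤ X)
    (hcov : CovExcessLE ρ φ lam x X) (η : Fin n → ℝ) :
    ∫ z, ridgeFit φ lam x η z ^ 2 ∂ρ ≤ (1 + X) * ((n : ℝ)⁻¹ * ∑ i, η i ^ 2) :=
  (hcov (ridgeCoef φ lam x η)).trans (ridge_energy hn φ hlam x η hX).1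

variable [IsProbabilityMeasure ρ]

theorem integral_sq_le {a : 𝒳 → ℝ} (ha : BddMeas a) {M : ℝ} (hM : ∀ z, |a z| ≤ M) :
    ∫ z, a z ^ 2 ∂ρ ≤ M ^ 2 := by
  calc ∫ z, a z ^ 2 ∂ρ ≤ ∫ _z, M ^ 2 ∂ρ :=
        integral_mono ((ha.pow 2).integrable ρ) (integrable_const _) fun z => by
          change a z ^ 2 ≤ M ^ 2
          rw [← sq_abs]
          exact pow_le_pow_left₀ (abs_nonneg _) (hM _) 2
    _ = M ^ 2 := by simp

theorem sqrt_integral_ridgeRes_sq_le_add (hn : 0 < n) (hlam : 0 < lam) (hX : 0 ≤ X)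
    (hφ : ∀ p, BddMeas fun z => φ z p) (hcov : CovExcessLE ρ φ lam x X) {a : 𝒳 → ℝ}
    (ha : BddMeas a) :
    √(∫ z, ridgeRes φ lam x a z ^ 2 ∂ρ) ≤
      √(∫ z, a z ^ 2 ∂ρ) + √(1 + X) * √((n : ℝ)⁻¹ * ∑ i, a (x i) ^ 2) := by
  refine (sqrt_integral_sub_sq_le ρ ha (bddMeas_ridgeFit hφ _)).trans ?_
  rw [← Real.sqrt_mul (by linarith)]
  gcongr
  exact integral_ridgeFit_sq_le ρ hn hlam hX hcov _

theorem sqrt_integral_ridgeRes_sq_le (hn : 0 < n) (hlam : 0 < lam) (hX : 0 ≤ X)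
    (hφ : ∀ p, BddMeas fun z => φ z p) (hcov : CovExcessLE ρ φ lam x X) {a : 𝒳 → ℝ}
    (ha : BddMeas a) {M : ℝ} (hM : ∀ z, |a z| ≤ M) :
    √(∫ z, ridgeRes φ lam x a z ^ 2 ∂ρ) ≤ 2 * √(1 + X) * M := by
  have hM0 : 0 ≤ M := (abs_nonneg _).trans (hM (x ⟨0, hn⟩))
  have h := sqrt_integral_ridgeRes_sq_le_add ρ hn hlam hX hφ hcov ha
  have h1 : √(∫ z, a z ^ 2 ∂ρ) ≤ M := Real.sqrt_le_iff.2 ⟨hM0, integral_sq_le ρ ha hM⟩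
  have h2 : √((n : ℝ)⁻¹ * ∑ i, a (x i) ^ 2) ≤ M := Real.sqrt_le_iff.2 ⟨hM0, mean_sq_le hn hM⟩
  have h3 : 1 ≤ √(1 + X) := Real.one_le_sqrt.2 (by linarith)
  nlinarith [mul_le_mul_of_nonneg_left h2 (Real.sqrt_nonneg (1 + X)),
    mul_le_mul_of_nonneg_right h3 hM0]

/-- This is the ideal case without excess: each of the two norms of a fluctuation has mean square at
most s⁻¹ ∫ g², so the coefficients 2 + 2 already give the constant 4. -/
theorem integral_ridgeRes_sq_le_two_mul (hn : 0 < n) (hlam : 0 < lam)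
    (hφ : ∀ p, BddMeas fun z => φ z p) (hcov : CovExcessLE ρ φ lam x 0) {a : 𝒳 → ℝ}
    (ha : BddMeas a) :
    ∫ z, ridgeRes φ lam x a z ^ 2 ∂ρ ≤
      2 * ∫ z, a z ^ 2 ∂ρ + 2 * ((n : ℝ)⁻¹ * ∑ i, a (x i) ^ 2) := by
  have h1 := integral_add_sq_le_two ρ ha (bddMeas_ridgeFit (lam := lam) (x := x) hφ
    (fun i => a (x i)))
  have h2 := integral_ridgeFit_sq_le ρ hn hlam le_rfl hcov (fun i => a (x i))
  simp only [add_zero, one_mul] at h2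
  simp only [ridgeRes]
  linarith

/-- The `L²(ρ)` norm of a ridge residual, with the deviations of the empirical inner products
of the function with the features as error term. -/
theorem integral_ridgeRes_sq_le (hn : 0 < n) (hlam : 0 < lam) (hX : 0 ≤ X)
    (hφ : ∀ p, BddMeas fun z => φ z p) (hcov : CovExcessLE ρ φ lam x X) {a : 𝒳 → ℝ}
    (ha : BddMeas a) :
    ∫ z, ridgeRes φ lam x a z ^ 2 ∂ρ ≤ ∫ z, a z ^ 2 ∂ρ +
      (1 + X) * ((n : ℝ)⁻¹ * ∑ i, a (x i) ^ 2) +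
      (s : ℝ)⁻¹ * ∑ p, sampleDev ρ x a (fun z => φ z p) ^ 2 / (4 * lam) := by
  set η := fun i => a (x i) with hη
  set c := ridgeCoef φ lam x η with hc
  have hF : BddMeas (ridgeFit φ lam x η) := bddMeas_ridgeFit hφ _
  have e1 : ∫ z, ridgeRes φ lam x a z ^ 2 ∂ρ = ∫ z, a z ^ 2 ∂ρ -
      2 * ∫ z, a z * ridgeFit φ lam x η z ∂ρ + ∫ z, ridgeFit φ lam x η z ^ 2 ∂ρ := by
    have : (fun z => ridgeRes φ lam x a z ^ 2) = fun z => a z ^ 2 -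
        2 * (a z * ridgeFit φ lam x η z) + ridgeFit φ lam x η z ^ 2 := by
      funext z; simp only [ridgeRes, ← hη]; ring
    rw [this, integral_add ((ha.pow 2).sub ((ha.mul hF).const_mul 2) |>.integrable ρ)
      ((hF.pow 2).integrable ρ), integral_sub ((ha.pow 2).integrable ρ)
      ((ha.mul hF).const_mul 2 |>.integrable ρ), integral_const_mul]
  have e2 : ∫ z, a z * ridgeFit φ lam x η z ∂ρ =
      (n : ℝ)⁻¹ * ∑ i, η i * ridgeFit φ lam x η (x i) +
        (s : ℝ)⁻¹ * ∑ p, c p * sampleDev ρ x a (fun z => φ z p) := by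
    have e3 : ∀ z, a z * ridgeFit φ lam x η z = (s : ℝ)⁻¹ * ∑ p, c p * (a z * φ z p) := by
      intro z
      rw [ridgeFit, mul_left_comm, Finset.mul_sum]
      congr 1
      exact Finset.sum_congr rfl fun p _ => by rw [hc]; ring
    have e4 : ∑ i, η i * ridgeFit φ lam x η (x i) =
        (s : ℝ)⁻¹ * ∑ p, c p * ∑ i, a (x i) * φ (x i) p := by
      have e3' : ∀ i, η i * ridgeFit φ lam x η (x i) =
        (s : ℝ)⁻¹ * ∑ p, c p * (a (x i) * φ (x i) p) := fun i => e3 (x i)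
      simp only [e3', ← Finset.mul_sum]
      rw [Finset.sum_comm]
      simp only [Finset.mul_sum]
    simp only [e3]
    rw [integral_const_mul, integral_finsetSum _ fun p _ =>
      ((ha.mul (hφ p)).const_mul (c p)).integrable ρ, e4]
    simp only [integral_const_mul, sampleDev, mul_sub, Finset.sum_sub_distrib]
    have : ∑ p, c p * ((n : ℝ)⁻¹ * ∑ i, a (x i) * φ (x i) p) =
        (n : ℝ)⁻¹ * ∑ p, c p * ∑ i, a (x i) * φ (x i) p := by
      rw [Finset.mul_sum]; exact Finset.sum_congr rfl fun p _ => by ring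
    rw [this]
    ring
  -- Young's inequality with weight 4λ. It raises the multiple of the coefficient norm from 2 + 4X
  -- to 6 + 4X, the value in the second inequality of `ridge_energy`.
  have h3 : -(2 * ((s : ℝ)⁻¹ * ∑ p, c p * sampleDev ρ x a (fun z => φ z p))) ≤
      4 * lam * ((s : ℝ)⁻¹ * ∑ p, c p ^ 2) +
        (s : ℝ)⁻¹ * ∑ p, sampleDev ρ x a (fun z => φ z p) ^ 2 / (4 * lam) := by
    have hp : ∀ p, 0 ≤ 4 * lam * c p ^ 2 + sampleDev ρ x a (fun z => φ z p) ^ 2 / (4 * lam) +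
        2 * (c p * sampleDev ρ x a (fun z => φ z p)) := by
      intro p
      have : 4 * lam * c p ^ 2 + sampleDev ρ x a (fun z => φ z p) ^ 2 / (4 * lam) +
        2 * (c p * sampleDev ρ x a (fun z => φ z p)) =
          (4 * lam * c p + sampleDev ρ x a (fun z => φ z p)) ^ 2 / (4 * lam) := by
        field_simp; ring
      rw [this]
      positivity
    have h := mul_nonneg (inv_nonneg.2 (Nat.cast_nonneg s : (0 : ℝ) ≤ s))
      (Finset.sum_nonneg fun p (_ : p ∈ Finset.univ) => hp p)
    simp only [Finset.sum_add_distrib, ← Finset.mul_sum] at h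
    linarith
  have h4 : ∫ z, ridgeFit φ lam x η z ^ 2 ∂ρ ≤ _ := hcov c
  have h5 := (ridge_energy hn φ hlam x η hX).2.1
  rw [e1, e2]
  have h6 : (n : ℝ)⁻¹ * ∑ i, ((s : ℝ)⁻¹ * ∑ p, φ (x i) p * c p) ^ 2 =
    (n : ℝ)⁻¹ * ∑ i, ridgeFit φ lam x η (x i) ^ 2 := rfl
  rw [h6] at h4
  simp only [← hc] at h5
  linarith

theorem sampleDev_sum_mul (hφ : ∀ p, BddMeas fun z => φ z p) (c : Fin s → ℝ) :
    sampleDev ρ x (fun z => ∑ p, φ z p * c p) (fun z => ∑ p, φ z p * c p) =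
      ∑ p, ∑ r, c p * c r * sampleDev ρ x (fun z => φ z p) (fun z => φ z r) := by
  have e : ∀ z, (∑ p, φ z p * c p) * (∑ p, φ z p * c p) =
      ∑ p, ∑ r, c p * c r * (φ z p * φ z r) := by
    intro z
    rw [Finset.sum_mul_sum]
    exact Finset.sum_congr rfl fun p _ => Finset.sum_congr rfl fun r _ => by ring
  simp only [sampleDev, e]
  rw [integral_finsetSum _ fun p _ => (BddMeas.sum Finset.univ fun r =>
    ((hφ p).mul (hφ r)).const_mul (c p * c r)).integrable ρ]
  simp_rw [integral_finsetSum Finset.univ fun r _ =>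
    (((hφ _).mul (hφ r)).const_mul (c _ * c r)).integrable ρ]
  simp only [integral_const_mul, mul_sub, Finset.sum_sub_distrib]
  congr 1
  rw [Finset.sum_comm, Finset.mul_sum]
  refine Finset.sum_congr rfl fun p _ => ?_
  rw [Finset.sum_comm, Finset.mul_sum]
  refine Finset.sum_congr rfl fun r _ => ?_
  rw [← Finset.mul_sum]
  ring

/-- The covariance difference is the quadratic form of the matrix of deviations, and a quadratic
form is bounded by the Frobenius norm of its matrix. -/
theorem covExcessLE_of_sum_sq_le (hφ : ∀ p, BddMeas fun z => φ z p)
    (h : √(((s : ℝ)⁻¹) ^ 2 * ∑ p, ∑ r, sampleDev ρ x (fun z => φ z p) (fun z => φ z r) ^ 2) ≤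
      (2 + 4 * X) * lam) : CovExcessLE ρ φ lam x X := by
  intro c
  have h0 : 0 ≤ (s : ℝ)⁻¹ * ∑ p, c p ^ 2 := by positivity
  set Q := ∑ p, ∑ r, sampleDev ρ x (fun z => φ z p) (fun z => φ z r) ^ 2 with hQ
  have hQ0 : 0 ≤ Q := by positivity
  have hC : ∑ p, ∑ r, c p * c r * sampleDev ρ x (fun z => φ z p) (fun z => φ z r) ≤
      (∑ p, c p ^ 2) * √Q := by
    have hcs := Finset.sum_mul_sq_le_sq_mul_sq (Finset.univ ×ˢ Finset.univ)
      (fun q : Fin s × Fin s => c q.1 * c q.2)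
      (fun q => sampleDev ρ x (fun z => φ z q.1) (fun z => φ z q.2))
    rw [Finset.sum_product, Finset.sum_product, Finset.sum_product] at hcs
    have hcc : ∑ p, ∑ r, (c p * c r) ^ 2 = (∑ p, c p ^ 2) ^ 2 := by
      rw [sq (∑ p, c p ^ 2), Finset.sum_mul_sum]
      simp only [mul_pow]
    simp only at hcs
    rw [hcc, ← hQ] at hcs
    calc _ ≤ √((∑ p, c p ^ 2) ^ 2 * Q) := Real.le_sqrt_of_sq_le hcs
      _ = _ := by rw [Real.sqrt_mul (sq_nonneg _), Real.sqrt_sq (by positivity)]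
  have hdev := sampleDev_sum_mul (x := x) ρ hφ c
  rw [Real.sqrt_mul (sq_nonneg _), Real.sqrt_sq (by positivity)] at h
  have e1 : ∫ z, ((s : ℝ)⁻¹ * ∑ p, φ z p * c p) ^ 2 ∂ρ -
      (n : ℝ)⁻¹ * ∑ i, ((s : ℝ)⁻¹ * ∑ p, φ (x i) p * c p) ^ 2 =
      ((s : ℝ)⁻¹) ^ 2 * sampleDev ρ x (fun z => ∑ p, φ z p * c p) (fun z => ∑ p, φ z p * c p) := by
    simp only [sampleDev, ← sq]
    simp only [mul_pow _ _ 2, integral_const_mul, ← Finset.mul_sum]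
    ring
  have h1 : ((s : ℝ)⁻¹) ^ 2 * sampleDev ρ x (fun z => ∑ p, φ z p * c p)
      (fun z => ∑ p, φ z p * c p) ≤ ((s : ℝ)⁻¹) ^ 2 * ((∑ p, c p ^ 2) * √Q) := by
    rw [hdev]; gcongr
  have h2 := mul_le_mul_of_nonneg_right h h0
  nlinarith

/-- If the features are bounded by `1`, their covariance is at most `1`. -/
theorem covExcessLE_of_half_le (hs : 0 < s) (hφ : ∀ p, BddMeas fun z => φ z p)
    (hφ1 : ∀ z p, |φ z p| ≤ 1) (hlam : 1 / 2 ≤ lam) : CovExcessLE ρ φ lam x 0 := by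
  intro c
  have hs' : (0 : ℝ) < s := by exact_mod_cast hs
  have hm : BddMeas fun z => ((s : ℝ)⁻¹ * ∑ p, φ z p * c p) :=
    (BddMeas.sum Finset.univ fun p => (hφ p).mul (BddMeas.const _)).const_mul _
  have h0 : 0 ≤ (s : ℝ)⁻¹ * ∑ p, c p ^ 2 := by positivity
  have h1 : ∫ z, ((s : ℝ)⁻¹ * ∑ p, φ z p * c p) ^ 2 ∂ρ ≤ √((s : ℝ)⁻¹ * ∑ p, c p ^ 2) ^ 2 := by
    refine integral_sq_le ρ hm fun z => Real.abs_le_sqrt ?_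
    have h := Finset.sum_mul_sq_le_sq_mul_sq Finset.univ (fun p => φ z p) c
    have h1 : ∑ p, φ z p ^ 2 ≤ s := by
      calc ∑ p, φ z p ^ 2 ≤ ∑ p : Fin s, (1 : ℝ) :=
            Finset.sum_le_sum fun p _ => (sq_le_one_iff_abs_le_one _).2 (hφ1 z p)
        _ = s := by simp
    have h0 : 0 ≤ ∑ p, c p ^ 2 := Finset.sum_nonneg fun i _ => sq_nonneg _
    have h2 := h.trans (mul_le_mul_of_nonneg_right h1 h0)
    rw [mul_pow]
    calc ((s : ℝ)⁻¹) ^ 2 * (∑ p, φ z p * c p) ^ 2 ≤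
        ((s : ℝ)⁻¹) ^ 2 * (s * ∑ p, c p ^ 2) := by gcongr
      _ = _ := by field_simp
  rw [Real.sq_sqrt h0] at h1
  have h2 : 0 ≤ (n : ℝ)⁻¹ * ∑ i, ((s : ℝ)⁻¹ * ∑ p, φ (x i) p * c p) ^ 2 := by positivity
  nlinarith

end RidgeL2

/-! ### Leave-one-out formula for the residual of a feature. -/

section LeaveOneOut

variable {𝒳 : Type*} {n s : ℕ}

/-- The features `φ` with the `p`-th one replaced by zero. -/
noncomputable def dropFeature (φ : 𝒳 → Fin s → ℝ) (p : Fin s) : 𝒳 → Fin s → ℝ :=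
  fun z r => if r = p then 0 else φ z r

theorem sum_mul_const_mul {ι : Type*} [Fintype ι] (r : ℝ) (a c : ι → ℝ) :
    ∑ i, a i * (r * c i) = r * ∑ i, a i * c i := by
  simp only [mul_left_comm _ r, Finset.mul_sum]

theorem sum_dropFeature (φ : 𝒳 → Fin s → ℝ) (p : Fin s) (z : 𝒳) (c : Fin s → ℝ) :
    ∑ r, φ z r * c r = ∑ r, dropFeature φ p z r * c r + φ z p * c p := by
  rw [← Finset.add_sum_erase _ _ (Finset.mem_univ p),
    ← Finset.add_sum_erase Finset.univ (fun r => dropFeature φ p z r * c r) (Finset.mem_univ p)]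
  have : ∑ r ∈ Finset.univ.erase p, φ z r * c r =
      ∑ r ∈ Finset.univ.erase p, dropFeature φ p z r * c r :=
    Finset.sum_congr rfl fun r hr => by simp [dropFeature, Finset.ne_of_mem_erase hr]
  rw [this]
  simp [dropFeature]
  ring

/-- Leave-one-out formula for the ridge residual of a feature. -/
theorem ridgeRes_feature (hn : 0 < n) (hs : 0 < s) (φ : 𝒳 → Fin s → ℝ) {lam : ℝ} (hlam : 0 < lam)
    (x : Fin n → 𝒳) (p : Fin s) (hφ : ∀ i q, |φ (x i) q| ≤ 1) :
    ∃ ζ : ℝ, 0 ≤ ζ ∧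
      ζ * (1 + (s : ℝ)⁻¹ * ((n : ℝ)⁻¹ * ∑ i, φ (x i) p ^ 2) / (1 + lam)) ≤ 1 ∧
      ∀ z, ridgeRes φ lam x (fun y => φ y p) z =
        ζ * ridgeRes (dropFeature φ p) lam x (fun y => φ y p) z := by
  have hn' : (0 : ℝ) < n := by exact_mod_cast hn
  have hs' : (0 : ℝ) < s := by exact_mod_cast hs
  -- With M the regularized kernel matrix of the other features and φ_p the vector of values of the
  -- p-th feature, ω = M⁻¹φ_p and b = φ_pᵀM⁻¹φ_p. The factor ζ will be (1 + b/s)⁻¹.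
  set ω := dualCoeff (rfmKernel (dropFeature φ p) id) lam x (fun i => φ (x i) p) with hω
  set b := ∑ j, φ (x j) p * ω j with hb
  have hsol : ∀ i, (s : ℝ)⁻¹ * ∑ q, dropFeature φ p (x i) q *
      ∑ j, dropFeature φ p (x j) q * ω j + n * lam * ω i = φ (x i) p := fun i =>
    ridgeFit_add_dualCoeff hn (dropFeature φ p) hlam x (fun i => φ (x i) p) i
  have hdrop : ∀ z, ∑ q, dropFeature φ p z q * ∑ j, dropFeature φ p (x j) q * ω j =
      ∑ q, dropFeature φ p z q * ∑ j, φ (x j) q * ω j := by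
    intro z
    refine Finset.sum_congr rfl fun q _ => ?_
    by_cases hq : q = p <;> simp [dropFeature, hq]
  -- the quadratic form of the reduced system
  have hquad : ∀ v : Fin n → ℝ, (s : ℝ)⁻¹ * ∑ q, (∑ j, dropFeature φ p (x j) q * v j) ^ 2 ≤
      n * ∑ j, v j ^ 2 := by
    intro v
    have hq : ∀ q, (∑ j, dropFeature φ p (x j) q * v j) ^ 2 ≤ n * ∑ j, v j ^ 2 := by
      intro q
      have h := Finset.sum_mul_sq_le_sq_mul_sq Finset.univ (fun j => dropFeature φ p (x j) q) v
      have h1 : ∑ j, dropFeature φ p (x j) q ^ 2 ≤ n := by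
        calc ∑ j, dropFeature φ p (x j) q ^ 2 ≤ ∑ j : Fin n, (1 : ℝ) := by
              refine Finset.sum_le_sum fun j _ => (sq_le_one_iff_abs_le_one _).2 ?_
              by_cases hq : q = p
              · simp [dropFeature, hq]
              · simpa [dropFeature, hq] using hφ j q
          _ = n := by simp
      exact h.trans (mul_le_mul_of_nonneg_right h1 (Finset.sum_nonneg fun i _ => sq_nonneg _))
    calc _ ≤ (s : ℝ)⁻¹ * ∑ _q : Fin s, (n * ∑ j, v j ^ 2) := by
          gcongr with q; exact hq q
      _ = n * ∑ j, v j ^ 2 := by simp; field_simp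
  have hform : ∀ v w : Fin n → ℝ, ∑ i, v i * ((s : ℝ)⁻¹ * ∑ q, dropFeature φ p (x i) q *
      ∑ j, dropFeature φ p (x j) q * w j + n * lam * w i) =
      (s : ℝ)⁻¹ * ∑ q, (∑ j, dropFeature φ p (x j) q * v j) *
        (∑ j, dropFeature φ p (x j) q * w j) + n * lam * ∑ i, v i * w i := by
    intro v w
    simp only [mul_add, Finset.sum_add_distrib]
    congr 1
    · simp only [Finset.mul_sum (s := Finset.univ (α := Fin s)), ]
      rw [Finset.sum_comm]
      refine Finset.sum_congr rfl fun q _ => ?_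
      rw [Finset.sum_mul, Finset.mul_sum]
      exact Finset.sum_congr rfl fun i _ => by ring
    · rw [Finset.mul_sum]
      exact Finset.sum_congr rfl fun i _ => by ring
  -- Since the features are bounded by 1, M ≤ n(1 + λ)I, so M⁻¹ is bounded below by r = 1/(n(1 +
  -- λ)). Without operator monotonicity: the form of M at ω - rφ_p is nonnegative, equals b -
  -- 2r‖φ_p‖² + r²φ_pᵀMφ_p, and is at most b - r‖φ_p‖².
  have hbpos : (∑ i, φ (x i) p ^ 2) / (n * (1 + lam)) ≤ b := by
    set r : ℝ := 1 / (n * (1 + lam)) with hr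
    have hr0 : 0 < r := by positivity
    have h1 := hform (fun i => ω i - r * φ (x i) p) (fun i => ω i - r * φ (x i) p)
    have h2 : 0 ≤ ∑ i, (ω i - r * φ (x i) p) * ((s : ℝ)⁻¹ * ∑ q, dropFeature φ p (x i) q *
      ∑ j, dropFeature φ p (x j) q * (ω j - r * φ (x j) p) + n * lam * (ω i - r * φ (x i) p)) := by
      rw [h1]
      have : 0 ≤ (s : ℝ)⁻¹ * ∑ q, (∑ j, dropFeature φ p (x j) q * (ω j - r * φ (x j) p)) *
        (∑ j, dropFeature φ p (x j) q * (ω j - r * φ (x j) p)) :=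
        mul_nonneg (by positivity) (Finset.sum_nonneg fun q _ => mul_self_nonneg _)
      have : 0 ≤ ∑ i, (ω i - r * φ (x i) p) * (ω i - r * φ (x i) p) :=
        Finset.sum_nonneg fun q _ => mul_self_nonneg _
      positivity
    have h3 : ∀ i, (s : ℝ)⁻¹ * ∑ q, dropFeature φ p (x i) q *
      ∑ j, dropFeature φ p (x j) q * (ω j - r * φ (x j) p) + n * lam * (ω i - r * φ (x i) p) =
      φ (x i) p - r * ((s : ℝ)⁻¹ * ∑ q, dropFeature φ p (x i) q *
      ∑ j, dropFeature φ p (x j) q * φ (x j) p + n * lam * φ (x i) p) := by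
      intro i
      have : ∀ q, ∑ j, dropFeature φ p (x j) q * (ω j - r * φ (x j) p) =
        ∑ j, dropFeature φ p (x j) q * ω j - r * ∑ j, dropFeature φ p (x j) q * φ (x j) p := by
        intro q
        rw [Finset.mul_sum, ← Finset.sum_sub_distrib]
        exact Finset.sum_congr rfl fun j _ => by ring
      simp only [this]
      simp only [mul_sub (dropFeature φ p (x i) _), Finset.sum_sub_distrib, sum_mul_const_mul]
      linear_combination hsol i
    simp only [h3] at h2
    have h4 := hform (fun i => φ (x i) p) (fun i => φ (x i) p)
    have h5 := hform (fun i => φ (x i) p) ω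
    simp only [hsol] at h5
    have h6 := hform ω (fun i => φ (x i) p)
    have h7 : ∑ i, ω i * ((s : ℝ)⁻¹ * ∑ q, dropFeature φ p (x i) q *
      ∑ j, dropFeature φ p (x j) q * φ (x j) p + n * lam * φ (x i) p) =
        ∑ i, φ (x i) p * φ (x i) p := by
      rw [h6, h5]
      congr 1
      · congr 1; exact Finset.sum_congr rfl fun q _ => mul_comm _ _
      · congr 1; exact Finset.sum_congr rfl fun q _ => mul_comm _ _
    have h8 : ∑ i, (ω i - r * φ (x i) p) * (φ (x i) p - r * ((s : ℝ)⁻¹ * ∑ q,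
      dropFeature φ p (x i) q * ∑ j, dropFeature φ p (x j) q * φ (x j) p + n * lam * φ (x i) p)) =
      b - 2 * r * ∑ i, φ (x i) p * φ (x i) p + r ^ 2 * ((s : ℝ)⁻¹ * ∑ q,
        (∑ j, dropFeature φ p (x j) q * φ (x j) p) *
        (∑ j, dropFeature φ p (x j) q * φ (x j) p) + n * lam * ∑ i, φ (x i) p * φ (x i) p) := by
      rw [← h4]
      have : b - 2 * r * ∑ i, φ (x i) p * φ (x i) p = ∑ i, ω i * φ (x i) p -
        r * ∑ i, φ (x i) p * φ (x i) p - r * ∑ i, ω i * ((s : ℝ)⁻¹ * ∑ q,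
          dropFeature φ p (x i) q * ∑ j, dropFeature φ p (x j) q * φ (x j) p +
            n * lam * φ (x i) p) := by
        rw [h7, hb]
        have : ∑ j, φ (x j) p * ω j = ∑ i, ω i * φ (x i) p :=
          Finset.sum_congr rfl fun j _ => mul_comm _ _
        rw [this]; ring
      rw [this, Finset.mul_sum, Finset.mul_sum, Finset.mul_sum, ← Finset.sum_sub_distrib,
        ← Finset.sum_sub_distrib, ← Finset.sum_add_distrib]
      exact Finset.sum_congr rfl fun j _ => by ring
    rw [h8] at h2
    have h9 := hquad (fun j => φ (x j) p)
    simp only [sq] at h9 ⊢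
    set S := ∑ i, φ (x i) p * φ (x i) p with hS
    have h10 : r ^ 2 * ((s : ℝ)⁻¹ * ∑ q, (∑ j, dropFeature φ p (x j) q * φ (x j) p) *
        (∑ j, dropFeature φ p (x j) q * φ (x j) p) + n * lam * S) ≤
          r ^ 2 * (n * S + n * lam * S) := by
      gcongr
    have h11 : r ^ 2 * (n * S + n * lam * S) = r * S := by
      rw [hr]; field_simp
    have h12 : S / (n * (1 + lam)) = r * S := by rw [hr]; ring
    rw [h12]
    linarith
  have hb0 : 0 ≤ b := le_trans (by positivity) hbpos
  have hden : 0 < 1 + (s : ℝ)⁻¹ * b := by positivity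
  refine ⟨(1 + (s : ℝ)⁻¹ * b)⁻¹, by positivity, ?_, fun z => ?_⟩
  · rw [inv_mul_le_iff₀ hden, mul_one]
    have : (s : ℝ)⁻¹ * ((n : ℝ)⁻¹ * ∑ i, φ (x i) p ^ 2) / (1 + lam) =
      (s : ℝ)⁻¹ * ((∑ i, φ (x i) p ^ 2) / (n * (1 + lam))) := by field_simp
    rw [this]
    gcongr
  -- Sherman–Morrison: restoring the p-th feature is the rank-one update M + s⁻¹φ_pφ_pᵀ, which only
  -- rescales the solution for the target φ_p.
  · have hfull : dualCoeff (rfmKernel φ id) lam x (fun i => φ (x i) p) =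
        fun j => (1 + (s : ℝ)⁻¹ * b)⁻¹ * ω j := by
      refine dualCoeff_eq_of_solves hn φ hlam x _ _ fun i => ?_
      simp only [sum_mul_const_mul]
      rw [sum_dropFeature φ p, ← hb]
      have h1 := hsol i
      rw [hdrop] at h1
      have h3 : (s : ℝ)⁻¹ * ∑ q, dropFeature φ p (x i) q * ∑ j, φ (x j) q * ω j =
        φ (x i) p - n * lam * ω i := by linarith
      calc _ = (1 + (s : ℝ)⁻¹ * b)⁻¹ * ((s : ℝ)⁻¹ * ∑ q, dropFeature φ p (x i) q *
            ∑ j, φ (x j) q * ω j + (s : ℝ)⁻¹ * b * φ (x i) p + n * lam * ω i) := by ring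
        _ = (1 + (s : ℝ)⁻¹ * b)⁻¹ * ((1 + (s : ℝ)⁻¹ * b) * φ (x i) p) := by rw [h3]; ring
        _ = φ (x i) p := by field_simp
    simp only [ridgeRes, ridgeFit, ridgeCoef, hfull, sum_mul_const_mul, ← hω]
    rw [sum_dropFeature φ p, ← hb, hdrop]
    set G := ∑ q, dropFeature φ p z q * ∑ j, φ (x j) q * ω j
    field_simp
    ring

end LeaveOneOut

/-! ### From exponential moments of the deviations to the covariance excess. -/

section Excess

variable {s : ℕ}

/-- A weighted average of exponentials of the squared entries of a matrix `t`; the diagonal entries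
have smaller weight and larger exponent. -/
noncomputable def devEnergy (n : ℝ) (t : Fin s → Fin s → ℝ) : ℝ :=
  ∑ p, ∑ r, (if p = r then 1 else 4) / (s * (4 * s - 3)) *
    Real.exp ((if p = r then 3 / 2 else 3 / 8) * n * t p r ^ 2)

/-- The rate at which `devEnergy` dominates the exponential of the mean square of the entries. -/
noncomputable def devRate (s : ℕ) : ℝ := 3 / 2 * s / (4 * s - 3)

/-- A bound, in units of `4 lam`, for the excess over `2 lam` of the root mean square of the entries
of a matrix, see `sqrt_mean_sq_le_devExcess`. -/
noncomputable def devExcess (n lam : ℝ) (t : Fin s → Fin s → ℝ) : ℝ :=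
  1 / 20 * √(Real.exp (-(4 * devRate s * n * lam ^ 2)) * devEnergy n t)

theorem four_mul_sub_three_pos (hs : 0 < s) : (0 : ℝ) < 4 * s - 3 := by
  have : (1 : ℝ) ≤ s := by exact_mod_cast hs
  linarith

theorem devWeight_sum (hs : 0 < s) :
    ∑ p : Fin s, ∑ r : Fin s, (if p = r then (1 : ℝ) else 4) / (s * (4 * s - 3)) = 1 := by
  have hs' : (0 : ℝ) < s := by exact_mod_cast hs
  have h3 := four_mul_sub_three_pos hs
  have h : ∀ p : Fin s, ∑ r : Fin s, (if p = r then (1 : ℝ) else 4) = 4 * s - 3 := by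
    intro p
    have : ∀ r : Fin s, (if p = r then (1 : ℝ) else 4) = 4 - if p = r then 3 else 0 := by
      intro r; split_ifs <;> norm_num
    simp only [this, Finset.sum_sub_distrib, Finset.sum_ite_eq, Finset.mem_univ, if_true]
    simp; ring
  simp only [← Finset.sum_div, h, Finset.sum_const, Finset.card_univ, Fintype.card_fin,
    nsmul_eq_mul]
  exact div_self (mul_pos hs' h3).ne'

theorem devEnergy_nonneg (hs : 0 < s) (n : ℝ) (t : Fin s → Fin s → ℝ) : 0 ≤ devEnergy n t := by
  have h3 := four_mul_sub_three_pos hs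
  refine Finset.sum_nonneg fun p _ => Finset.sum_nonneg fun r _ => ?_
  have : (0 : ℝ) ≤ if p = r then 1 else 4 := by split_ifs <;> norm_num
  positivity

theorem devExcess_nonneg (n lam : ℝ) (t : Fin s → Fin s → ℝ) : 0 ≤ devExcess n lam t := by
  unfold devExcess; positivity

theorem devExcess_mono (hs : 0 < s) {n : ℝ} (hn : 0 ≤ n) (lam : ℝ) {t t' : Fin s → Fin s → ℝ}
    (h : ∀ p r, t p r ^ 2 ≤ t' p r ^ 2) : devExcess n lam t ≤ devExcess n lam t' := by
  have h3 := four_mul_sub_three_pos hs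
  unfold devExcess devEnergy
  refine mul_le_mul_of_nonneg_left (Real.sqrt_le_sqrt (mul_le_mul_of_nonneg_left
    (Finset.sum_le_sum fun p _ => Finset.sum_le_sum fun r _ => ?_) (Real.exp_pos _).le))
    (by norm_num)
  have h1 : (0 : ℝ) ≤ if p = r then 1 else 4 := by split_ifs <;> norm_num
  have h2 : (0 : ℝ) ≤ if p = r then 3 / 2 else 3 / 8 := by split_ifs <;> norm_num
  refine mul_le_mul_of_nonneg_left (Real.exp_le_exp.2 ?_) (by positivity)
  exact mul_le_mul_of_nonneg_left (h p r) (by positivity)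

/-- Jensen's inequality for exp. The weights 1 and 4 are inverse to the exponents 3/2 and 3/8, so
after averaging every entry carries the same coefficient and the plain mean square appears. -/
theorem exp_mean_sq_le_devEnergy (hs : 0 < s) (n : ℝ) (t : Fin s → Fin s → ℝ) :
    Real.exp (devRate s * n * (((s : ℝ)⁻¹) ^ 2 * ∑ p, ∑ r, t p r ^ 2)) ≤ devEnergy n t := by
  have hs' : (0 : ℝ) < s := by exact_mod_cast hs
  have h3 := four_mul_sub_three_pos hs
  have hJ := convexOn_exp.map_sum_le (t := (Finset.univ : Finset (Fin s × Fin s)))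
    (w := fun q => (if q.1 = q.2 then (1 : ℝ) else 4) / (s * (4 * s - 3)))
    (p := fun q => (if q.1 = q.2 then 3 / 2 else 3 / 8) * n * t q.1 q.2 ^ 2)
    (fun q _ => by
      have : (0 : ℝ) ≤ if q.1 = q.2 then 1 else 4 := by split_ifs <;> norm_num
      positivity)
    (by rw [Fintype.sum_prod_type]; exact devWeight_sum hs) (fun _ _ => Set.mem_univ _)
  simp only [smul_eq_mul, Fintype.sum_prod_type] at hJ
  refine le_trans (le_of_eq ?_) hJ
  congr 1
  rw [devRate, Finset.mul_sum, Finset.mul_sum]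
  refine Finset.sum_congr rfl fun p _ => ?_
  rw [Finset.mul_sum, Finset.mul_sum]
  refine Finset.sum_congr rfl fun r _ => ?_
  split_ifs
  · field_simp
  · field_simp; ring

theorem sqrt_mean_sq_le_devExcess (hs : 0 < s) {n lam : ℝ} (hlam : 0 < lam)
    (hrate : 1 ≤ devRate s * n * lam ^ 2) (t : Fin s → Fin s → ℝ) :
    √(((s : ℝ)⁻¹) ^ 2 * ∑ p, ∑ r, t p r ^ 2) ≤ (2 + 4 * devExcess n lam t) * lam := by
  have hX := devExcess_nonneg n lam t
  set q := ((s : ℝ)⁻¹) ^ 2 * ∑ p, ∑ r, t p r ^ 2 with hq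
  have hq0 : 0 ≤ q := by positivity
  rcases le_or_gt (√q) (2 * lam) with h | h
  · nlinarith
  set u := (√q / lam - 2) / 4 with hu
  have hu0 : 0 ≤ u := by
    have : 2 ≤ √q / lam := by rw [le_div_iff₀ hlam]; exact h.le
    rw [hu]; linarith
  have hqu : q = lam ^ 2 * (2 + 4 * u) ^ 2 := by
    have : 2 + 4 * u = √q / lam := by rw [hu]; ring
    rw [this, div_pow, Real.sq_sqrt hq0]; field_simp
  -- Since q = λ²(4 + 16u + 16u²), the prefactor cancels the constant 4, and `hrate` leaves an
  -- exponent of at least 16u.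
  have h1 : Real.exp (8 * u) ^ 2 ≤ Real.exp (-(4 * devRate s * n * lam ^ 2)) * devEnergy n t := by
    calc Real.exp (8 * u) ^ 2 = Real.exp (16 * u) := by rw [← Real.exp_nat_mul]; norm_num; ring
      _ ≤ Real.exp (-(4 * devRate s * n * lam ^ 2) + devRate s * n * q) := by
          apply Real.exp_le_exp.2
          rw [hqu]
          nlinarith [mul_le_mul_of_nonneg_right hrate (by positivity : 0 ≤ 16 * u + 16 * u ^ 2)]
      _ ≤ _ := by
          rw [Real.exp_add]
          exact mul_le_mul_of_nonneg_left (exp_mean_sq_le_devEnergy hs n t) (Real.exp_pos _).le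
  have h2 : Real.exp (8 * u) ≤ √(Real.exp (-(4 * devRate s * n * lam ^ 2)) * devEnergy n t) :=
    Real.le_sqrt_of_sq_le h1
  -- exp(8u) ≥ e · 8u, and 8e > 20; this is the origin of the factor 1/20 in `devExcess`.
  have h3 : 20 * u ≤ Real.exp (8 * u) := by
    have e1 : Real.exp (8 * u) = Real.exp 1 * Real.exp (8 * u - 1) := by
      rw [← Real.exp_add]; ring_nf
    have e2 := Real.add_one_le_exp (8 * u - 1)
    have e3 := Real.exp_one_gt_d9
    rw [e1]
    nlinarith [Real.exp_pos 1]
  have h4 : u ≤ devExcess n lam t := by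
    unfold devExcess; linarith
  have h5 : √q = (2 + 4 * u) * lam := by rw [hu]; field_simp; ring
  rw [h5]
  gcongr

end Excess

/-! ### Residual of a fluctuation for a fixed draw of the random features. -/

section Pointwise

/-- After expanding the square, the diagonal terms keep their individual sharp bounds D; the crude
common bound N is spent only on products of different terms, whose weights will be small in the
application. -/
theorem integral_sum_sub_sq_le {α ι : Type*} [Fintype ι] [DecidableEq ι] [MeasurableSpace α]
    (P : Measure α) [IsProbabilityMeasure P] {r : ι → α → ℝ} {r₀ : α → ℝ} (hr : ∀ i, BddMeas (r i))
    (hr₀ : BddMeas r₀) (w D : ι → ℝ) {N m : ℝ} (hN : 0 ≤ N)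
    (hD : ∀ i, ∫ a, r i a ^ 2 ∂P ≤ D i) (h : ∀ i, √(∫ a, r i a ^ 2 ∂P) ≤ N)
    (h₀ : √(∫ a, r₀ a ^ 2 ∂P) ≤ N * m) :
    ∫ a, (∑ i, w i * r i a - r₀ a) ^ 2 ∂P ≤ ∑ i, w i ^ 2 * D i +
      N ^ 2 * (∑ i, ∑ j, (if i = j then 0 else |w i| * |w j|) + 2 * m * ∑ i, |w i| + m ^ 2) := by
  have e : ∀ a, (∑ i, w i * r i a - r₀ a) ^ 2 = ∑ i, ∑ j, w i * w j * (r i a * r j a) -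
      2 * ∑ i, w i * (r i a * r₀ a) + r₀ a ^ 2 := by
    intro a
    have h1 : (∑ i, w i * r i a) ^ 2 = ∑ i, ∑ j, w i * w j * (r i a * r j a) := by
      rw [sq, Finset.sum_mul_sum]
      exact Finset.sum_congr rfl fun i _ => Finset.sum_congr rfl fun j _ => by ring
    have h2 : ∑ i, w i * (r i a * r₀ a) = (∑ i, w i * r i a) * r₀ a := by
      rw [Finset.sum_mul]; exact Finset.sum_congr rfl fun i _ => by ring
    rw [← h1, h2]; ring
  have i1 : BddMeas fun a => ∑ i, ∑ j, w i * w j * (r i a * r j a) :=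
    BddMeas.sum Finset.univ fun i => BddMeas.sum Finset.univ fun j =>
      ((hr i).mul (hr j)).const_mul _
  have i2 : BddMeas fun a => ∑ i, w i * (r i a * r₀ a) :=
    BddMeas.sum Finset.univ fun i => ((hr i).mul hr₀).const_mul _
  have e2 : ∫ a, (∑ i, w i * r i a - r₀ a) ^ 2 ∂P =
      ∑ i, ∑ j, w i * w j * ∫ a, r i a * r j a ∂P - 2 * ∑ i, w i * ∫ a, r i a * r₀ a ∂P +
        ∫ a, r₀ a ^ 2 ∂P := by
    simp only [e]
    rw [integral_add (i1.sub (i2.const_mul 2) |>.integrable P) ((hr₀.pow 2).integrable P),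
      integral_sub (i1.integrable P) ((i2.const_mul 2).integrable P), integral_const_mul,
      integral_finsetSum _ fun i _ => ((hr i).mul hr₀ |>.const_mul _).integrable P,
      integral_finsetSum _ fun i _ => (BddMeas.sum Finset.univ fun j =>
        ((hr i).mul (hr j)).const_mul (w i * w j)).integrable P]
    simp_rw [integral_finsetSum Finset.univ fun j _ =>
      (((hr _).mul (hr j)).const_mul (w _ * w j)).integrable P, integral_const_mul]
  rw [e2]
  have b1 : ∑ i, ∑ j, w i * w j * ∫ a, r i a * r j a ∂P ≤
      ∑ i, w i ^ 2 * D i + N ^ 2 * ∑ i, ∑ j, (if i = j then 0 else |w i| * |w j|) := by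
    rw [Finset.mul_sum, ← Finset.sum_add_distrib]
    refine Finset.sum_le_sum fun i _ => ?_
    have hi : w i ^ 2 * D i = ∑ j, if i = j then w i ^ 2 * D i else 0 := by simp
    rw [hi, Finset.mul_sum, ← Finset.sum_add_distrib]
    refine Finset.sum_le_sum fun j _ => ?_
    split_ifs with hij
    · subst hij
      have : ∫ a, r i a * r i a ∂P = ∫ a, r i a ^ 2 ∂P := by simp only [sq]
      rw [this]
      nlinarith [mul_le_mul_of_nonneg_left (hD i) (sq_nonneg (w i))]
    · have h1 := abs_integral_mul_le_sqrt P (hr i) (hr j)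
      have h2 : √(∫ a, r i a ^ 2 ∂P) * √(∫ a, r j a ^ 2 ∂P) ≤ N * N :=
        mul_le_mul (h i) (h j) (Real.sqrt_nonneg _) hN
      calc w i * w j * ∫ a, r i a * r j a ∂P ≤ |w i * w j * ∫ a, r i a * r j a ∂P| := le_abs_self _
        _ = |w i| * |w j| * |∫ a, r i a * r j a ∂P| := by rw [abs_mul, abs_mul]
        _ ≤ |w i| * |w j| * (N * N) := by gcongr; exact h1.trans h2
        _ = _ := by ring
  have b2 : -(2 * ∑ i, w i * ∫ a, r i a * r₀ a ∂P) ≤ N ^ 2 * (2 * m * ∑ i, |w i|) := by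
    have : N ^ 2 * (2 * m * ∑ i, |w i|) + 2 * ∑ i, w i * ∫ a, r i a * r₀ a ∂P =
        2 * ∑ i, (N ^ 2 * m * |w i| + w i * ∫ a, r i a * r₀ a ∂P) := by
      rw [Finset.sum_add_distrib, ← Finset.mul_sum]; ring
    have hnn : 0 ≤ ∑ i, (N ^ 2 * m * |w i| + w i * ∫ a, r i a * r₀ a ∂P) := by
      refine Finset.sum_nonneg fun i _ => ?_
      have h1 := abs_integral_mul_le_sqrt P (hr i) hr₀
      have h2 : √(∫ a, r i a ^ 2 ∂P) * √(∫ a, r₀ a ^ 2 ∂P) ≤ N * (N * m) :=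
        mul_le_mul (h i) h₀ (Real.sqrt_nonneg _) hN
      have h3 : |w i * ∫ a, r i a * r₀ a ∂P| ≤ |w i| * (N * (N * m)) := by
        rw [abs_mul]; gcongr; exact h1.trans h2
      have := (abs_le.1 h3).1
      linarith
    linarith
  have b3 : ∫ a, r₀ a ^ 2 ∂P ≤ N ^ 2 * m ^ 2 := by
    have h0 : 0 ≤ ∫ a, r₀ a ^ 2 ∂P := integral_nonneg fun a => sq_nonneg _
    calc ∫ a, r₀ a ^ 2 ∂P = √(∫ a, r₀ a ^ 2 ∂P) ^ 2 := (Real.sq_sqrt h0).symm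
      _ ≤ (N * m) ^ 2 := by gcongr
      _ = _ := by ring
  linarith

variable {𝒳 : Type*} [MeasurableSpace 𝒳] {n s : ℕ} (ρ : Measure 𝒳) [IsProbabilityMeasure ρ]

/-- Let r be the empirical norm of the feature. Its residual against the other features has norm at
most √(1 + Y)(1 + r), and the leave-one-out factor ζ decreases as r grows. The product keeps the
constant strictly below 4. Only the excess Y of the other features enters, so in the application it
is independent of the feature itself. -/
theorem integral_ridgeRes_feature_sq_le (hn : 0 < n) (hs : 0 < s) {φ : 𝒳 → Fin s → ℝ} {lam Y : ℝ}
    (hlam : 0 < lam) (hlam2 : lam ≤ 1 / 2) (hY : 0 ≤ Y) {x : Fin n → 𝒳}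
    (hφ : ∀ p, BddMeas fun z => φ z p) (hφ1 : ∀ z p, |φ z p| ≤ 1) (p : Fin s)
    (hcov : CovExcessLE ρ (dropFeature φ p) lam x Y) :
    ∫ z, ridgeRes φ lam x (fun y => φ y p) z ^ 2 ∂ρ ≤ (6 * s / (3 * s + 1)) ^ 2 * (1 + Y) := by
  have hs' : (1 : ℝ) ≤ s := by exact_mod_cast hs
  obtain ⟨ζ, hζ0, hζ, he⟩ := ridgeRes_feature hn hs φ hlam x p fun i q => hφ1 _ q
  have hdrop : ∀ q, BddMeas fun z => dropFeature φ p z q := by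
    intro q
    by_cases hq : q = p
    · simpa [dropFeature, hq] using BddMeas.const 0
    · simpa [dropFeature, hq] using hφ q
  have h1 := sqrt_integral_ridgeRes_sq_le_add ρ hn hlam hY hdrop hcov (hφ p)
  set h := (n : ℝ)⁻¹ * ∑ i, φ (x i) p ^ 2 with hh
  set r := √h with hr
  have hh0 : 0 ≤ h := by positivity
  have hr0 : 0 ≤ r := Real.sqrt_nonneg _
  have hrh : r ^ 2 = h := Real.sq_sqrt hh0
  have h2 : √(∫ z, φ z p ^ 2 ∂ρ) ≤ 1 := by
    apply Real.sqrt_le_iff.2 ⟨by norm_num, ?_⟩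
    exact integral_sq_le ρ (hφ p) fun z => hφ1 z p
  have hY1 : 1 ≤ √(1 + Y) := Real.one_le_sqrt.2 (by linarith)
  have h3 : √(∫ z, ridgeRes (dropFeature φ p) lam x (fun y => φ y p) z ^ 2 ∂ρ) ≤
      √(1 + Y) * (1 + r) := by nlinarith
  have hlamζ : ζ * (1 + (s : ℝ)⁻¹ * r ^ 2 * (2 / 3)) ≤ 1 := by
    refine le_trans (mul_le_mul_of_nonneg_left ?_ hζ0) hζ
    rw [hrh]
    have : 2 / 3 ≤ 1 / (1 + lam) := by
      rw [div_le_div_iff₀ (by norm_num) (by linarith)]; linarith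
    have h4 : 0 ≤ (s : ℝ)⁻¹ * h := by positivity
    calc 1 + (s : ℝ)⁻¹ * h * (2 / 3) ≤ 1 + (s : ℝ)⁻¹ * h * (1 / (1 + lam)) := by gcongr
      _ = _ := by ring
  have hkey : ζ * (1 + r) ≤ 6 * s / (3 * s + 1) := by
    have e1 : ζ * (3 * s + 2 * r ^ 2) ≤ 3 * s := by
      have : 3 * s * (ζ * (1 + (s : ℝ)⁻¹ * r ^ 2 * (2 / 3))) = ζ * (3 * s + 2 * r ^ 2) := by
        field_simp
      rw [← this]
      nlinarith
    rw [le_div_iff₀ (by positivity)]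
    -- For r ≤ 1 and s ≥ 1 the difference is at least its value at s = 1, namely (2r - 1)² + 1. The
    -- case r > 1 cannot occur for features bounded by 1.
    have e2 : (1 + r) * (3 * s + 1) ≤ 2 * (3 * s + 2 * r ^ 2) := by
      rcases le_or_gt r 1 with hr1 | hr1
      · nlinarith [sq_nonneg (2 * r - 1), mul_nonneg (sub_nonneg.2 hr1) (sub_nonneg.2 hs')]
      · exfalso
        have : h ≤ 1 := by simpa using mean_sq_le (x := x) hn (fun z => hφ1 z p)
        nlinarith
    nlinarith [mul_le_mul_of_nonneg_left e2 hζ0]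
  simp only [he, mul_pow, integral_const_mul]
  set J := ∫ z, ridgeRes (dropFeature φ p) lam x (fun y => φ y p) z ^ 2 ∂ρ with hJ
  have hJ0 : 0 ≤ J := integral_nonneg fun z => sq_nonneg _
  calc ζ ^ 2 * J = (ζ * √J) ^ 2 := by rw [mul_pow, Real.sq_sqrt hJ0]
    _ ≤ (ζ * (√(1 + Y) * (1 + r))) ^ 2 := by gcongr
    _ = (ζ * (1 + r)) ^ 2 * √(1 + Y) ^ 2 := by ring
    _ ≤ (6 * s / (3 * s + 1)) ^ 2 * √(1 + Y) ^ 2 := by gcongr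
    _ = _ := by rw [Real.sq_sqrt (by linarith)]

variable {𝒱 : Type*} [MeasurableSpace 𝒱] (μ : Measure 𝒱) [IsProbabilityMeasure μ]

/-- The function with coefficients `g` in the feature space `L²(μ)`. -/
noncomputable def featureMean (ψ : 𝒳 → 𝒱 → ℝ) (g : 𝒱 → ℝ) (z : 𝒳) : ℝ := ∫ v, g v * ψ z v ∂μ

/-- The fluctuation of the Monte Carlo approximation of `featureMean`. -/
noncomputable def fluctuation (ψ : 𝒳 → 𝒱 → ℝ) (g : 𝒱 → ℝ) (V : Fin s → 𝒱) (z : 𝒳) : ℝ :=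
  (s : ℝ)⁻¹ * ∑ q, g (V q) * ψ z (V q) - featureMean μ ψ g z

variable {ψ : 𝒳 → 𝒱 → ℝ}

theorem bddMeas_feature (hψ : Measurable (Function.uncurry ψ)) (hψ1 : ∀ z v, |ψ z v| ≤ 1) (v : 𝒱) :
    BddMeas fun z => ψ z v :=
  ⟨hψ.comp (measurable_id.prodMk measurable_const), 1, fun z => hψ1 z v⟩

theorem bddMeas_feature' (hψ : Measurable (Function.uncurry ψ)) (hψ1 : ∀ z v, |ψ z v| ≤ 1) (z : 𝒳) :
    BddMeas fun v => ψ z v :=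
  ⟨hψ.comp (measurable_const.prodMk measurable_id), 1, fun v => hψ1 z v⟩

theorem bddMeas_uncurry (hψ : Measurable (Function.uncurry ψ)) (hψ1 : ∀ z v, |ψ z v| ≤ 1) :
    BddMeas fun q : 𝒳 × 𝒱 => ψ q.1 q.2 := ⟨hψ, 1, fun _ => hψ1 _ _⟩

theorem bddMeas_featureMean (hψ : Measurable (Function.uncurry ψ)) (hψ1 : ∀ z v, |ψ z v| ≤ 1)
    {g : 𝒱 → ℝ} (hg : BddMeas g) : BddMeas (featureMean μ ψ g) :=
  ((hg.comp measurable_snd).mul (bddMeas_uncurry hψ hψ1)).integral_left μ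

theorem bddMeas_fluctuation_prod (hψ : Measurable (Function.uncurry ψ)) (hψ1 : ∀ z v, |ψ z v| ≤ 1)
    {g : 𝒱 → ℝ} (hg : BddMeas g) :
    BddMeas fun q : (Fin s → 𝒱) × 𝒳 => fluctuation μ ψ g q.1 q.2 := by
  have hp : ∀ p : Fin s, Measurable fun q : (Fin s → 𝒱) × 𝒳 => q.1 p := fun p =>
    (measurable_pi_apply p).comp measurable_fst
  refine BddMeas.sub (BddMeas.const_mul _ (BddMeas.sum _ fun p => (hg.comp (hp p)).mul
    ((bddMeas_uncurry hψ hψ1).comp (measurable_snd.prodMk (hp p))))) ?_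
  exact (bddMeas_featureMean μ hψ hψ1 hg).comp measurable_snd

theorem bddMeas_fluctuation (hψ : Measurable (Function.uncurry ψ)) (hψ1 : ∀ z v, |ψ z v| ≤ 1)
    {g : 𝒱 → ℝ} (hg : BddMeas g) (V : Fin s → 𝒱) : BddMeas (fluctuation μ ψ g V) :=
  (bddMeas_fluctuation_prod μ hψ hψ1 hg).comp (measurable_const.prodMk measurable_id)

theorem abs_featureMean_le (hψ : Measurable (Function.uncurry ψ)) (hψ1 : ∀ z v, |ψ z v| ≤ 1)
    {g : 𝒱 → ℝ} (hg : BddMeas g) (z : 𝒳) : |featureMean μ ψ g z| ≤ ∫ v, |g v| ∂μ := by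
  refine (abs_integral_le_integral_abs).trans ?_
  refine integral_mono ((hg.mul (bddMeas_feature' hψ hψ1 z)).abs.integrable μ)
    (hg.abs.integrable μ) fun v => ?_
  simp only [abs_mul]
  exact mul_le_of_le_one_right (abs_nonneg _) (hψ1 z v)

theorem abs_fluctuation_le (hψ : Measurable (Function.uncurry ψ)) (hψ1 : ∀ z v, |ψ z v| ≤ 1)
    {g : 𝒱 → ℝ} (hg : BddMeas g) (V : Fin s → 𝒱) (z : 𝒳) :
    |fluctuation μ ψ g V z| ≤ ∫ v, |g v| ∂μ + (s : ℝ)⁻¹ * ∑ q, |g (V q)| := by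
  have h1 : |(s : ℝ)⁻¹ * ∑ q, g (V q) * ψ z (V q)| ≤ (s : ℝ)⁻¹ * ∑ q, |g (V q)| := by
    rw [abs_mul, abs_of_nonneg (by positivity : (0 : ℝ) ≤ (s : ℝ)⁻¹)]
    refine mul_le_mul_of_nonneg_left ((Finset.abs_sum_le_sum_abs _ _).trans
      (Finset.sum_le_sum fun q _ => ?_)) (by positivity)
    rw [abs_mul]
    exact mul_le_of_le_one_right (abs_nonneg _) (hψ1 z _)
  have h2 := abs_featureMean_le μ hψ hψ1 hg z
  have h3 := abs_sub ((s : ℝ)⁻¹ * ∑ q, g (V q) * ψ z (V q)) (featureMean μ ψ g z)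
  unfold fluctuation
  linarith

theorem fluctuation_add (hψ : Measurable (Function.uncurry ψ)) (hψ1 : ∀ z v, |ψ z v| ≤ 1)
    {g g' : 𝒱 → ℝ} (hg : BddMeas g) (hg' : BddMeas g') (V : Fin s → 𝒱) (z : 𝒳) :
    fluctuation μ ψ (fun v => g v + g' v) V z =
      fluctuation μ ψ g V z + fluctuation μ ψ g' V z := by
  have hz := bddMeas_feature' hψ hψ1 z
  simp only [fluctuation, featureMean, add_mul, Finset.sum_add_distrib, mul_add]
  rw [integral_add ((hg.mul hz).integrable μ) ((hg'.mul hz).integrable μ)]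
  ring

/-- The `L²(ρ)` norm of the ridge residual of a fluctuation, for coefficients split in two parts. -/
theorem integral_ridgeRes_fluctuation_sq_le (hn : 0 < n) (hs : 0 < s)
    (hψ : Measurable (Function.uncurry ψ)) (hψ1 : ∀ z v, |ψ z v| ≤ 1) {g₁ g₂ : 𝒱 → ℝ}
    (hg₁ : BddMeas g₁) (hg₂ : BddMeas g₂) {lam X : ℝ} (hlam : 0 < lam) (hlam2 : lam ≤ 1 / 2)
    (hX : 0 ≤ X) {x : Fin n → 𝒳} {V : Fin s → 𝒱} {Y : Fin s → ℝ} (hY : ∀ p, 0 ≤ Y p)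
    (hcov : CovExcessLE ρ (fun z p => ψ z (V p)) lam x X)
    (hcovY : ∀ p, CovExcessLE ρ (dropFeature (fun z p => ψ z (V p)) p) lam x (Y p)) :
    ∫ z, ridgeRes (fun z p => ψ z (V p)) lam x
        (fun z => fluctuation μ ψ g₁ V z + fluctuation μ ψ g₂ V z) z ^ 2 ∂ρ ≤
      ∫ z, fluctuation μ ψ g₁ V z ^ 2 ∂ρ +
      (n : ℝ)⁻¹ * ∑ i, fluctuation μ ψ g₁ V (x i) ^ 2 +
      X * (∫ v, |g₁ v| ∂μ + (s : ℝ)⁻¹ * ∑ q, |g₁ (V q)|) ^ 2 +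
      (s : ℝ)⁻¹ * ∑ p, sampleDev ρ x (fluctuation μ ψ g₁ V) (fun z => ψ z (V p)) ^ 2 / (4 * lam) +
      8 * (1 + X) * ((∫ v, |g₁ v| ∂μ + (s : ℝ)⁻¹ * ∑ q, |g₁ (V q)|) *
        (∫ v, |g₂ v| ∂μ + (s : ℝ)⁻¹ * ∑ q, |g₂ (V q)|)) +
      (∑ p, ((s : ℝ)⁻¹ * g₂ (V p)) ^ 2 * ((6 * s / (3 * s + 1)) ^ 2 * (1 + Y p)) +
      4 * (1 + X) * (∑ p, ∑ r, (if p = r then 0 else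
        |(s : ℝ)⁻¹ * g₂ (V p)| * |(s : ℝ)⁻¹ * g₂ (V r)|) +
        2 * (∫ v, |g₂ v| ∂μ) * ∑ p, |(s : ℝ)⁻¹ * g₂ (V p)| + (∫ v, |g₂ v| ∂μ) ^ 2)) := by
  set φ : 𝒳 → Fin s → ℝ := fun z p => ψ z (V p) with hφdef
  have hφ : ∀ p, BddMeas fun z => φ z p := fun p => bddMeas_feature hψ hψ1 (V p)
  have hφ1 : ∀ z p, |φ z p| ≤ 1 := fun z p => hψ1 z _
  set a₁ := fluctuation μ ψ g₁ V with ha₁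
  set a₂ := fluctuation μ ψ g₂ V with ha₂
  have hb₁ : BddMeas a₁ := bddMeas_fluctuation μ hψ hψ1 hg₁ V
  have hb₂ : BddMeas a₂ := bddMeas_fluctuation μ hψ hψ1 hg₂ V
  set G₁ := ∫ v, |g₁ v| ∂μ + (s : ℝ)⁻¹ * ∑ q, |g₁ (V q)| with hG₁
  set G₂ := ∫ v, |g₂ v| ∂μ + (s : ℝ)⁻¹ * ∑ q, |g₂ (V q)| with hG₂
  set m₂ := ∫ v, |g₂ v| ∂μ with hm₂
  have hm₂0 : 0 ≤ m₂ := integral_nonneg fun v => abs_nonneg _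
  have hM₁ : ∀ z, |a₁ z| ≤ G₁ := abs_fluctuation_le μ hψ hψ1 hg₁ V
  have hM₂ : ∀ z, |a₂ z| ≤ G₂ := abs_fluctuation_le μ hψ hψ1 hg₂ V
  have hr₁ := bddMeas_ridgeRes (lam := lam) (x := x) hφ hb₁
  have hr₂ := bddMeas_ridgeRes (lam := lam) (x := x) hφ hb₂
  have n₁ := sqrt_integral_ridgeRes_sq_le ρ hn hlam hX hφ hcov hb₁ hM₁
  have n₂ := sqrt_integral_ridgeRes_sq_le ρ hn hlam hX hφ hcov hb₂ hM₂
  have hG₁0 : 0 ≤ G₁ := (abs_nonneg _).trans (hM₁ (x ⟨0, hn⟩))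
  have hG₂0 : 0 ≤ G₂ := (abs_nonneg _).trans (hM₂ (x ⟨0, hn⟩))
  have hsq : √(1 + X) * √(1 + X) = 1 + X := Real.mul_self_sqrt (by linarith)
  have e1 : ∫ z, ridgeRes φ lam x (fun z => a₁ z + a₂ z) z ^ 2 ∂ρ =
      ∫ z, ridgeRes φ lam x a₁ z ^ 2 ∂ρ +
        2 * ∫ z, ridgeRes φ lam x a₁ z * ridgeRes φ lam x a₂ z ∂ρ +
        ∫ z, ridgeRes φ lam x a₂ z ^ 2 ∂ρ := by
    have : ∀ z, ridgeRes φ lam x (fun z => a₁ z + a₂ z) z ^ 2 = ridgeRes φ lam x a₁ z ^ 2 +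
        2 * (ridgeRes φ lam x a₁ z * ridgeRes φ lam x a₂ z) + ridgeRes φ lam x a₂ z ^ 2 := by
      intro z; rw [ridgeRes_add]; ring
    simp only [this]
    rw [integral_add ((hr₁.pow 2).add ((hr₁.mul hr₂).const_mul 2) |>.integrable ρ)
      ((hr₂.pow 2).integrable ρ), integral_add ((hr₁.pow 2).integrable ρ)
      ((hr₁.mul hr₂).const_mul 2 |>.integrable ρ), integral_const_mul]
  have b1 := integral_ridgeRes_sq_le ρ hn hlam hX hφ hcov hb₁
  have b1' : X * ((n : ℝ)⁻¹ * ∑ i, a₁ (x i) ^ 2) ≤ X * G₁ ^ 2 :=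
    mul_le_mul_of_nonneg_left (mean_sq_le hn hM₁) hX
  -- A crude bound suffices for the mixed term: in the mean, G₂ is small against ‖g₂‖ except for its
  -- diagonal terms, and those meet g₁ at the same feature, where g₁g₂ will vanish.
  have b2 : 2 * ∫ z, ridgeRes φ lam x a₁ z * ridgeRes φ lam x a₂ z ∂ρ ≤
      8 * (1 + X) * (G₁ * G₂) := by
    have h1 := integral_mul_le_sqrt ρ hr₁ hr₂
    have h2 := mul_le_mul n₁ n₂ (Real.sqrt_nonneg _) (by positivity)
    have h3 : 2 * √(1 + X) * G₁ * (2 * √(1 + X) * G₂) = 4 * (1 + X) * (G₁ * G₂) := by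
      linear_combination 4 * G₁ * G₂ * hsq
    linarith
  have b3 := integral_sum_sub_sq_le ρ (r := fun p => ridgeRes φ lam x (fun z => φ z p))
    (r₀ := ridgeRes φ lam x (featureMean μ ψ g₂)) (fun p => bddMeas_ridgeRes hφ (hφ p))
    (bddMeas_ridgeRes hφ (bddMeas_featureMean μ hψ hψ1 hg₂)) (fun p => (s : ℝ)⁻¹ * g₂ (V p))
    (fun p => (6 * s / (3 * s + 1)) ^ 2 * (1 + Y p)) (N := 2 * √(1 + X)) (m := m₂)
    (by positivity)
    (fun p => integral_ridgeRes_feature_sq_le ρ hn hs hlam hlam2 (hY p) hφ hφ1 p (hcovY p))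
    (fun p => by
      simpa using sqrt_integral_ridgeRes_sq_le ρ hn hlam hX hφ hcov (hφ p) (fun z => hφ1 z p))
    (sqrt_integral_ridgeRes_sq_le ρ hn hlam hX hφ hcov (bddMeas_featureMean μ hψ hψ1 hg₂)
      (abs_featureMean_le μ hψ hψ1 hg₂))
  -- The fluctuation of g₂ is a combination of the regressors themselves minus its mean, so its
  -- residual is expressed through the residuals of single features.
  have e2 : ∀ z, ridgeRes φ lam x a₂ z = ∑ p, (s : ℝ)⁻¹ * g₂ (V p) *
      ridgeRes φ lam x (fun z => φ z p) z - ridgeRes φ lam x (featureMean μ ψ g₂) z := by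
    intro z
    have : a₂ = fun z => ∑ p, (s : ℝ)⁻¹ * g₂ (V p) * φ z p - featureMean μ ψ g₂ z := by
      funext z
      simp only [ha₂, fluctuation, Finset.mul_sum, hφdef, mul_assoc]
    rw [this, ridgeRes_sub, ridgeRes_sum]
    simp only [ridgeRes_smul]
  have e3 : (2 * √(1 + X)) ^ 2 = 4 * (1 + X) := by
    rw [mul_pow, sq (√(1 + X)), hsq]; norm_num
  simp only [← e2, e3] at b3
  rw [e1]
  linarith

end Pointwise

/-! ### Calculus of upper bounds for means. -/

/-- `F` is bounded and measurable, with mean at most `c`. -/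
def MeanLE {α : Type*} [MeasurableSpace α] (P : Measure α) (F : α → ℝ) (c : ℝ) : Prop :=
  BddMeas F ∧ ∫ a, F a ∂P ≤ c

namespace MeanLE

variable {α : Type*} [MeasurableSpace α] {P : Measure α} {F G : α → ℝ} {c d : ℝ}

theorem mono (h : MeanLE P F c) (hcd : c ≤ d) : MeanLE P F d := ⟨h.1, h.2.trans hcd⟩

theorem const_mul (hF : MeanLE P F c) {k : ℝ} (hk : 0 ≤ k) :
    MeanLE P (fun a => k * F a) (k * c) := by
  refine ⟨hF.1.const_mul k, ?_⟩
  rw [integral_const_mul]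
  exact mul_le_mul_of_nonneg_left hF.2 hk

variable [IsProbabilityMeasure P]

theorem of_le (hF : BddMeas F) (hG : MeanLE P G c) (h : ∀ a, F a ≤ G a) : MeanLE P F c :=
  ⟨hF, (integral_mono (hF.integrable P) (hG.1.integrable P) h).trans hG.2⟩

theorem const (c : ℝ) : MeanLE P (fun _ => c) c := ⟨BddMeas.const c, by simp⟩

theorem add (hF : MeanLE P F c) (hG : MeanLE P G d) : MeanLE P (fun a => F a + G a) (c + d) := by
  refine ⟨hF.1.add hG.1, ?_⟩
  rw [integral_add (hF.1.integrable P) (hG.1.integrable P)]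
  exact add_le_add hF.2 hG.2

theorem sum {ι : Type*} [Fintype ι] {F : ι → α → ℝ} {c : ι → ℝ}
    (hF : ∀ i, MeanLE P (F i) (c i)) : MeanLE P (fun a => ∑ i, F i a) (∑ i, c i) := by
  refine ⟨BddMeas.sum _ fun i => (hF i).1, ?_⟩
  rw [integral_finsetSum _ fun i _ => (hF i).1.integrable P]
  exact Finset.sum_le_sum fun i _ => (hF i).2

/-- Cauchy--Schwarz. -/
theorem mul {x : ℝ} (hF : MeanLE P (fun a => F a ^ 2) (x ^ 2)) (hx : 0 ≤ x) (hFm : BddMeas F)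
    (hGm : BddMeas G) (hG : ∫ a, G a ^ 2 ∂P ≤ d ^ 2) (hd : 0 ≤ d) :
    MeanLE P (fun a => F a * G a) (x * d) := by
  refine ⟨hFm.mul hGm, (integral_mul_le_sqrt P hFm hGm).trans ?_⟩
  exact mul_le_mul (Real.sqrt_le_iff.2 ⟨hx, hF.2⟩) (Real.sqrt_le_iff.2 ⟨hd, hG⟩)
    (Real.sqrt_nonneg _) hx

theorem one_add_mul {x : ℝ} (hF : MeanLE P (fun a => F a ^ 2) (x ^ 2)) (hx : 0 ≤ x)
    (hFm : BddMeas F) (hGm : BddMeas G) (hGc : ∫ a, G a ∂P ≤ c) (hG : ∫ a, G a ^ 2 ∂P ≤ d ^ 2)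
    (hd : 0 ≤ d) : MeanLE P (fun a => (1 + F a) * G a) (c + x * d) := by
  have h := MeanLE.add (P := P) ⟨hGm, hGc⟩ (hF.mul hx hFm hGm hG hd)
  refine ⟨by simpa [add_mul] using h.1, le_trans (le_of_eq ?_) h.2⟩
  simp [add_mul]

end MeanLE

/-! ### Moments of the covariance excess under random features. -/

section Energy

variable {𝒱 : Type*} [MeasurableSpace 𝒱] (μ : Measure 𝒱) [IsProbabilityMeasure μ] {s : ℕ}
  {T : 𝒱 → 𝒱 → ℝ} {n lam h Θ : ℝ}

theorem bddMeas_kernel_eval (hT : BddMeas fun q : 𝒱 × 𝒱 => T q.1 q.2) (p r : Fin s) :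
    BddMeas fun V : Fin s → 𝒱 => T (V p) (V r) :=
  BddMeas.comp (h := fun V : Fin s → 𝒱 => (V p, V r)) hT
    ((measurable_pi_apply p).prodMk (measurable_pi_apply r))

theorem bddMeas_kernel_exp (hT : BddMeas fun q : 𝒱 × 𝒱 => T q.1 q.2) (c : ℝ) :
    BddMeas fun q : 𝒱 × 𝒱 => Real.exp (c * T q.1 q.2 ^ 2) :=
  ((hT.pow 2).const_mul c).exp

theorem bddMeas_devEnergy {t : (Fin s → 𝒱) → Fin s → Fin s → ℝ}
    (ht : ∀ p r, BddMeas fun V => t V p r) : BddMeas fun V => devEnergy n (t V) :=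
  BddMeas.sum _ fun p => BddMeas.sum _ fun r => (((ht p r).pow 2).const_mul _).exp.const_mul _

theorem bddMeas_devExcess {t : (Fin s → 𝒱) → Fin s → Fin s → ℝ}
    (ht : ∀ p r, BddMeas fun V => t V p r) : BddMeas fun V => devExcess n lam (t V) :=
  ((bddMeas_devEnergy ht).const_mul _).sqrt.const_mul _

theorem devWeight_nonneg (hs : 0 < s) (p r : Fin s) :
    (0 : ℝ) ≤ (if p = r then 1 else 4) / (s * (4 * s - 3)) := by
  have h3 := four_mul_sub_three_pos hs
  have : (0 : ℝ) ≤ if p = r then 1 else 4 := by split_ifs <;> norm_num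
  positivity

theorem meanLE_devEnergy_mul (hs : 0 < s) (hT : BddMeas fun q : 𝒱 × 𝒱 => T q.1 q.2)
    {Z : (Fin s → 𝒱) → ℝ} (hZ : BddMeas Z) {c : ℝ}
    (h1 : ∀ p, ∫ V, Real.exp (3 / 2 * n * T (V p) (V p) ^ 2) * Z V
      ∂(Measure.pi fun _ : Fin s => μ) ≤ c)
    (h2 : ∀ p r, p ≠ r → ∫ V, Real.exp (3 / 8 * n * T (V p) (V r) ^ 2) * Z V
      ∂(Measure.pi fun _ : Fin s => μ) ≤ c) :
    MeanLE (Measure.pi fun _ : Fin s => μ)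
      (fun V => devEnergy n (fun p r => T (V p) (V r)) * Z V) c := by
  have hsum := MeanLE.sum (P := Measure.pi fun _ : Fin s => μ)
    (F := fun (q : Fin s × Fin s) V => (if q.1 = q.2 then 1 else 4) / (s * (4 * s - 3)) *
      (Real.exp ((if q.1 = q.2 then 3 / 2 else 3 / 8) * n * T (V q.1) (V q.2) ^ 2) * Z V))
    (c := fun q => (if q.1 = q.2 then 1 else 4) / (s * (4 * s - 3)) * c)
    fun q => MeanLE.const_mul (k := (if q.1 = q.2 then 1 else 4) / (s * (4 * s - 3)))
      ⟨BddMeas.mul ((((bddMeas_kernel_eval hT q.1 q.2).pow 2).const_mul _).exp) hZ, by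
        by_cases hq : q.1 = q.2
        · simp only [hq, if_true]; exact h1 _
        · simp only [hq, if_false]; exact h2 _ _ hq⟩ (devWeight_nonneg hs _ _)
  rw [← Finset.sum_mul, Fintype.sum_prod_type, devWeight_sum hs, one_mul] at hsum
  refine ⟨(bddMeas_devEnergy (bddMeas_kernel_eval hT)).mul hZ, le_trans (le_of_eq ?_) hsum.2⟩
  congr 1
  funext V
  simp only [devEnergy, Fintype.sum_prod_type, Finset.sum_mul, mul_assoc]

theorem meanLE_devEnergy (hs : 0 < s) (hT : BddMeas fun q : 𝒱 × 𝒱 => T q.1 q.2)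
    (h1 : ∫ v, Real.exp (3 / 2 * n * T v v ^ 2) ∂μ ≤ h)
    (h2 : ∫ v, ∫ w, Real.exp (3 / 8 * n * T v w ^ 2) ∂μ ∂μ ≤ h) :
    MeanLE (Measure.pi fun _ : Fin s => μ) (fun V => devEnergy n (fun p r => T (V p) (V r))) h := by
  have := meanLE_devEnergy_mul μ (n := n) hs hT (BddMeas.const 1) (c := h)
    (fun p => by
      simp only [mul_one]
      rw [integral_pi_eval μ p (k := fun v => Real.exp (3 / 2 * n * T v v ^ 2))
        ((bddMeas_kernel_exp hT _).comp (measurable_id.prodMk measurable_id))]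
      exact h1)
    (fun p r hpr => by
      simp only [mul_one]
      rw [integral_pi_eval_pair μ hpr (k := fun q => Real.exp (3 / 8 * n * T q.1 q.2 ^ 2))
        (bddMeas_kernel_exp hT _)]
      exact h2)
  simpa using this

/-- An entry not involving index q is independent of k(V q) and is controlled by the global moments.
An entry involving q is controlled, conditionally on V q, by the pointwise bounds on the support of
k. Truncating the coefficients to typical features is what provides these bounds. -/
theorem meanLE_devEnergy_mul_eval (hs : 0 < s) (hT : BddMeas fun q : 𝒱 × 𝒱 => T q.1 q.2)
    (hsymm : ∀ v w, T v w = T w v)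
    (h1 : ∫ v, Real.exp (3 / 2 * n * T v v ^ 2) ∂μ ≤ Θ)
    (h2 : ∫ v, ∫ w, Real.exp (3 / 8 * n * T v w ^ 2) ∂μ ∂μ ≤ Θ) {k : 𝒱 → ℝ} (hk : BddMeas k)
    (hk0 : ∀ v, 0 ≤ k v) (hk1 : ∀ v, Real.exp (3 / 2 * n * T v v ^ 2) * k v ≤ Θ * k v)
    (hk2 : ∀ v, (∫ w, Real.exp (3 / 8 * n * T v w ^ 2) ∂μ) * k v ≤ Θ * k v) (q : Fin s) :
    MeanLE (Measure.pi fun _ : Fin s => μ)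
      (fun V => devEnergy n (fun p r => T (V p) (V r)) * k (V q)) (Θ * ∫ v, k v ∂μ) := by
  have hI : 0 ≤ ∫ v, k v ∂μ := integral_nonneg hk0
  have hd : BddMeas fun v => Real.exp (3 / 2 * n * T v v ^ 2) :=
    (bddMeas_kernel_exp hT _).comp (measurable_id.prodMk measurable_id)
  have he := bddMeas_kernel_exp hT (3 / 8 * n)
  have hpair : ∀ p, p ≠ q → ∫ V, Real.exp (3 / 8 * n * T (V q) (V p) ^ 2) * k (V q)
      ∂(Measure.pi fun _ : Fin s => μ) ≤ Θ * ∫ v, k v ∂μ := by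
    intro p hp
    rw [integral_pi_eval_pair μ hp.symm (k := fun z => Real.exp (3 / 8 * n * T z.1 z.2 ^ 2) * k z.1)
      (he.mul (hk.comp measurable_fst)), ← integral_const_mul]
    refine integral_mono ((he.mul (hk.comp measurable_fst)).integral_left μ |>.integrable μ)
      ((hk.const_mul Θ).integrable μ) fun v => ?_
    simp only [integral_mul_const]
    exact hk2 v
  refine meanLE_devEnergy_mul μ hs hT (hk.comp (measurable_pi_apply q)) (fun p => ?_)
    fun p r hpr => ?_
  · by_cases hpq : p = q
    · subst hpq
      rw [integral_pi_eval μ p (k := fun v => Real.exp (3 / 2 * n * T v v ^ 2) * k v)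
        (hd.mul hk), ← integral_const_mul]
      exact integral_mono ((hd.mul hk).integrable μ) ((hk.const_mul Θ).integrable μ) hk1
    · rw [integral_pi_eval_mul μ p (k := fun v => Real.exp (3 / 2 * n * T v v ^ 2))
        (F := fun V => k (V q)) hd (hk.comp (measurable_pi_apply q))
        (fun V v => by rw [Function.update_of_ne (Ne.symm hpq)]), integral_pi_eval μ q hk]
      exact mul_le_mul_of_nonneg_right h1 hI
  · by_cases hpq : p = q
    · subst hpq
      exact hpair r hpr.symm
    by_cases hrq : r = q
    · subst hrq
      simp only [fun V : Fin s → 𝒱 => hsymm (V p) (V r)]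
      exact hpair p hpr
    · simp only [mul_comm _ (k _)]
      rw [integral_pi_eval_mul μ q hk
        (F := fun V => Real.exp (3 / 8 * n * T (V p) (V r) ^ 2))
        (((bddMeas_kernel_eval hT p r).pow 2).const_mul _).exp
        (fun V v => by rw [Function.update_of_ne hpq, Function.update_of_ne hrq]), mul_comm,
        integral_pi_eval_pair μ hpr (k := fun q => Real.exp (3 / 8 * n * T q.1 q.2 ^ 2)) he]
      exact mul_le_mul_of_nonneg_right h2 hI

theorem devExcess_sq (hs : 0 < s) (t : Fin s → Fin s → ℝ) :
    devExcess n lam t ^ 2 =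
      1 / 400 * Real.exp (-(4 * devRate s * n * lam ^ 2)) * devEnergy n t := by
  have := devEnergy_nonneg hs n t
  rw [devExcess, mul_pow, Real.sq_sqrt (by positivity)]
  ring

/-- The `L²` norm of `devExcess` if `devEnergy` has mean `h`. -/
noncomputable def devScale (s : ℕ) (n lam h : ℝ) : ℝ :=
  1 / 20 * √(Real.exp (-(4 * devRate s * n * lam ^ 2)) * h)

theorem devScale_nonneg (s : ℕ) (n lam h : ℝ) : 0 ≤ devScale s n lam h := by
  unfold devScale; positivity

theorem devScale_sq (hh : 0 ≤ h) : devScale s n lam h ^ 2 =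
    1 / 400 * Real.exp (-(4 * devRate s * n * lam ^ 2)) * h := by
  rw [devScale, mul_pow, Real.sq_sqrt (by positivity)]
  ring

theorem meanLE_devExcess_sq (hs : 0 < s) (hT : BddMeas fun q : 𝒱 × 𝒱 => T q.1 q.2) (hh : 0 ≤ h)
    (h1 : ∫ v, Real.exp (3 / 2 * n * T v v ^ 2) ∂μ ≤ h)
    (h2 : ∫ v, ∫ w, Real.exp (3 / 8 * n * T v w ^ 2) ∂μ ∂μ ≤ h) :
    MeanLE (Measure.pi fun _ : Fin s => μ)
      (fun V => devExcess n lam (fun p r => T (V p) (V r)) ^ 2) (devScale s n lam h ^ 2) := by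
  simp only [devExcess_sq hs, devScale_sq hh]
  exact (meanLE_devEnergy μ hs hT h1 h2).const_mul (by positivity)

/-- Write the integrand as (X g(V q)) · g(V q) and apply Cauchy–Schwarz; the square of the first
factor is a multiple of `devEnergy` times g(V q)², so no fourth moment of g is needed. -/
theorem meanLE_devExcess_sq_mul_eval (hs : 0 < s) (hT : BddMeas fun q : 𝒱 × 𝒱 => T q.1 q.2)
    (hsymm : ∀ v w, T v w = T w v) (hΘ : 0 ≤ Θ)
    (h1 : ∫ v, Real.exp (3 / 2 * n * T v v ^ 2) ∂μ ≤ Θ)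
    (h2 : ∫ v, ∫ w, Real.exp (3 / 8 * n * T v w ^ 2) ∂μ ∂μ ≤ Θ) {g : 𝒱 → ℝ} (hg : BddMeas g)
    (hg1 : ∀ v, g v ≠ 0 → Real.exp (3 / 2 * n * T v v ^ 2) ≤ Θ)
    (hg2 : ∀ v, g v ≠ 0 → ∫ w, Real.exp (3 / 8 * n * T v w ^ 2) ∂μ ≤ Θ) (q : Fin s) :
    MeanLE (Measure.pi fun _ : Fin s => μ)
      (fun V => devExcess n lam (fun p r => T (V p) (V r)) * g (V q) ^ 2)
      (devScale s n lam Θ * ∫ v, g v ^ 2 ∂μ) := by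
  have hX := bddMeas_devExcess (n := n) (lam := lam) (bddMeas_kernel_eval (s := s) hT)
  have hgq : BddMeas fun V : Fin s → 𝒱 => g (V q) := hg.comp (measurable_pi_apply q)
  have hN : 0 ≤ ∫ v, g v ^ 2 ∂μ := integral_nonneg fun v => sq_nonneg _
  have key : ∀ (f : ℝ) (v : 𝒱), (g v ≠ 0 → f ≤ Θ) → f * g v ^ 2 ≤ Θ * g v ^ 2 := by
    intro f v hf
    by_cases hv : g v = 0
    · simp [hv]
    · exact mul_le_mul_of_nonneg_right (hf hv) (sq_nonneg _)
  have hE := (meanLE_devEnergy_mul_eval μ hs hT hsymm h1 h2 (hg.pow 2) (fun v => sq_nonneg _)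
    (fun v => key _ v (hg1 v)) (fun v => key _ v (hg2 v)) q).const_mul
      (k := 1 / 400 * Real.exp (-(4 * devRate s * n * lam ^ 2))) (by positivity)
  have hF : MeanLE (Measure.pi fun _ : Fin s => μ)
      (fun V => (devExcess n lam (fun p r => T (V p) (V r)) * g (V q)) ^ 2)
      ((devScale s n lam Θ * √(∫ v, g v ^ 2 ∂μ)) ^ 2) := by
    refine ⟨(hX.mul hgq).pow 2, le_trans (le_of_eq ?_) (hE.2.trans (le_of_eq ?_))⟩
    · congr 1; funext V; simp only [mul_pow, devExcess_sq hs]; ring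
    · rw [mul_pow, devScale_sq hΘ, Real.sq_sqrt hN]; ring
  have := hF.mul (mul_nonneg (devScale_nonneg _ _ _ _) (Real.sqrt_nonneg _)) (hX.mul hgq) hgq
    (d := √(∫ v, g v ^ 2 ∂μ)) (by
      rw [Real.sq_sqrt hN, integral_pi_eval μ q (k := fun v => g v ^ 2) (hg.pow 2)])
    (Real.sqrt_nonneg _)
  rw [mul_assoc, Real.mul_self_sqrt hN] at this
  simpa [sq, mul_assoc] using this

end Energy

/-! ### Variance of Monte Carlo fluctuations. -/

section Variance

variable {𝒱 : Type*} [MeasurableSpace 𝒱] (μ : Measure 𝒱) [IsProbabilityMeasure μ] {s : ℕ}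

theorem integral_sub_integral_sq_le {f : 𝒱 → ℝ} (hf : BddMeas f) :
    ∫ v, (f v - ∫ w, f w ∂μ) ^ 2 ∂μ ≤ ∫ v, f v ^ 2 ∂μ := by
  set m := ∫ w, f w ∂μ with hm
  have e : ∀ v, (f v - m) ^ 2 = f v ^ 2 - 2 * m * f v + m ^ 2 := fun v => by ring
  simp only [e]
  rw [integral_add ((hf.pow 2).sub (hf.const_mul _) |>.integrable μ) (integrable_const _),
    integral_sub ((hf.pow 2).integrable μ) (hf.const_mul _ |>.integrable μ), integral_const_mul,
    ← hm]
  simp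
  nlinarith [sq_nonneg m]

theorem integral_pi_mean_sub_sq_le (hs : 0 < s) {k : 𝒱 → ℝ} (hk : BddMeas k) :
    ∫ V, ((s : ℝ)⁻¹ * ∑ q, k (V q) - ∫ v, k v ∂μ) ^ 2 ∂(Measure.pi fun _ : Fin s => μ) ≤
      (s : ℝ)⁻¹ * ∫ v, k v ^ 2 ∂μ := by
  have hs' : (0 : ℝ) < s := by exact_mod_cast hs
  set m := ∫ v, k v ∂μ with hm
  have hkm : BddMeas fun v => (s : ℝ)⁻¹ * (k v - m) := (hk.sub (BddMeas.const m)).const_mul _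
  have e : ∀ V : Fin s → 𝒱, (s : ℝ)⁻¹ * ∑ q, k (V q) - m = ∑ q, (s : ℝ)⁻¹ * (k (V q) - m) := by
    intro V
    rw [← Finset.mul_sum, Finset.sum_sub_distrib]
    simp
    field_simp
  simp only [e]
  have h0 : ∫ v, (s : ℝ)⁻¹ * (k v - m) ∂μ = 0 := by
    rw [integral_const_mul, integral_sub (hk.integrable μ) (integrable_const _)]
    simp [hm]
  rw [integral_sum_sq_of_orthogonal (Measure.pi fun _ : Fin s => μ)
    (Y := fun q V => (s : ℝ)⁻¹ * (k (V q) - m)) (fun q => hkm.comp (measurable_pi_apply q))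
    fun i j hij => by
      rw [integral_pi_eval_mul μ i (F := fun V => (s : ℝ)⁻¹ * (k (V j) - m)) hkm
        (hkm.comp (measurable_pi_apply j)) (fun V v => by rw [Function.update_of_ne hij.symm]), h0,
        zero_mul]]
  have h1 : ∀ q : Fin s, ∫ V, ((s : ℝ)⁻¹ * (k (V q) - m)) ^ 2 ∂(Measure.pi fun _ : Fin s => μ) ≤
      (s : ℝ)⁻¹ ^ 2 * ∫ v, k v ^ 2 ∂μ := by
    intro q
    rw [integral_pi_eval μ q (k := fun v => ((s : ℝ)⁻¹ * (k v - m)) ^ 2) (hkm.pow 2)]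
    simp only [mul_pow]
    rw [integral_const_mul]
    exact mul_le_mul_of_nonneg_left (integral_sub_integral_sq_le μ hk) (by positivity)
  refine (Finset.sum_le_sum fun q _ => h1 q).trans (le_of_eq ?_)
  simp
  field_simp

variable {𝒳 : Type*} [MeasurableSpace 𝒳] {n : ℕ} (ρ : Measure 𝒳) [IsProbabilityMeasure ρ]
  {ψ : 𝒳 → 𝒱 → ℝ}

theorem meanLE_fluctuation_sq (hs : 0 < s) (hψ : Measurable (Function.uncurry ψ))
    (hψ1 : ∀ z v, |ψ z v| ≤ 1) {g : 𝒱 → ℝ} (hg : BddMeas g) (z : 𝒳) :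
    MeanLE (Measure.pi fun _ : Fin s => μ) (fun V => fluctuation μ ψ g V z ^ 2)
      ((s : ℝ)⁻¹ * ∫ v, g v ^ 2 ∂μ) := by
  have hb : BddMeas fun V : Fin s → 𝒱 => fluctuation μ ψ g V z :=
    BddMeas.comp (h := fun V : Fin s → 𝒱 => (V, z)) (bddMeas_fluctuation_prod μ hψ hψ1 hg)
      (measurable_id.prodMk measurable_const)
  have hk := hg.mul (bddMeas_feature' hψ hψ1 z)
  refine ⟨hb.pow 2, (integral_pi_mean_sub_sq_le μ hs hk).trans ?_⟩
  refine mul_le_mul_of_nonneg_left (integral_mono ((hk.pow 2).integrable μ)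
    ((hg.pow 2).integrable μ) fun v => ?_) (by positivity)
  simp only [mul_pow]
  exact mul_le_of_le_one_right (sq_nonneg _) ((sq_le_one_iff_abs_le_one _).2 (hψ1 z v))

theorem meanLE_integral_fluctuation_sq (hs : 0 < s) (hψ : Measurable (Function.uncurry ψ))
    (hψ1 : ∀ z v, |ψ z v| ≤ 1) {g : 𝒱 → ℝ} (hg : BddMeas g) :
    MeanLE (Measure.pi fun _ : Fin s => μ) (fun V => ∫ z, fluctuation μ ψ g V z ^ 2 ∂ρ)
      ((s : ℝ)⁻¹ * ∫ v, g v ^ 2 ∂μ) := by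
  have hb := (bddMeas_fluctuation_prod (s := s) μ hψ hψ1 hg).pow 2
  refine ⟨hb.integral_left ρ, ?_⟩
  rw [integral_integral_swap (hb.integrable _)]
  have := integral_mono (μ := ρ) ((BddMeas.integral_left (f := fun q : 𝒳 × (Fin s → 𝒱) =>
    fluctuation μ ψ g q.2 q.1 ^ 2) (hb.comp measurable_swap) _).integrable ρ)
    (integrable_const ((s : ℝ)⁻¹ * ∫ v, g v ^ 2 ∂μ))
    fun z => (meanLE_fluctuation_sq μ hs hψ hψ1 hg z).2
  simpa using this

theorem meanLE_mean_fluctuation_sq (hn : 0 < n) (hs : 0 < s)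
    (hψ : Measurable (Function.uncurry ψ))
    (hψ1 : ∀ z v, |ψ z v| ≤ 1) {g : 𝒱 → ℝ} (hg : BddMeas g) (x : Fin n → 𝒳) :
    MeanLE (Measure.pi fun _ : Fin s => μ)
      (fun V => (n : ℝ)⁻¹ * ∑ i, fluctuation μ ψ g V (x i) ^ 2)
      ((s : ℝ)⁻¹ * ∫ v, g v ^ 2 ∂μ) := by
  have hn' : (0 : ℝ) < n := by exact_mod_cast hn
  refine ((MeanLE.sum fun i => meanLE_fluctuation_sq μ hs hψ hψ1 hg (x i)).const_mul
    (by positivity : 0 ≤ (n : ℝ)⁻¹)).mono (le_of_eq ?_)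
  simp
  field_simp

/-- The second moment of the fluctuation of `∑ q, g (V q) * T (V q) (V p)`. -/
theorem meanLE_kernel_fluctuation_sq (hs : 0 < s) {T : 𝒱 → 𝒱 → ℝ}
    (hT : BddMeas fun q : 𝒱 × 𝒱 => T q.1 q.2) (hsymm : ∀ v w, T v w = T w v) {g : 𝒱 → ℝ}
    (hg : BddMeas g) {τ τ' H : ℝ} (hτ : ∀ v, g v ≠ 0 → ∫ w, T v w ^ 2 ∂μ ≤ τ)
    (hτ' : ∀ v, g v ≠ 0 → T v v ^ 2 ≤ τ') (hH : ∫ v, ∫ w, T v w ^ 2 ∂μ ∂μ ≤ H) (p : Fin s) :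
    MeanLE (Measure.pi fun _ : Fin s => μ)
      (fun V => ((s : ℝ)⁻¹ * ∑ q, g (V q) * T (V q) (V p) - ∫ v, g v * T v (V p) ∂μ) ^ 2)
      ((s : ℝ)⁻¹ ^ 2 * ((s - 1) * τ + 2 * (τ' + H)) * ∫ v, g v ^ 2 ∂μ) := by
  have hs' : (0 : ℝ) < s := by exact_mod_cast hs
  set N := ∫ v, g v ^ 2 ∂μ with hN
  have hN0 : 0 ≤ N := integral_nonneg fun v => sq_nonneg _
  set σ : 𝒱 → ℝ := fun w => ∫ v, g v * T v w ∂μ with hσ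
  have hTw : ∀ w, BddMeas fun v => T v w := fun w =>
    BddMeas.comp (h := fun v : 𝒱 => (v, w)) hT (measurable_id.prodMk measurable_const)
  have hTv : ∀ v, BddMeas fun w => T v w := fun v =>
    BddMeas.comp (h := fun w : 𝒱 => (v, w)) hT (measurable_const.prodMk measurable_id)
  have hTd : BddMeas fun v => T v v :=
    BddMeas.comp (h := fun v : 𝒱 => (v, v)) hT (measurable_id.prodMk measurable_id)
  have hTs : BddMeas fun q : 𝒱 × 𝒱 => T q.2 q.1 := hT.comp measurable_swap
  have hgT : BddMeas fun q : 𝒱 × 𝒱 => g q.2 * T q.2 q.1 := (hg.comp measurable_snd).mul hTs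
  have hσb : BddMeas σ := hgT.integral_left μ
  have hk : BddMeas fun q : 𝒱 × 𝒱 => (s : ℝ)⁻¹ * (g q.2 * T q.2 q.1 - σ q.1) :=
    (hgT.sub (hσb.comp measurable_fst)).const_mul _
  have hYb : ∀ q, BddMeas fun V : Fin s → 𝒱 => (s : ℝ)⁻¹ * (g (V q) * T (V q) (V p) - σ (V p)) :=
    fun q => BddMeas.comp (h := fun V : Fin s → 𝒱 => (V p, V q)) hk
      ((measurable_pi_apply p).prodMk (measurable_pi_apply q))
  have e : ∀ V : Fin s → 𝒱, (s : ℝ)⁻¹ * ∑ q, g (V q) * T (V q) (V p) - ∫ v, g v * T v (V p) ∂μ =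
      ∑ q, (s : ℝ)⁻¹ * (g (V q) * T (V q) (V p) - σ (V p)) := by
    intro V
    rw [← Finset.mul_sum, Finset.sum_sub_distrib, mul_sub]
    simp [hσ]
    field_simp
  simp only [e]
  refine ⟨(BddMeas.sum _ hYb).pow 2, ?_⟩
  -- Given all coordinates but V q, the term with index q is centred. Of two distinct indices at
  -- least one differs from p, so all pairs are orthogonal, including those with the non-centred
  -- term p.
  have horth : ∀ q r, q ≠ r → q ≠ p →
      ∫ V, (s : ℝ)⁻¹ * (g (V q) * T (V q) (V p) - σ (V p)) *
        ((s : ℝ)⁻¹ * (g (V r) * T (V r) (V p) - σ (V p))) ∂(Measure.pi fun _ : Fin s => μ) = 0 := by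
    intro q r hqr hqp
    refine integral_pi_eq_zero_of_resample μ q ((hYb q).mul (hYb r)) fun V => ?_
    simp only [Function.update_self, Function.update_of_ne hqr.symm,
      Function.update_of_ne (Ne.symm hqp)]
    rw [integral_mul_const, integral_const_mul,
      integral_sub ((hg.mul (hTw _)).integrable μ) (integrable_const _)]
    simp [hσ]
  rw [integral_sum_sq_of_orthogonal _ hYb fun q r hqr => by
    by_cases hqp : q = p
    · have := horth r q hqr.symm (by rw [← hqp]; exact hqr.symm)
      simpa only [mul_comm] using this
    · exact horth q r hqr hqp]
  have hoff : ∀ q, q ≠ p → ∫ V, ((s : ℝ)⁻¹ * (g (V q) * T (V q) (V p) - σ (V p))) ^ 2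
      ∂(Measure.pi fun _ : Fin s => μ) ≤ (s : ℝ)⁻¹ ^ 2 * (τ * N) := by
    intro q hqp
    rw [integral_pi_eval_pair μ hqp.symm
      (k := fun q => ((s : ℝ)⁻¹ * (g q.2 * T q.2 q.1 - σ q.1)) ^ 2) (hk.pow 2)]
    have h1 : ∫ w, ∫ v, ((s : ℝ)⁻¹ * (g v * T v w - σ w)) ^ 2 ∂μ ∂μ ≤
        ∫ w, (s : ℝ)⁻¹ ^ 2 * ∫ v, (g v * T v w) ^ 2 ∂μ ∂μ := by
      refine integral_mono ((hk.pow 2).integral_left μ |>.integrable μ)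
        (((hgT.pow 2).integral_left μ).const_mul _ |>.integrable μ) fun w => ?_
      simp only [mul_pow _ _ 2]
      rw [integral_const_mul]
      refine mul_le_mul_of_nonneg_left ?_ (by positivity)
      simpa only [mul_pow] using integral_sub_integral_sq_le μ (hg.mul (hTw w))
    refine h1.trans ?_
    rw [integral_const_mul]
    refine mul_le_mul_of_nonneg_left ?_ (by positivity)
    rw [integral_integral_swap ((hgT.pow 2).integrable _), hN, ← integral_const_mul]
    have hgT' : BddMeas fun q : 𝒱 × 𝒱 => (g q.1 * T q.1 q.2) ^ 2 :=
      ((hg.comp measurable_fst).mul hT).pow 2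
    refine integral_mono (hgT'.integral_left μ |>.integrable μ)
      (((hg.pow 2).const_mul τ).integrable μ) fun v => ?_
    simp only [mul_pow]
    rw [integral_const_mul, mul_comm]
    by_cases hv : g v = 0
    · simp [hv]
    · exact mul_le_mul_of_nonneg_right (hτ v hv) (sq_nonneg _)
  -- The term q = p is not centred given V p; bounding its two parts separately costs a factor 2 on
  -- one term out of s.
  have hdiag : ∫ V, ((s : ℝ)⁻¹ * (g (V p) * T (V p) (V p) - σ (V p))) ^ 2
      ∂(Measure.pi fun _ : Fin s => μ) ≤ (s : ℝ)⁻¹ ^ 2 * (2 * (τ' + H) * N) := by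
    rw [integral_pi_eval μ p (k := fun v => ((s : ℝ)⁻¹ * (g v * T v v - σ v)) ^ 2)
      ((((hg.mul hTd).sub hσb).const_mul _).pow 2)]
    simp only [mul_pow _ _ 2]
    rw [integral_const_mul]
    refine mul_le_mul_of_nonneg_left ?_ (by positivity)
    refine (integral_add_sq_le_two μ (hg.mul hTd) hσb).trans ?_
    have h1 : ∫ v, (g v * T v v) ^ 2 ∂μ ≤ τ' * N := by
      rw [hN, ← integral_const_mul]
      refine integral_mono (((hg.mul hTd).pow 2).integrable μ)
        (((hg.pow 2).const_mul τ').integrable μ) fun v => ?_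
      simp only [mul_pow]
      rw [mul_comm]
      by_cases hv : g v = 0
      · simp [hv]
      · exact mul_le_mul_of_nonneg_right (hτ' v hv) (sq_nonneg _)
    have h2 : ∫ v, σ v ^ 2 ∂μ ≤ H * N := by
      refine le_trans ?_ (mul_le_mul_of_nonneg_right hH hN0)
      rw [← integral_mul_const]
      refine integral_mono ((hσb.pow 2).integrable μ)
        ((((hT.pow 2).integral_left μ).mul (BddMeas.const N)).integrable μ) fun w => ?_
      have hc := abs_integral_mul_le_sqrt μ hg (hTw w)
      have hT0 : 0 ≤ ∫ v, T v w ^ 2 ∂μ := integral_nonneg fun v => sq_nonneg _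
      calc σ w ^ 2 = |σ w| ^ 2 := (sq_abs _).symm
        _ ≤ (√N * √(∫ v, T v w ^ 2 ∂μ)) ^ 2 := by gcongr
        _ = (∫ v, T v w ^ 2 ∂μ) * N := by
            rw [mul_pow, Real.sq_sqrt hN0, Real.sq_sqrt hT0, mul_comm]
        _ = _ := by simp only [fun v => hsymm v w]
    linarith
  rw [← Finset.add_sum_erase _ _ (Finset.mem_univ p)]
  have hcard : ((Finset.univ.erase p).card : ℝ) = s - 1 := by
    rw [Finset.card_erase_of_mem (Finset.mem_univ p), Finset.card_univ, Fintype.card_fin,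
      Nat.cast_sub hs, Nat.cast_one]
  have := Finset.sum_le_card_nsmul (Finset.univ.erase p) (fun q =>
    ∫ V, ((s : ℝ)⁻¹ * (g (V q) * T (V q) (V p) - σ (V p))) ^ 2 ∂(Measure.pi fun _ : Fin s => μ))
    _ fun q hq => hoff q (Finset.ne_of_mem_erase hq)
  rw [nsmul_eq_mul, hcard] at this
  calc _ ≤ (s : ℝ)⁻¹ ^ 2 * (2 * (τ' + H) * N) + (s - 1) * ((s : ℝ)⁻¹ ^ 2 * (τ * N)) :=
        add_le_add hdiag this
    _ = _ := by ring

end Variance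

/-! ### Deviations of inner products of features. -/

/-- The deviation of the empirical inner products of two features. -/
noncomputable def featureDev {𝒳 𝒱 : Type*} [MeasurableSpace 𝒳] {n : ℕ} (ρ : Measure 𝒳)
    (ψ : 𝒳 → 𝒱 → ℝ) (x : Fin n → 𝒳) (v w : 𝒱) : ℝ :=
  sampleDev ρ x (fun z => ψ z v) (fun z => ψ z w)

theorem featureDev_comm {𝒳 𝒱 : Type*} [MeasurableSpace 𝒳] {n : ℕ} (ρ : Measure 𝒳)
    (ψ : 𝒳 → 𝒱 → ℝ) (x : Fin n → 𝒳) (v w : 𝒱) :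
    featureDev ρ ψ x v w = featureDev ρ ψ x w v := by
  simp only [featureDev, sampleDev, mul_comm]

section Kernel

variable {𝒳 𝒱 : Type*} [MeasurableSpace 𝒳] [MeasurableSpace 𝒱] {n s : ℕ} (ρ : Measure 𝒳)
  [IsProbabilityMeasure ρ] (μ : Measure 𝒱) [IsProbabilityMeasure μ] {ψ : 𝒳 → 𝒱 → ℝ}

theorem bddMeas_featureDev (hψ : Measurable (Function.uncurry ψ)) (hψ1 : ∀ z v, |ψ z v| ≤ 1)
    (x : Fin n → 𝒳) : BddMeas fun q : 𝒱 × 𝒱 => featureDev ρ ψ x q.1 q.2 := by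
  have hb := bddMeas_uncurry hψ hψ1
  refine BddMeas.sub (BddMeas.integral_left
    (f := fun q : (𝒱 × 𝒱) × 𝒳 => ψ q.2 q.1.1 * ψ q.2 q.1.2) ?_ ρ)
    (BddMeas.const_mul _ (BddMeas.sum _ fun i => ?_))
  · exact BddMeas.mul
      (BddMeas.comp (h := fun q : (𝒱 × 𝒱) × 𝒳 => (q.2, q.1.1)) hb (by fun_prop))
      (BddMeas.comp (h := fun q : (𝒱 × 𝒱) × 𝒳 => (q.2, q.1.2)) hb (by fun_prop))
  · exact ((bddMeas_feature' hψ hψ1 (x i)).comp measurable_fst).mul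
      ((bddMeas_feature' hψ hψ1 (x i)).comp measurable_snd)

/-- The deviation is linear in its first argument and commutes with the μ-integral by Fubini. The
error term of `integral_ridgeRes_sq_le` thereby becomes a Monte Carlo fluctuation for the kernel
`featureDev`, one order of λ² smaller in mean square than that of ψ. -/
theorem sampleDev_fluctuation (hψ : Measurable (Function.uncurry ψ)) (hψ1 : ∀ z v, |ψ z v| ≤ 1)
    {g : 𝒱 → ℝ} (hg : BddMeas g) (x : Fin n → 𝒳) (V : Fin s → 𝒱) (w : 𝒱) :
    sampleDev ρ x (fluctuation μ ψ g V) (fun z => ψ z w) =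
      (s : ℝ)⁻¹ * ∑ q, g (V q) * featureDev ρ ψ x (V q) w -
        ∫ v, g v * featureDev ρ ψ x v w ∂μ := by
  have hw := bddMeas_feature hψ hψ1 w
  have hb := bddMeas_uncurry hψ hψ1
  have hm := bddMeas_featureMean μ hψ hψ1 hg
  have hsum : BddMeas fun z => (s : ℝ)⁻¹ * ∑ q, g (V q) * (ψ z (V q) * ψ z w) :=
    BddMeas.const_mul _ (BddMeas.sum _ fun q => ((bddMeas_feature hψ hψ1 (V q)).mul hw).const_mul _)
  have e : ∀ z, fluctuation μ ψ g V z * ψ z w =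
      (s : ℝ)⁻¹ * ∑ q, g (V q) * (ψ z (V q) * ψ z w) - ∫ v, g v * (ψ z v * ψ z w) ∂μ := by
    intro z
    have : ∫ v, g v * (ψ z v * ψ z w) ∂μ = featureMean μ ψ g z * ψ z w := by
      simp only [featureMean, ← mul_assoc, integral_mul_const]
    rw [this, fluctuation, sub_mul, mul_assoc, Finset.sum_mul]
    simp only [mul_assoc]
  have hgp : BddMeas fun q : 𝒳 × 𝒱 => g q.2 * (ψ q.1 q.2 * ψ q.1 w) :=
    (hg.comp measurable_snd).mul (hb.mul (hw.comp measurable_fst))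
  have hgz : ∀ z, BddMeas fun v => g v * (ψ z v * ψ z w) := fun z =>
    hg.mul ((bddMeas_feature' hψ hψ1 z).mul (BddMeas.const _))
  have i1 : BddMeas fun v => g v * ∫ z, ψ z v * ψ z w ∂ρ :=
    hg.mul (BddMeas.integral_left (f := fun q : 𝒱 × 𝒳 => ψ q.2 q.1 * ψ q.2 w)
      ((hb.comp measurable_swap).mul (hw.comp measurable_snd)) ρ)
  have i2 : BddMeas fun v => g v * ((n : ℝ)⁻¹ * ∑ i, ψ (x i) v * ψ (x i) w) :=
    hg.mul (BddMeas.const_mul _ (BddMeas.sum _ fun i =>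
      (bddMeas_feature' hψ hψ1 (x i)).mul (BddMeas.const _)))
  simp only [featureDev, sampleDev, e, mul_sub]
  rw [integral_sub (hsum.integrable ρ) ((hgp.integral_left μ).integrable ρ), integral_const_mul,
    integral_finsetSum _ fun q _ =>
      (((bddMeas_feature hψ hψ1 (V q)).mul hw).const_mul (g (V q))).integrable ρ,
    integral_integral_swap (hgp.integrable _), integral_sub (i1.integrable μ) (i2.integrable μ)]
  simp only [integral_const_mul, Finset.sum_sub_distrib, mul_sub]
  have h1 : ∫ v, g v * ((n : ℝ)⁻¹ * ∑ i, ψ (x i) v * ψ (x i) w) ∂μ =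
      (n : ℝ)⁻¹ * ∑ i, ∫ v, g v * (ψ (x i) v * ψ (x i) w) ∂μ := by
    rw [← integral_finsetSum _ fun i _ => (hgz (x i)).integrable μ, ← integral_const_mul]
    congr 1
    funext v
    rw [← Finset.mul_sum]
    ring
  have h2 : (s : ℝ)⁻¹ * ∑ q, g (V q) * ((n : ℝ)⁻¹ * ∑ i, ψ (x i) (V q) * ψ (x i) w) =
      (n : ℝ)⁻¹ * ∑ i, (s : ℝ)⁻¹ * ∑ q, g (V q) * (ψ (x i) (V q) * ψ (x i) w) := by
    simp only [Finset.mul_sum]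
    rw [Finset.sum_comm]
    exact Finset.sum_congr rfl fun i _ => Finset.sum_congr rfl fun q _ => by ring
  rw [h1, h2]
  ring

theorem covExcessLE_devExcess (hs : 0 < s) (hψ : Measurable (Function.uncurry ψ))
    (hψ1 : ∀ z v, |ψ z v| ≤ 1) {lam : ℝ} (hlam : 0 < lam)
    (hrate : 1 ≤ devRate s * n * lam ^ 2) (x : Fin n → 𝒳) (V : Fin s → 𝒱) :
    CovExcessLE ρ (fun z p => ψ z (V p)) lam x
      (devExcess n lam fun p r => featureDev ρ ψ x (V p) (V r)) :=
  covExcessLE_of_sum_sq_le ρ (fun p => bddMeas_feature hψ hψ1 (V p))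
    (sqrt_mean_sq_le_devExcess hs hlam hrate _)

/-- Dropping feature p annihilates row and column p of the deviation matrix, so this excess does not
depend on V p. -/
theorem covExcessLE_dropFeature_devExcess (hs : 0 < s)
    (hψ : Measurable (Function.uncurry ψ))
    (hψ1 : ∀ z v, |ψ z v| ≤ 1) {lam : ℝ} (hlam : 0 < lam)
    (hrate : 1 ≤ devRate s * n * lam ^ 2) (x : Fin n → 𝒳) (V : Fin s → 𝒱) (p : Fin s) :
    CovExcessLE ρ (dropFeature (fun z p => ψ z (V p)) p) lam x
      (devExcess n lam fun q r =>
        if q = p ∨ r = p then 0 else featureDev ρ ψ x (V q) (V r)) := by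
  refine covExcessLE_of_sum_sq_le ρ (fun q => ?_) ?_
  · by_cases hq : q = p
    · simpa [dropFeature, hq] using BddMeas.const 0
    · simpa [dropFeature, hq] using bddMeas_feature hψ hψ1 (V q)
  · refine le_trans (le_of_eq ?_) (sqrt_mean_sq_le_devExcess hs hlam hrate _)
    congr 2
    refine Finset.sum_congr rfl fun q _ => Finset.sum_congr rfl fun r _ => ?_
    by_cases hq : q = p
    · simp [dropFeature, hq, sampleDev]
    by_cases hr : r = p
    · simp [dropFeature, hr, sampleDev]
    simp [dropFeature, hq, hr, featureDev]

end Kernel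

/-! ### Moments weighted by the covariance excess. -/

/-- The supremum bound for the fluctuation with coefficients `g`. -/
noncomputable def coefBound {𝒱 : Type*} [MeasurableSpace 𝒱] {s : ℕ} (μ : Measure 𝒱)
    (g : 𝒱 → ℝ) (V : Fin s → 𝒱) : ℝ :=
  ∫ v, |g v| ∂μ + (s : ℝ)⁻¹ * ∑ q, |g (V q)|

theorem bddMeas_coefBound {𝒱 : Type*} [MeasurableSpace 𝒱] (μ : Measure 𝒱) {s : ℕ} {g : 𝒱 → ℝ}
    (hg : BddMeas g) : BddMeas (coefBound (s := s) μ g) :=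
  (BddMeas.const _).add (BddMeas.const_mul _ (BddMeas.sum _ fun q =>
    hg.abs.comp (measurable_pi_apply q)))

section WeightedMoments

variable {𝒱 : Type*} [MeasurableSpace 𝒱] (μ : Measure 𝒱) [IsProbabilityMeasure μ] {s : ℕ}
  {X : (Fin s → 𝒱) → ℝ} {x : ℝ} {g g₁ g₂ : 𝒱 → ℝ}

theorem sum_ite_eq_le {ι : Type*} [Fintype ι] [DecidableEq ι] {a b : ℝ} (hb : 0 ≤ b) :
    ∑ p : ι, ∑ r : ι, (if p = r then a else b) ≤
      Fintype.card ι * a + (Fintype.card ι : ℝ) ^ 2 * b := by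
  have h : ∀ p r : ι, (if p = r then a else b) ≤ (if p = r then a else 0) + b := by
    intro p r; split_ifs <;> linarith
  refine (Finset.sum_le_sum fun p _ => Finset.sum_le_sum fun r _ => h p r).trans (le_of_eq ?_)
  simp [Finset.sum_add_distrib]
  ring

theorem integral_pi_eval_mul_eval {k l : 𝒱 → ℝ} (hk : BddMeas k) (hl : BddMeas l) {p r : Fin s}
    (hpr : p ≠ r) : ∫ V, k (V p) * l (V r) ∂(Measure.pi fun _ : Fin s => μ) =
      (∫ v, k v ∂μ) * ∫ v, l v ∂μ := by
  rw [integral_pi_eval_mul μ p (F := fun V => l (V r)) hk (hl.comp (measurable_pi_apply r))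
    (fun V v => by rw [Function.update_of_ne hpr.symm]), integral_pi_eval μ r hl]

theorem bddMeas_abs_eval (hg : BddMeas g) (p : Fin s) : BddMeas fun V : Fin s → 𝒱 => |g (V p)| :=
  hg.abs.comp (measurable_pi_apply p)

theorem integral_abs_eval_sq_le (hg : BddMeas g) (p : Fin s) :
    ∫ V, |g (V p)| ^ 2 ∂(Measure.pi fun _ : Fin s => μ) ≤ √(∫ v, g v ^ 2 ∂μ) ^ 2 := by
  rw [Real.sq_sqrt (integral_nonneg fun v => sq_nonneg _)]
  simp only [sq_abs]
  exact (integral_pi_eval μ p (k := fun v => g v ^ 2) (hg.pow 2)).le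

theorem integral_abs_eval_mul_abs_eval_sq_le (hg₁ : BddMeas g₁) (hg₂ : BddMeas g₂) {p r : Fin s}
    (hpr : p ≠ r) : ∫ V, (|g₁ (V p)| * |g₂ (V r)|) ^ 2 ∂(Measure.pi fun _ : Fin s => μ) ≤
      (√(∫ v, g₁ v ^ 2 ∂μ) * √(∫ v, g₂ v ^ 2 ∂μ)) ^ 2 := by
  rw [mul_pow, Real.sq_sqrt (integral_nonneg fun v => sq_nonneg _),
    Real.sq_sqrt (integral_nonneg fun v => sq_nonneg _)]
  simp only [mul_pow, sq_abs]
  exact (integral_pi_eval_mul_eval μ (k := fun v => g₁ v ^ 2) (l := fun v => g₂ v ^ 2)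
    (hg₁.pow 2) (hg₂.pow 2) hpr).le

/-- Products of g at different indices are square integrable by independence, so Cauchy–Schwarz with
E X² ≤ x² handles them. The diagonal g(V q)² needs the separate bound y, but carries only the weight
1/s. -/
theorem meanLE_mul_coefBound_sq (hs : 0 < s) (hX : BddMeas X) (hx : 0 ≤ x)
    (hX2 : MeanLE (Measure.pi fun _ : Fin s => μ) (fun V => X V ^ 2) (x ^ 2)) (hg : BddMeas g)
    {y : ℝ} (hXg : ∀ q, MeanLE (Measure.pi fun _ : Fin s => μ)
      (fun V => X V * g (V q) ^ 2) (y * ∫ v, g v ^ 2 ∂μ)) :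
    MeanLE (Measure.pi fun _ : Fin s => μ) (fun V => X V * coefBound μ g V ^ 2)
      ((4 * x + y / s) * ∫ v, g v ^ 2 ∂μ) := by
  have hs' : (0 : ℝ) < s := by exact_mod_cast hs
  set N := ∫ v, g v ^ 2 ∂μ with hN
  have hN0 : 0 ≤ N := integral_nonneg fun v => sq_nonneg _
  have hNN : √N * √N = N := Real.mul_self_sqrt hN0
  set m := ∫ v, |g v| ∂μ with hm
  have hm0 : 0 ≤ m := integral_nonneg fun v => abs_nonneg _
  have hmN : m ≤ √N := integral_abs_le_sqrt μ hg
  have h1 := (hX2.mul hx hX (BddMeas.const 1) (d := 1) (by simp) zero_le_one).const_mul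
    (sq_nonneg m)
  have h2 := (MeanLE.sum fun q => hX2.mul hx hX (bddMeas_abs_eval hg q)
    (integral_abs_eval_sq_le μ hg q) (Real.sqrt_nonneg _)).const_mul
      (by positivity : 0 ≤ 2 * m * (s : ℝ)⁻¹)
  have h3 := (MeanLE.sum fun q => MeanLE.sum fun r => show MeanLE (Measure.pi fun _ : Fin s => μ)
      (fun V => X V * (|g (V q)| * |g (V r)|)) (if q = r then y * N else x * N) by
    by_cases hqr : q = r
    · subst hqr
      simpa [← sq] using hXg q
    · simp only [hqr, if_false]
      have := hX2.mul hx hX ((bddMeas_abs_eval hg q).mul (bddMeas_abs_eval hg r))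
        (integral_abs_eval_mul_abs_eval_sq_le μ hg hg hqr) (by positivity)
      rwa [hNN] at this).const_mul (by positivity : 0 ≤ (s : ℝ)⁻¹ ^ 2)
  have h := (h1.add h2).add h3
  refine MeanLE.mono (c := _) (MeanLE.of_le (hX.mul ((bddMeas_coefBound μ hg).pow 2)) h
    fun V => le_of_eq ?_) ?_
  · simp only [coefBound, ← hm, ← Finset.mul_sum, ← Finset.sum_mul]
    ring
  · have h4 := sum_ite_eq_le (ι := Fin s) (a := y * N) (mul_nonneg hx hN0)
    rw [Fintype.card_fin] at h4
    simp only [Finset.sum_const, Finset.card_univ, Fintype.card_fin, nsmul_eq_mul]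
    have e1 : m ^ 2 * (x * 1) ≤ N * x := by
      have : m ^ 2 ≤ N := by nlinarith
      nlinarith
    have e2 : 2 * m * (s : ℝ)⁻¹ * (s * (x * √N)) ≤ 2 * (N * x) := by
      have : m * √N ≤ N := by nlinarith [Real.sqrt_nonneg N]
      calc 2 * m * (s : ℝ)⁻¹ * (s * (x * √N)) = 2 * x * (m * √N) := by field_simp
        _ ≤ 2 * x * N := by gcongr
        _ = _ := by ring
    have e3 := mul_le_mul_of_nonneg_left h4 (by positivity : 0 ≤ (s : ℝ)⁻¹ ^ 2)
    have e4 : (s : ℝ)⁻¹ ^ 2 * (s * (y * N) + (s : ℝ) ^ 2 * (x * N)) = y / s * N + x * N := by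
      field_simp
    linarith

/-- The diagonal vanishes because g₁ and g₂ have disjoint supports. Off the diagonal, independence
produces the factor ∫|g₂|, small by `hm₂`, or the factor x from the excess. -/
theorem meanLE_one_add_mul_coefBound_mul (hs : 0 < s) (hX : BddMeas X) (hx : 0 ≤ x)
    (hX2 : MeanLE (Measure.pi fun _ : Fin s => μ) (fun V => X V ^ 2) (x ^ 2)) (hg₁ : BddMeas g₁)
    (hg₂ : BddMeas g₂) (h0 : ∀ v, g₁ v * g₂ v = 0) {q : ℝ}
    (hm₂ : ∫ v, |g₂ v| ∂μ ≤ q * √(∫ v, g₂ v ^ 2 ∂μ)) :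
    MeanLE (Measure.pi fun _ : Fin s => μ)
      (fun V => (1 + X V) * (coefBound μ g₁ V * coefBound μ g₂ V))
      ((4 * q + 2 * x + 2 * q * x) * (√(∫ v, g₁ v ^ 2 ∂μ) * √(∫ v, g₂ v ^ 2 ∂μ))) := by
  have hs' : (0 : ℝ) < s := by exact_mod_cast hs
  set n₁ := √(∫ v, g₁ v ^ 2 ∂μ) with hn₁
  set n₂ := √(∫ v, g₂ v ^ 2 ∂μ) with hn₂
  have hn₁0 : 0 ≤ n₁ := Real.sqrt_nonneg _
  have hn₂0 : 0 ≤ n₂ := Real.sqrt_nonneg _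
  set m₁ := ∫ v, |g₁ v| ∂μ with hm₁d
  set m₂ := ∫ v, |g₂ v| ∂μ with hm₂d
  have hm₁0 : 0 ≤ m₁ := integral_nonneg fun v => abs_nonneg _
  have hm₂0 : 0 ≤ m₂ := integral_nonneg fun v => abs_nonneg _
  have hm₁ : m₁ ≤ n₁ := integral_abs_le_sqrt μ hg₁
  have h1 := (hX2.one_add_mul hx hX (BddMeas.const 1) (c := 1) (d := 1) (by simp) (by simp)
    zero_le_one).const_mul (mul_nonneg hm₁0 hm₂0)
  have h2 := (MeanLE.sum fun r => hX2.one_add_mul hx hX (bddMeas_abs_eval hg₂ r)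
    (integral_pi_eval μ r hg₂.abs).le (integral_abs_eval_sq_le μ hg₂ r)
    (Real.sqrt_nonneg _)).const_mul (by positivity : 0 ≤ m₁ * (s : ℝ)⁻¹)
  have h3 := (MeanLE.sum fun r => hX2.one_add_mul hx hX (bddMeas_abs_eval hg₁ r)
    (integral_pi_eval μ r hg₁.abs).le (integral_abs_eval_sq_le μ hg₁ r)
    (Real.sqrt_nonneg _)).const_mul (by positivity : 0 ≤ m₂ * (s : ℝ)⁻¹)
  have h4 := (MeanLE.sum fun p => MeanLE.sum fun r => show MeanLE (Measure.pi fun _ : Fin s => μ)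
      (fun V => (1 + X V) * (|g₁ (V p)| * |g₂ (V r)|))
      (if p = r then 0 else m₁ * m₂ + x * (n₁ * n₂)) by
    by_cases hpr : p = r
    · subst hpr
      simp only [← abs_mul, h0, abs_zero, mul_zero, if_true]
      exact MeanLE.const 0
    · simp only [hpr, if_false]
      exact hX2.one_add_mul hx hX ((bddMeas_abs_eval hg₁ p).mul (bddMeas_abs_eval hg₂ r))
        (integral_pi_eval_mul_eval μ hg₁.abs hg₂.abs hpr).le
        (integral_abs_eval_mul_abs_eval_sq_le μ hg₁ hg₂ hpr) (by positivity)).const_mul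
          (by positivity : 0 ≤ (s : ℝ)⁻¹ ^ 2)
  have h := ((h1.add h2).add h3).add h4
  refine MeanLE.mono (c := _) (MeanLE.of_le (((BddMeas.const 1).add hX).mul
    ((bddMeas_coefBound μ hg₁).mul (bddMeas_coefBound μ hg₂))) h fun V => le_of_eq ?_) ?_
  · simp only [coefBound, ← hm₁d, ← hm₂d, ← Finset.mul_sum, ← Finset.sum_mul]
    ring
  · have h5 := sum_ite_eq_le (ι := Fin s) (b := m₁ * m₂ + x * (n₁ * n₂)) (a := 0) (by positivity)
    rw [Fintype.card_fin] at h5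
    simp only [Finset.sum_const, Finset.card_univ, Fintype.card_fin, nsmul_eq_mul]
    have e3 := mul_le_mul_of_nonneg_left h5 (by positivity : 0 ≤ (s : ℝ)⁻¹ ^ 2)
    have e4 : (s : ℝ)⁻¹ ^ 2 * (s * 0 + (s : ℝ) ^ 2 * (m₁ * m₂ + x * (n₁ * n₂))) =
        m₁ * m₂ + x * (n₁ * n₂) := by field_simp; ring
    have e5 : m₁ * (s : ℝ)⁻¹ * (s * (m₂ + x * n₂)) = m₁ * m₂ + x * (m₁ * n₂) := by field_simp
    have e6 : m₂ * (s : ℝ)⁻¹ * (s * (m₁ + x * n₁)) = m₁ * m₂ + x * (m₂ * n₁) := by field_simp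
    have f1 : m₁ * m₂ ≤ n₁ * (q * n₂) := mul_le_mul hm₁ hm₂ hm₂0 hn₁0
    have f2 : m₁ * n₂ ≤ n₁ * n₂ := mul_le_mul_of_nonneg_right hm₁ hn₂0
    have f3 : m₂ * n₁ ≤ q * n₂ * n₁ := mul_le_mul_of_nonneg_right hm₂ hn₁0
    have g1 := mul_le_mul_of_nonneg_left f1 hx
    have g2 := mul_le_mul_of_nonneg_left f2 hx
    have g3 := mul_le_mul_of_nonneg_left f3 hx
    linarith

/-- Only distinct indices occur in the double sum, so by independence every contribution carries two
factors ∫|g| or a factor x; all are small for coefficients concentrated on a rare set. -/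
theorem meanLE_one_add_mul_cross (hs : 0 < s) (hX : BddMeas X) (hx : 0 ≤ x)
    (hX2 : MeanLE (Measure.pi fun _ : Fin s => μ) (fun V => X V ^ 2) (x ^ 2)) (hg : BddMeas g)
    {q : ℝ} (hq : 0 ≤ q) (hm : ∫ v, |g v| ∂μ ≤ q * √(∫ v, g v ^ 2 ∂μ)) :
    MeanLE (Measure.pi fun _ : Fin s => μ)
      (fun V => 4 * (1 + X V) * (∑ p, ∑ r, (if p = r then 0 else
        |(s : ℝ)⁻¹ * g (V p)| * |(s : ℝ)⁻¹ * g (V r)|) +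
        2 * (∫ v, |g v| ∂μ) * ∑ p, |(s : ℝ)⁻¹ * g (V p)| + (∫ v, |g v| ∂μ) ^ 2))
      (4 * (4 * q ^ 2 + x * (1 + q) ^ 2) * ∫ v, g v ^ 2 ∂μ) := by
  have hs' : (0 : ℝ) < s := by exact_mod_cast hs
  have hN0 : 0 ≤ ∫ v, g v ^ 2 ∂μ := integral_nonneg fun v => sq_nonneg _
  have hNN : √(∫ v, g v ^ 2 ∂μ) * √(∫ v, g v ^ 2 ∂μ) = ∫ v, g v ^ 2 ∂μ := Real.mul_self_sqrt hN0
  set N := √(∫ v, g v ^ 2 ∂μ) with hN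
  have hN' : 0 ≤ N := Real.sqrt_nonneg _
  set m := ∫ v, |g v| ∂μ with hmd
  have hm0 : 0 ≤ m := integral_nonneg fun v => abs_nonneg _
  have h1 := (hX2.one_add_mul hx hX (BddMeas.const 1) (c := 1) (d := 1) (by simp) (by simp)
    zero_le_one).const_mul (sq_nonneg m)
  have h2 := (MeanLE.sum fun r => hX2.one_add_mul hx hX (bddMeas_abs_eval hg r)
    (integral_pi_eval μ r hg.abs).le (integral_abs_eval_sq_le μ hg r)
    (Real.sqrt_nonneg _)).const_mul (by positivity : 0 ≤ 2 * m * (s : ℝ)⁻¹)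
  have h3 := (MeanLE.sum fun p => MeanLE.sum fun r => show MeanLE (Measure.pi fun _ : Fin s => μ)
      (fun V => (1 + X V) * (if p = r then 0 else |g (V p)| * |g (V r)|))
      (if p = r then 0 else m * m + x * (N * N)) by
    by_cases hpr : p = r
    · simp only [hpr, if_true, mul_zero]
      exact MeanLE.const 0
    · simp only [hpr, if_false]
      exact hX2.one_add_mul hx hX ((bddMeas_abs_eval hg p).mul (bddMeas_abs_eval hg r))
        (integral_pi_eval_mul_eval μ hg.abs hg.abs hpr).le
        (integral_abs_eval_mul_abs_eval_sq_le μ hg hg hpr) (by positivity)).const_mul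
          (by positivity : 0 ≤ (s : ℝ)⁻¹ ^ 2)
  have h := ((h1.add h2).add h3).const_mul (by norm_num : (0 : ℝ) ≤ 4)
  have habs : ∀ t : ℝ, |(s : ℝ)⁻¹ * t| = (s : ℝ)⁻¹ * |t| := fun t => by
    rw [abs_mul, abs_of_nonneg (by positivity : 0 ≤ (s : ℝ)⁻¹)]
  have e : ∀ V : Fin s → 𝒱, 4 * (m ^ 2 * ((1 + X V) * 1) +
        2 * m * (s : ℝ)⁻¹ * ∑ i, (1 + X V) * |g (V i)| +
      (s : ℝ)⁻¹ ^ 2 * ∑ i, ∑ j, (1 + X V) * (if i = j then 0 else |g (V i)| * |g (V j)|)) =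
      4 * (1 + X V) * (∑ p, ∑ r, (if p = r then 0 else
        |(s : ℝ)⁻¹ * g (V p)| * |(s : ℝ)⁻¹ * g (V r)|) +
        2 * m * ∑ p, |(s : ℝ)⁻¹ * g (V p)| + m ^ 2) := by
    intro V
    have e1 : ∀ p r : Fin s, (if p = r then 0 else
        |(s : ℝ)⁻¹ * g (V p)| * |(s : ℝ)⁻¹ * g (V r)|) =
        (s : ℝ)⁻¹ ^ 2 * (if p = r then 0 else |g (V p)| * |g (V r)|) := by
      intro p r
      split_ifs
      · simp
      · rw [habs, habs]; ring
    simp only [e1]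
    simp only [habs, ← Finset.mul_sum]
    ring
  simp only [e] at h
  refine h.mono ?_
  have h5 := sum_ite_eq_le (ι := Fin s) (b := m * m + x * (N * N)) (a := 0) (by positivity)
  rw [Fintype.card_fin] at h5
  simp only [Finset.sum_const, Finset.card_univ, Fintype.card_fin, nsmul_eq_mul]
  have e3 := mul_le_mul_of_nonneg_left h5 (by positivity : 0 ≤ (s : ℝ)⁻¹ ^ 2)
  have e4 : (s : ℝ)⁻¹ ^ 2 * (s * 0 + (s : ℝ) ^ 2 * (m * m + x * (N * N))) =
      m * m + x * (N * N) := by field_simp; ring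
  have e5 : 2 * m * (s : ℝ)⁻¹ * (s * (m + x * N)) = 2 * (m * m) + 2 * (x * (m * N)) := by
    field_simp
  have f1 : m * m ≤ q * N * (q * N) := mul_le_mul hm hm hm0 (by positivity)
  have f2 : m * N ≤ q * N * N := mul_le_mul_of_nonneg_right hm hN'
  have g1 := mul_le_mul_of_nonneg_left f1 hx
  have g2 := mul_le_mul_of_nonneg_left f2 hx
  have e6 : 4 * (4 * q ^ 2 + x * (1 + q) ^ 2) * ∫ v, g v ^ 2 ∂μ =
      4 * (4 * q ^ 2 + x * (1 + q) ^ 2) * (N * N) := by rw [hNN]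
  rw [e6]
  linarith

end WeightedMoments

/-! ### Expectation of the residual over the random features. -/

section ExpectedError

variable {𝒳 𝒱 : Type*} [MeasurableSpace 𝒳] [MeasurableSpace 𝒱] {n s : ℕ} (ρ : Measure 𝒳)
  [IsProbabilityMeasure ρ] (μ : Measure 𝒱) [IsProbabilityMeasure μ] {ψ : 𝒳 → 𝒱 → ℝ}

theorem meanLE_devExcess (hs : 0 < s) {T : 𝒱 → 𝒱 → ℝ} {N lam h : ℝ}
    (hT : BddMeas fun q : 𝒱 × 𝒱 => T q.1 q.2) (hh : 0 ≤ h)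
    (h1 : ∫ v, Real.exp (3 / 2 * N * T v v ^ 2) ∂μ ≤ h)
    (h2 : ∫ v, ∫ w, Real.exp (3 / 8 * N * T v w ^ 2) ∂μ ∂μ ≤ h) :
    MeanLE (Measure.pi fun _ : Fin s => μ) (fun V => devExcess N lam (fun p r => T (V p) (V r)))
      (devScale s N lam h) := by
  have := (meanLE_devExcess_sq μ (lam := lam) hs hT hh h1 h2).mul (devScale_nonneg _ _ _ _)
    (bddMeas_devExcess (bddMeas_kernel_eval hT)) (BddMeas.const 1) (d := 1) (by simp) zero_le_one
  simpa using this

/-- The mean square of the ridge residual of a fluctuation, for coefficients split in two parts. -/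
theorem integral_integral_ridgeRes_fluctuation_sq_le (hn : 0 < n) (hs : 0 < s)
    (hψ : Measurable (Function.uncurry ψ)) (hψ1 : ∀ z v, |ψ z v| ≤ 1) {g₁ g₂ : 𝒱 → ℝ}
    (hg₁ : BddMeas g₁) (hg₂ : BddMeas g₂) (h0 : ∀ v, g₁ v * g₂ v = 0) {lam : ℝ} (hlam : 0 < lam)
    (hlam2 : lam ≤ 1 / 2) (hrate : 1 ≤ devRate s * n * lam ^ 2) (x : Fin n → 𝒳)
    {h Θ τ τ' H q : ℝ} (hh : 0 ≤ h) (hΘ : h ≤ Θ) (hq : 0 ≤ q)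
    (h1 : ∫ v, Real.exp (3 / 2 * n * featureDev ρ ψ x v v ^ 2) ∂μ ≤ h)
    (h2 : ∫ v, ∫ w, Real.exp (3 / 8 * n * featureDev ρ ψ x v w ^ 2) ∂μ ∂μ ≤ h)
    (hg1 : ∀ v, g₁ v ≠ 0 → Real.exp (3 / 2 * n * featureDev ρ ψ x v v ^ 2) ≤ Θ)
    (hg2 : ∀ v, g₁ v ≠ 0 → ∫ w, Real.exp (3 / 8 * n * featureDev ρ ψ x v w ^ 2) ∂μ ≤ Θ)
    (hτ : ∀ v, g₁ v ≠ 0 → ∫ w, featureDev ρ ψ x v w ^ 2 ∂μ ≤ τ)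
    (hτ' : ∀ v, g₁ v ≠ 0 → featureDev ρ ψ x v v ^ 2 ≤ τ')
    (hH : ∫ v, ∫ w, featureDev ρ ψ x v w ^ 2 ∂μ ∂μ ≤ H)
    (hm : ∫ v, |g₂ v| ∂μ ≤ q * √(∫ v, g₂ v ^ 2 ∂μ)) :
    ∫ V, ∫ z, ridgeRes (fun z p => ψ z (V p)) lam x
        (fun z => fluctuation μ ψ g₁ V z + fluctuation μ ψ g₂ V z) z ^ 2 ∂ρ
        ∂(Measure.pi fun _ : Fin s => μ) ≤
      (s : ℝ)⁻¹ * ((2 + (s : ℝ)⁻¹ * ((s - 1) * τ + 2 * (τ' + H)) / (4 * lam) +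
          devScale s n lam Θ + 4 * s * devScale s n lam h) * ∫ v, g₁ v ^ 2 ∂μ +
        8 * s * (4 * q + 2 * devScale s n lam h + 2 * q * devScale s n lam h) *
          (√(∫ v, g₁ v ^ 2 ∂μ) * √(∫ v, g₂ v ^ 2 ∂μ)) +
        ((6 * s / (3 * s + 1)) ^ 2 * (1 + devScale s n lam h) +
          4 * s * (4 * q ^ 2 + devScale s n lam h * (1 + q) ^ 2)) * ∫ v, g₂ v ^ 2 ∂μ) := by
  have hs' : (0 : ℝ) < s := by exact_mod_cast hs
  have hn' : (0 : ℝ) < n := by exact_mod_cast hn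
  set T := featureDev ρ ψ x with hTdef
  have hT : BddMeas fun q : 𝒱 × 𝒱 => T q.1 q.2 := bddMeas_featureDev ρ hψ hψ1 x
  have hsymm : ∀ v w, T v w = T w v := featureDev_comm ρ ψ x
  set e := devScale s n lam h with he
  have he0 : 0 ≤ e := devScale_nonneg _ _ _ _
  set X : (Fin s → 𝒱) → ℝ := fun V => devExcess n lam fun p r => T (V p) (V r) with hX
  have hXb : BddMeas X := bddMeas_devExcess (bddMeas_kernel_eval hT)
  have hX2 : MeanLE (Measure.pi fun _ : Fin s => μ) (fun V => X V ^ 2) (e ^ 2) :=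
    meanLE_devExcess_sq μ hs hT hh h1 h2
  set Y : (Fin s → 𝒱) → Fin s → ℝ := fun V p => devExcess n lam fun q r =>
    if q = p ∨ r = p then 0 else T (V q) (V r) with hY
  have hYb : ∀ p, BddMeas fun V => Y V p := fun p => bddMeas_devExcess fun q r => by
    by_cases hqr : q = p ∨ r = p
    · simp only [hqr, if_true]; exact BddMeas.const 0
    · simp only [hqr, if_false]; exact bddMeas_kernel_eval hT q r
  have hYm : ∀ p, MeanLE (Measure.pi fun _ : Fin s => μ) (fun V => Y V p) e := fun p =>
    MeanLE.of_le (hYb p) (meanLE_devExcess μ hs hT hh h1 h2) fun V =>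
      devExcess_mono hs hn'.le lam fun q r => by
        split_ifs
        · simpa using sq_nonneg _
        · exact le_rfl
  -- Independence of Y V p from V p lets the mean of g₂(V p)²(1 + Y V p) factor, so nothing is
  -- required of the atypical feature V p.
  have hYu : ∀ p V v, Y (Function.update V p v) p = Y V p := by
    intro p V v
    simp only [hY]
    congr 1
    funext q r
    split_ifs with hqr
    · rfl
    · push Not at hqr
      rw [Function.update_of_ne hqr.1, Function.update_of_ne hqr.2]
  have t1 := meanLE_integral_fluctuation_sq μ ρ hs hψ hψ1 hg₁
  have t2 := meanLE_mean_fluctuation_sq μ hn hs hψ hψ1 hg₁ x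
  have t3 := meanLE_mul_coefBound_sq μ hs hXb he0 hX2 hg₁ (y := devScale s n lam Θ) fun q =>
    meanLE_devExcess_sq_mul_eval μ hs hT hsymm (hh.trans hΘ) (h1.trans hΘ) (h2.trans hΘ) hg₁ hg1
      hg2 q
  have t4 := (MeanLE.sum fun p =>
    (meanLE_kernel_fluctuation_sq μ hs hT hsymm hg₁ hτ hτ' hH p).const_mul
      (by positivity : 0 ≤ (4 * lam)⁻¹)).const_mul (by positivity : 0 ≤ (s : ℝ)⁻¹)
  have t5 := (meanLE_one_add_mul_coefBound_mul μ hs hXb he0 hX2 hg₁ hg₂ h0 hm).const_mul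
    (by norm_num : (0 : ℝ) ≤ 8)
  have t6 := MeanLE.sum fun p => show MeanLE (Measure.pi fun _ : Fin s => μ)
      (fun V => ((s : ℝ)⁻¹ * g₂ (V p)) ^ 2 * ((6 * s / (3 * s + 1)) ^ 2 * (1 + Y V p)))
      ((s : ℝ)⁻¹ ^ 2 * (6 * s / (3 * s + 1)) ^ 2 * ((∫ v, g₂ v ^ 2 ∂μ) * (1 + e))) by
    have hF := (MeanLE.const (P := Measure.pi fun _ : Fin s => μ) 1).add (hYm p)
    have := MeanLE.const_mul (P := Measure.pi fun _ : Fin s => μ)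
      (F := fun V => g₂ (V p) ^ 2 * (1 + Y V p)) (c := (∫ v, g₂ v ^ 2 ∂μ) * (1 + e))
      ⟨((hg₂.pow 2).comp (measurable_pi_apply p)).mul hF.1, by
        rw [integral_pi_eval_mul μ p (k := fun v => g₂ v ^ 2) (hg₂.pow 2) hF.1
          (fun V v => by rw [hYu])]
        exact mul_le_mul_of_nonneg_left hF.2 (integral_nonneg fun v => sq_nonneg _)⟩
      (by positivity : 0 ≤ (s : ℝ)⁻¹ ^ 2 * (6 * s / (3 * s + 1)) ^ 2)
    refine MeanLE.of_le ?_ this fun V => le_of_eq (by ring)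
    exact (((hg₂.comp (measurable_pi_apply p)).const_mul _).pow 2).mul (hF.1.const_mul _)
  have t7 := meanLE_one_add_mul_cross μ hs hXb he0 hX2 hg₂ hq hm
  have htot := ((((t1.add t2).add t3).add t4).add t5).add (t6.add t7)
  have hpt : ∀ V : Fin s → 𝒱, ∫ z, ridgeRes (fun z p => ψ z (V p)) lam x
      (fun z => fluctuation μ ψ g₁ V z + fluctuation μ ψ g₂ V z) z ^ 2 ∂ρ ≤ _ := fun V =>
    integral_ridgeRes_fluctuation_sq_le ρ μ hn hs hψ hψ1 hg₁ hg₂ hlam hlam2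
      (devExcess_nonneg _ _ _) (Y := Y V) (fun p => devExcess_nonneg _ _ _)
      (covExcessLE_devExcess ρ hs hψ hψ1 hlam hrate x V)
      (covExcessLE_dropFeature_devExcess ρ hs hψ hψ1 hlam hrate x V)
  refine (integral_mono_of_nonneg (Filter.Eventually.of_forall fun V =>
    integral_nonneg fun z => sq_nonneg _) (htot.1.integrable _)
    (Filter.Eventually.of_forall fun V => (hpt V).trans (le_of_eq ?_))).trans (htot.2.trans
      (le_of_eq ?_))
  · simp only [coefBound, sampleDev_fluctuation ρ μ hψ hψ1 hg₁, div_eq_inv_mul (_ ^ 2) (4 * lam)]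
    ring
  · simp only [Finset.sum_const, Finset.card_univ, Fintype.card_fin, nsmul_eq_mul]
    field_simp
    ring

end ExpectedError

/-! ### Numerical verification of the constants. -/

section Scalar

/-- Discriminant criterion, by completing the square. A collects the typical part, B the atypical
part and C their interaction. -/
theorem quadratic_form_le {A B C m₁ m₂ : ℝ} (hA : A < 4) (h : C ^ 2 ≤ 4 * ((4 - A) * (4 - B))) :
    A * m₁ ^ 2 + C * (m₁ * m₂) + B * m₂ ^ 2 ≤ 4 * (m₁ ^ 2 + m₂ ^ 2) := by
  have h1 : 0 ≤ 4 * (4 - A) * ((4 - A) * m₁ ^ 2 - C * (m₁ * m₂) + (4 - B) * m₂ ^ 2) := by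
    have : 4 * (4 - A) * ((4 - A) * m₁ ^ 2 - C * (m₁ * m₂) + (4 - B) * m₂ ^ 2) =
        (2 * (4 - A) * m₁ - C * m₂) ^ 2 + (4 * ((4 - A) * (4 - B)) - C ^ 2) * m₂ ^ 2 := by ring
    rw [this]
    have := mul_nonneg (sub_nonneg.2 h) (sq_nonneg m₂)
    positivity
  have h2 := nonneg_of_mul_nonneg_right h1 (by linarith)
  linarith

variable {s : ℕ} {n lam δ : ℝ}

theorem devScale_le {h c : ℝ} (hc : 0 ≤ c)
    (hle : Real.exp (-(4 * devRate s * n * lam ^ 2)) * h ≤ (20 * c) ^ 2) :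
    devScale s n lam h ≤ c := by
  have := Real.sqrt_le_iff.2 ⟨(by positivity : 0 ≤ 20 * c), hle⟩
  unfold devScale
  linarith

/-- The hypothesis on λ makes the exponential at most (δ/s) to the power 16 `devRate s` = 24s/(4s -
3). This exceeds 6 for every s and is larger for small s, where more is needed. -/
theorem exp_devRate_le (hs : 0 < s) (hδ : 0 < δ) (hδs : δ ≤ s)
    (hL : 4 * Real.log (s / δ) ≤ n * lam ^ 2) (k : ℕ) (hk : (k : ℝ) * (4 * s - 3) ≤ 24 * s) :
    Real.exp (-(4 * devRate s * n * lam ^ 2)) ≤ (δ / s) ^ k := by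
  have hs' : (0 : ℝ) < s := by exact_mod_cast hs
  have h3 := four_mul_sub_three_pos hs
  have hL0 : 0 ≤ Real.log (s / δ) := Real.log_nonneg ((one_le_div hδ).2 hδs)
  have hu : (0 : ℝ) < δ / s := by positivity
  have e : (δ / s) ^ k = Real.exp (-(k * Real.log (s / δ))) := by
    rw [← mul_neg, ← Real.log_inv, inv_div, Real.exp_nat_mul, Real.exp_log hu]
  rw [e]
  apply Real.exp_le_exp.2
  have hdr : (k : ℝ) ≤ 16 * devRate s := by
    have : 16 * devRate s = 24 * s / (4 * s - 3) := by rw [devRate]; ring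
    rw [this, le_div_iff₀ h3]
    exact hk
  have hdr0 : 0 ≤ devRate s := by unfold devRate; positivity
  have h1 := mul_le_mul_of_nonneg_right hdr hL0
  have h2 := mul_le_mul_of_nonneg_left hL (by positivity : 0 ≤ 4 * devRate s)
  linarith

/-- The rate is at least 3/8, and s/δ ≥ 2 gives nλ² ≥ 4 log 2, so the product is at least (3/2) log
2 > 1. The bound s/δ ≥ 2 comes from the assumption that s ≥ 2 or δ ≤ 1/2. -/
theorem one_le_devRate_mul (hs : 0 < s) (hδ : 0 < δ) (hδs : 2 * δ ≤ s)
    (hL : 4 * Real.log (s / δ) ≤ n * lam ^ 2) : 1 ≤ devRate s * n * lam ^ 2 := by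
  have hs' : (0 : ℝ) < s := by exact_mod_cast hs
  have h3 := four_mul_sub_three_pos hs
  have h2 : Real.log 2 ≤ Real.log (s / δ) :=
    Real.log_le_log (by norm_num) ((le_div_iff₀ hδ).2 hδs)
  have hl := Real.log_two_gt_d9
  have hdr : 3 / 8 ≤ devRate s := by
    rw [devRate, div_le_div_iff₀ (by norm_num) h3]; linarith
  nlinarith

/-- With L = log(s/δ), all logarithms are combinations of log 2 ≤ ℓL and L, and L/n ≤ λ²/4. Dividing
by 4λ leaves a multiple of λ, and λ ≤ 1/2 makes it a constant. -/
theorem residual_rate_le {ℓ : ℝ} (hs : 0 < s) (hδ : 0 < δ) (hδ1 : δ < 1) (hδs : 2 * δ ≤ s)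
    (hn : 0 < n) (hlam : 0 < lam) (hlam2 : lam ≤ 1 / 2)
    (hL : 4 * Real.log (s / δ) ≤ n * lam ^ 2)
    (hℓ : Real.log 2 ≤ ℓ * Real.log (s / δ)) :
    (s : ℝ)⁻¹ * ((s - 1) * (Real.log (256 / (δ / s) ^ 6) / (3 / 8 * n)) +
      2 * (Real.log (256 / (δ / s) ^ 6) / (3 / 2 * n) + Real.log (4 / δ) / (3 / 8 * n))) /
        (4 * lam) ≤ 1 / 8 * (4 + 16 / 3 * ℓ - (s : ℝ)⁻¹ * (2 / 3)) := by
  have hs' : (1 : ℝ) ≤ s := by exact_mod_cast hs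
  have hs0 : (0 : ℝ) < s := by linarith
  set L := Real.log (s / δ) with hLd
  have hl2 : Real.log 2 ≤ L :=
    Real.log_le_log (by norm_num) ((le_div_iff₀ hδ).2 hδs)
  have hl := Real.log_two_gt_d9
  have hLpos : 0 < L := by linarith
  have e1 : Real.log (256 / (δ / s) ^ 6) = 8 * Real.log 2 + 6 * L := by
    rw [Real.log_div (by norm_num) (by positivity), Real.log_pow, hLd, ← inv_div, Real.log_inv,
      show (256 : ℝ) = 2 ^ 8 by norm_num, Real.log_pow]
    push_cast; ring
  have e2 : Real.log (4 / δ) ≤ 2 * Real.log 2 + L := by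
    have : Real.log (4 / δ) = 2 * Real.log 2 + Real.log (1 / δ) := by
      rw [show 4 / δ = (2 : ℝ) ^ 2 * (1 / δ) by ring, Real.log_mul (by norm_num) (by positivity),
        Real.log_pow]
      push_cast; ring
    rw [this, hLd]
    have : Real.log (1 / δ) ≤ Real.log (s / δ) :=
      Real.log_le_log (by positivity) (by gcongr)
    linarith
  have hτ0 : 0 ≤ 8 * Real.log 2 + 6 * L := by linarith
  have hnl : n⁻¹ * L ≤ lam ^ 2 / 4 := by
    rw [inv_mul_le_iff₀ hn]; linarith
  have hτ : n⁻¹ * (8 * Real.log 2 + 6 * L) ≤ lam ^ 2 / 4 * (8 * ℓ + 6) := by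
    have hℓ0 : 0 ≤ ℓ := by
      by_contra hc
      push Not at hc
      nlinarith
    calc n⁻¹ * (8 * Real.log 2 + 6 * L) ≤ n⁻¹ * (8 * (ℓ * L) + 6 * L) := by gcongr
      _ = (n⁻¹ * L) * (8 * ℓ + 6) := by ring
      _ ≤ _ := by gcongr
  have hH : n⁻¹ * Real.log (4 / δ) ≤ lam ^ 2 / 4 * (2 * ℓ + 1) := by
    have hℓ0 : 0 ≤ ℓ := by
      by_contra hc
      push Not at hc
      nlinarith
    calc n⁻¹ * Real.log (4 / δ) ≤ n⁻¹ * (2 * (ℓ * L) + L) := by gcongr; linarith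
      _ = (n⁻¹ * L) * (2 * ℓ + 1) := by ring
      _ ≤ _ := by gcongr
  rw [e1]
  have h1 : (s - 1) * ((8 * Real.log 2 + 6 * L) / (3 / 8 * n)) +
      2 * ((8 * Real.log 2 + 6 * L) / (3 / 2 * n) + Real.log (4 / δ) / (3 / 8 * n)) =
      (8 / 3 * (s - 1) + 4 / 3) * (n⁻¹ * (8 * Real.log 2 + 6 * L)) +
        16 / 3 * (n⁻¹ * Real.log (4 / δ)) := by
    field_simp; ring
  have h2 : (8 / 3 * ((s : ℝ) - 1) + 4 / 3) * (n⁻¹ * (8 * Real.log 2 + 6 * L)) +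
        16 / 3 * (n⁻¹ * Real.log (4 / δ)) ≤ (8 / 3 * ((s : ℝ) - 1) + 4 / 3) *
        (lam ^ 2 / 4 * (8 * ℓ + 6)) + 16 / 3 * (lam ^ 2 / 4 * (2 * ℓ + 1)) := by
    have : (0 : ℝ) ≤ 8 / 3 * (s - 1) + 4 / 3 := by linarith
    gcongr
  have h3 : (8 / 3 * ((s : ℝ) - 1) + 4 / 3) *
        (lam ^ 2 / 4 * (8 * ℓ + 6)) + 16 / 3 * (lam ^ 2 / 4 * (2 * ℓ + 1)) =
      lam ^ 2 * (s * (4 + 16 / 3 * ℓ) - 2 / 3) := by ring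
  have hℓ0 : 0 ≤ ℓ := by
    by_contra hc
    push Not at hc
    nlinarith
  have h4 : 0 ≤ s * (4 + 16 / 3 * ℓ) - 2 / 3 := by nlinarith
  rw [h1, div_le_iff₀ (by positivity)]
  calc (s : ℝ)⁻¹ * _ ≤ (s : ℝ)⁻¹ * (lam ^ 2 * (s * (4 + 16 / 3 * ℓ) - 2 / 3)) := by
        rw [← h3]; gcongr
    _ ≤ (s : ℝ)⁻¹ * (lam / 2 * (s * (4 + 16 / 3 * ℓ) - 2 / 3)) := by
        gcongr; nlinarith
    _ = _ := by field_simp; ring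

theorem error_constants_numeric {s : ℝ} (hs : 3 ≤ s) :
    1 / 8 * (4 + 16 / 3 * (7 / 11) - s⁻¹ * (2 / 3)) + 4 / 5 + 4 * s * (s⁻¹ ^ 3 / 10) < 2 ∧
    (8 * s * (4 * (s⁻¹ ^ 3 / 8) + 2 * (s⁻¹ ^ 3 / 10) + 2 * (s⁻¹ ^ 3 / 8) * (s⁻¹ ^ 3 / 10))) ^ 2 ≤
      4 * ((2 - (1 / 8 * (4 + 16 / 3 * (7 / 11) - s⁻¹ * (2 / 3)) + 4 / 5 +
        4 * s * (s⁻¹ ^ 3 / 10))) *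
      (4 - ((6 * s / (3 * s + 1)) ^ 2 * (1 + s⁻¹ ^ 3 / 10) +
        4 * s * (4 * (s⁻¹ ^ 3 / 8) ^ 2 + s⁻¹ ^ 3 / 10 * (1 + s⁻¹ ^ 3 / 8) ^ 2)))) := by
  have hs0 : 0 < s := by linarith
  set σ := s⁻¹ with hσ
  have hσ0 : 0 < σ := by positivity
  have hσs : σ * s = 1 := inv_mul_cancel₀ hs0.ne'
  have hσ3 : σ ≤ 1 / 3 := by nlinarith [mul_le_mul_of_nonneg_left hs hσ0.le]
  have p2 : σ ^ 2 ≤ 1 / 3 * σ := by nlinarith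
  have p3 : σ ^ 3 ≤ 1 / 9 * σ := by
    calc σ ^ 3 = σ ^ 2 * σ := by ring
      _ ≤ (1 / 3 * σ) * (1 / 3) := by gcongr
      _ = _ := by ring
  have p5 : σ ^ 5 ≤ 1 / 81 * σ := by
    calc σ ^ 5 = σ ^ 2 * σ ^ 3 := by ring
      _ ≤ (1 / 3 * (1 / 3)) * (1 / 9 * σ) := by gcongr; linarith
      _ = _ := by ring
  have p3' : σ ^ 3 ≤ 1 / 27 := by linarith
  have p30 : 0 < σ ^ 3 := by positivity
  have e1 : 4 * s * (σ ^ 3 / 10) = 2 / 5 * σ ^ 2 := by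
    linear_combination (2 / 5 * σ ^ 2) * hσs
  refine ⟨by rw [e1]; linarith, ?_⟩
  have e2 : 8 * s * (4 * (σ ^ 3 / 8) + 2 * (σ ^ 3 / 10) + 2 * (σ ^ 3 / 8) * (σ ^ 3 / 10)) =
      8 * σ ^ 2 * (7 / 10 + σ ^ 3 / 40) := by
    linear_combination (8 * σ ^ 2 * (7 / 10 + σ ^ 3 / 40)) * hσs
  have e3 : 4 * s * (4 * (σ ^ 3 / 8) ^ 2 + σ ^ 3 / 10 * (1 + σ ^ 3 / 8) ^ 2) =
      σ ^ 5 / 4 + 2 / 5 * σ ^ 2 * (1 + σ ^ 3 / 8) ^ 2 := by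
    linear_combination (σ ^ 5 / 4 + 2 / 5 * σ ^ 2 * (1 + σ ^ 3 / 8) ^ 2) * hσs
  -- The leave-one-out gain of order 1/s. The remaining terms for g₂ are small enough that 2σ of it
  -- survives, enough to dominate the squared interaction term.
  have e4 : (6 * s / (3 * s + 1)) ^ 2 ≤ 4 - 227 / 100 * σ := by
    rw [div_pow, div_le_iff₀ (by positivity)]
    have : (4 - 227 / 100 * σ) * (3 * s + 1) ^ 2 =
        36 * s ^ 2 + 24 * s + 4 - 227 / 100 * (9 * (σ * s) * s + 6 * (σ * s) + σ) := by ring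
    rw [this, hσs]
    linarith
  have e5 : (6 * s / (3 * s + 1)) ^ 2 * (1 + σ ^ 3 / 10) +
      (σ ^ 5 / 4 + 2 / 5 * σ ^ 2 * (1 + σ ^ 3 / 8) ^ 2) ≤ 4 - 2 * σ := by
    have h1 : (6 * s / (3 * s + 1)) ^ 2 * (1 + σ ^ 3 / 10) ≤
        (4 - 227 / 100 * σ) * (1 + σ ^ 3 / 10) := by gcongr
    have h2 : 2 / 5 * σ ^ 2 * (1 + σ ^ 3 / 8) ^ 2 ≤
        2 / 5 * (1 / 3 * σ) * (1 + 1 / 27 / 8) ^ 2 := by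
      gcongr
    have h3 : 0 ≤ σ * σ ^ 3 := by positivity
    linarith
  rw [e1, e2, e3]
  have e6 : 8 * σ ^ 2 * (7 / 10 + σ ^ 3 / 40) ≤ 8 * σ ^ 2 * (71 / 100) := by
    gcongr; linarith
  have e7 : (8 * σ ^ 2 * (7 / 10 + σ ^ 3 / 40)) ^ 2 ≤ 33 / 27 * σ := by
    calc (8 * σ ^ 2 * (7 / 10 + σ ^ 3 / 40)) ^ 2 ≤ (8 * σ ^ 2 * (71 / 100)) ^ 2 := by gcongr
      _ = (568 / 100) ^ 2 * (σ * σ ^ 3) := by ring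
      _ ≤ (568 / 100) ^ 2 * (σ * (1 / 27)) := by gcongr
      _ ≤ _ := by linarith
  refine e7.trans ?_
  have e8 : 23 / 100 ≤ 2 - (1 / 8 * (4 + 16 / 3 * (7 / 11) - σ * (2 / 3)) + 4 / 5 +
      2 / 5 * σ ^ 2) := by linarith
  have e9 := mul_le_mul e8 (by linarith [e5] : 2 * σ ≤ 4 - ((6 * s / (3 * s + 1)) ^ 2 *
    (1 + σ ^ 3 / 10) + (σ ^ 5 / 4 + 2 / 5 * σ ^ 2 * (1 + σ ^ 3 / 8) ^ 2))) (by positivity)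
    (by linarith)
  linarith

/-- The moment constants of the expected error add up to at most `4`. -/
theorem error_constants_le (hs : 0 < s) (hδ : 0 < δ) (hδ1 : δ < 1) (hsδ : 2 ≤ s ∨ δ ≤ 1 / 2)
    (hn : 0 < n) (hlam : 0 < lam) (hlam2 : lam ≤ 1 / 2)
    (hL : 4 * Real.log (s / δ) ≤ n * lam ^ 2) (m₁ m₂ : ℝ) (hm : 0 ≤ m₁ * m₂) :
    (2 + (s : ℝ)⁻¹ * ((s - 1) * (Real.log (256 / (δ / s) ^ 6) / (3 / 8 * n)) +
      2 * (Real.log (256 / (δ / s) ^ 6) / (3 / 2 * n) + Real.log (4 / δ) / (3 / 8 * n))) /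
        (4 * lam) + devScale s n lam (256 / (δ / s) ^ 6) + 4 * s * devScale s n lam (4 / δ)) *
        m₁ ^ 2 +
      8 * s * (4 * √(4 / δ / (256 / (δ / s) ^ 6)) + 2 * devScale s n lam (4 / δ) +
        2 * √(4 / δ / (256 / (δ / s) ^ 6)) * devScale s n lam (4 / δ)) * (m₁ * m₂) +
      ((6 * s / (3 * s + 1)) ^ 2 * (1 + devScale s n lam (4 / δ)) +
        4 * s * (4 * √(4 / δ / (256 / (δ / s) ^ 6)) ^ 2 + devScale s n lam (4 / δ) *
          (1 + √(4 / δ / (256 / (δ / s) ^ 6))) ^ 2)) * m₂ ^ 2 ≤ 4 * (m₁ ^ 2 + m₂ ^ 2) := by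
  have hs1 : (1 : ℝ) ≤ s := by exact_mod_cast hs
  have hs0 : (0 : ℝ) < s := by linarith
  have hδs : 2 * δ ≤ s := by
    rcases hsδ with h | h
    · have : (2 : ℝ) ≤ s := by exact_mod_cast h
      linarith
    · linarith
  have hlog2 := Real.log_two_gt_d9
  have hex := exp_devRate_le (n := n) (lam := lam) hs hδ (by linarith) hL
  set x := devScale s n lam (4 / δ) with hx
  set y := devScale s n lam (256 / (δ / s) ^ 6) with hy
  set q := √(4 / δ / (256 / (δ / s) ^ 6)) with hq
  have hx0 : 0 ≤ x := devScale_nonneg _ _ _ _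
  have hq0 : 0 ≤ q := Real.sqrt_nonneg _
  set ex := Real.exp (-(4 * devRate s * n * lam ^ 2)) with hexd
  set u := δ / s with hu
  have hu0 : 0 < u := by positivity
  have hδu : δ = u * s := by rw [hu]; field_simp
  have hqe : 4 / δ / (256 / u ^ 6) = u ^ 5 / (64 * s) := by
    rw [hδu]; field_simp; norm_num
  set W := (s : ℝ)⁻¹ * ((s - 1) * (Real.log (256 / u ^ 6) / (3 / 8 * n)) +
      2 * (Real.log (256 / u ^ 6) / (3 / 2 * n) + Real.log (4 / δ) / (3 / 8 * n))) /
        (4 * lam) with hWd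
  -- All coefficients increase with x, y and q, so upper bounds for these can be inserted. The
  -- values s = 1, s = 2 and s ≥ 3 require different bounds.
  have key : ∀ {ℓ : ℝ} (x' y' q' : ℝ), Real.log 2 ≤ ℓ * Real.log (s / δ) → x ≤ x' → y ≤ y' →
      q ≤ q' → 1 / 8 * (4 + 16 / 3 * ℓ - (s : ℝ)⁻¹ * (2 / 3)) + y' + 4 * s * x' < 2 →
            (8 * s * (4 * q' + 2 * x' + 2 * q' * x')) ^ 2 ≤
        4 * ((2 - (1 / 8 * (4 + 16 / 3 * ℓ - (s : ℝ)⁻¹ * (2 / 3)) + y' + 4 * s * x')) *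
        (4 - ((6 * s / (3 * s + 1)) ^ 2 * (1 + x') + 4 * s * (4 * q' ^ 2 + x' * (1 + q') ^ 2)))) →
      (2 + W + y + 4 * s * x) * m₁ ^ 2 + 8 * s * (4 * q + 2 * x + 2 * q * x) * (m₁ * m₂) +
        ((6 * s / (3 * s + 1)) ^ 2 * (1 + x) + 4 * s * (4 * q ^ 2 + x * (1 + q) ^ 2)) * m₂ ^ 2 ≤
        4 * (m₁ ^ 2 + m₂ ^ 2) := by
    intro ℓ x' y' q' hℓ hxx hyy hqq hA hquad
    have hW := residual_rate_le hs hδ hδ1 hδs hn hlam hlam2 hL hℓ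
    rw [← hu, ← hWd] at hW
    have hquad' := quadratic_form_le (m₁ := m₁) (m₂ := m₂) (A := 2 +
      (1 / 8 * (4 + 16 / 3 * ℓ - (s : ℝ)⁻¹ * (2 / 3)) + y' + 4 * s * x'))
      (B := (6 * s / (3 * s + 1)) ^ 2 * (1 + x') + 4 * s * (4 * q' ^ 2 + x' * (1 + q') ^ 2))
      (C := 8 * s * (4 * q' + 2 * x' + 2 * q' * x')) (by linarith)
      (hquad.trans (le_of_eq (by ring)))
    refine le_trans ?_ hquad'
    have hx'0 := hx0.trans hxx
    have hq'0 := hq0.trans hqq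
    have hsx : 4 * (s : ℝ) * x ≤ 4 * s * x' := by gcongr
    gcongr ?_ * m₁ ^ 2 + ?_ * (m₁ * m₂) + ?_ * m₂ ^ 2
    · linarith
    · gcongr
    · gcongr
  have hlogpos : Real.log 2 ≤ Real.log (s / δ) :=
    Real.log_le_log (by norm_num) ((le_div_iff₀ hδ).2 hδs)
  rcases (by omega : s = 1 ∨ s = 2 ∨ 3 ≤ s) with h1 | h2 | h3
  · have hsr : (s : ℝ) = 1 := by simp [h1]
    have hu2 : u ≤ 1 / 2 := by rw [hu, div_le_div_iff₀ hs0 (by norm_num)]; linarith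
    have hex' := hex 15 (by rw [hsr]; norm_num)
    refine key (ℓ := 1) (1 / 1000) (1 / 10) (1 / 40) (by linarith) ?_ ?_ ?_ ?_ ?_
    · refine devScale_le (by norm_num) ?_
      calc ex * (4 / δ) ≤ u ^ 15 * (4 / (u * s)) := by rw [← hδu]; gcongr
        _ = 4 * u ^ 14 := by rw [hsr]; field_simp
        _ ≤ 4 * (1 / 2) ^ 14 := by gcongr
        _ ≤ _ := by norm_num
    · refine devScale_le (by norm_num) ?_
      calc ex * (256 / u ^ 6) ≤ u ^ 15 * (256 / u ^ 6) := by gcongr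
        _ = 256 * u ^ 9 := by field_simp
        _ ≤ 256 * (1 / 2) ^ 9 := by gcongr
        _ ≤ _ := by norm_num
    · refine Real.sqrt_le_iff.2 ⟨by norm_num, ?_⟩
      rw [hqe, hsr]
      calc u ^ 5 / (64 * 1) ≤ (1 / 2) ^ 5 / (64 * 1) := by gcongr
        _ ≤ _ := by norm_num
    all_goals rw [hsr]; norm_num
  · have hsr : (s : ℝ) = 2 := by simp [h2]
    have hu2 : u ≤ 1 / 2 := by rw [hu, div_le_div_iff₀ hs0 (by norm_num)]; linarith
    have hex' := hex 9 (by rw [hsr]; norm_num)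
    refine key (ℓ := 1) (45 / 10000) (283 / 1000) (1 / 64) (by linarith) ?_ ?_ ?_ ?_ ?_
    · refine devScale_le (by norm_num) ?_
      calc ex * (4 / δ) ≤ u ^ 9 * (4 / (u * s)) := by rw [← hδu]; gcongr
        _ = 2 * u ^ 8 := by rw [hsr]; field_simp; norm_num
        _ ≤ 2 * (1 / 2) ^ 8 := by gcongr
        _ ≤ _ := by norm_num
    · refine devScale_le (by norm_num) ?_
      calc ex * (256 / u ^ 6) ≤ u ^ 9 * (256 / u ^ 6) := by gcongr
        _ = 256 * u ^ 3 := by field_simp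
        _ ≤ 256 * (1 / 2) ^ 3 := by gcongr
        _ ≤ _ := by norm_num
    · refine Real.sqrt_le_iff.2 ⟨by norm_num, ?_⟩
      rw [hqe, hsr]
      calc u ^ 5 / (64 * 2) ≤ (1 / 2) ^ 5 / (64 * 2) := by gcongr
        _ ≤ _ := by norm_num
    all_goals rw [hsr]; norm_num
  · have hsr : (3 : ℝ) ≤ s := by exact_mod_cast h3
    set σ := (s : ℝ)⁻¹ with hσ
    have hσ0 : 0 < σ := by positivity
    have hσs : σ * s = 1 := inv_mul_cancel₀ hs0.ne'
    have hσ3 : σ ≤ 1 / 3 := by nlinarith [mul_le_mul_of_nonneg_left hsr hσ0.le]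
    have huσ : u ≤ σ := by
      rw [hu, hσ, div_eq_mul_inv]
      exact mul_le_of_le_one_left (by positivity) hδ1.le
    have hex' := hex 6 (by push_cast; linarith)
    refine key (ℓ := 7 / 11) (σ ^ 3 / 10) (4 / 5) (σ ^ 3 / 8) ?_ ?_ ?_ ?_ ?_ ?_
    · have e1 : Real.log 3 ≤ Real.log (s / δ) :=
        Real.log_le_log (by norm_num) ((le_div_iff₀ hδ).2 (by nlinarith))
      -- 2¹¹ = 2048 ≤ 2187 = 3⁷, which justifies ℓ = 7/11 when s/δ ≥ 3.
      have e2 : 11 * Real.log 2 ≤ 7 * Real.log 3 := by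
        have h := Real.log_le_log (by norm_num) (by norm_num : (2 : ℝ) ^ 11 ≤ 3 ^ 7)
        rw [Real.log_pow, Real.log_pow] at h
        exact_mod_cast h
      linarith
    · refine devScale_le (by positivity) ?_
      calc ex * (4 / δ) ≤ u ^ 6 * (4 / (u * s)) := by rw [← hδu]; gcongr
        _ = 4 * u ^ 5 * σ := by rw [hσ]; field_simp
        _ ≤ 4 * σ ^ 5 * σ := by gcongr
        _ = _ := by ring
    -- The power (δ/s)⁶ in Θ cancels against the exponential factor, leaving 256 = (20 · 4/5)², a
    -- bound uniform in s.
    · refine devScale_le (by norm_num) ?_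
      calc ex * (256 / u ^ 6) ≤ u ^ 6 * (256 / u ^ 6) := by gcongr
        _ = 256 := by field_simp
        _ ≤ _ := by norm_num
    · refine Real.sqrt_le_iff.2 ⟨by positivity, ?_⟩
      rw [hqe]
      calc u ^ 5 / (64 * s) = u ^ 5 * σ / 64 := by rw [hσ]; field_simp
        _ ≤ σ ^ 5 * σ / 64 := by gcongr
        _ = _ := by ring
    · exact (error_constants_numeric hsr).1
    · exact (error_constants_numeric hsr).2

end Scalar

/-! ### The error bound for features bounded by one. -/

section Normalized

theorem integral_le_log_of_integral_exp_le {α : Type*} [MeasurableSpace α] (P : Measure α)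
    [IsProbabilityMeasure P] {f : α → ℝ} (hf : BddMeas f) {M : ℝ}
    (h : ∫ a, Real.exp (f a) ∂P ≤ M) : ∫ a, f a ∂P ≤ Real.log M := by
  have hj : Real.exp (∫ a, f a ∂P) ≤ ∫ a, Real.exp (f a) ∂P :=
    convexOn_exp.map_integral_le Real.continuous_exp.continuousOn isClosed_univ
      (Filter.Eventually.of_forall fun _ => Set.mem_univ _) (hf.integrable P) (hf.exp.integrable P)
  exact (Real.le_log_iff_exp_le ((Real.exp_pos _).trans_le (hj.trans h))).2 (hj.trans h)

variable {𝒳 𝒱 : Type*} [MeasurableSpace 𝒳] [MeasurableSpace 𝒱] {n s : ℕ} (ρ : Measure 𝒳)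
  [IsProbabilityMeasure ρ] (μ : Measure 𝒱) [IsProbabilityMeasure μ] {ψ : 𝒳 → 𝒱 → ℝ}
  {lam δ : ℝ} {g : 𝒱 → ℝ}

/-- Cauchy–Schwarz against the indicator of A: on a set of small measure the L¹ norm is much smaller
than the L² norm. -/
theorem integral_abs_indicator_le (hg : BddMeas g) {A : Set 𝒱} (hA : MeasurableSet A) {q : ℝ}
    (hq : μ.real A ≤ q) : ∫ v, |A.indicator g v| ∂μ ≤ √q * √(∫ v, A.indicator g v ^ 2 ∂μ) := by
  have h1 : BddMeas (A.indicator fun _ : 𝒱 => (1 : ℝ)) := (BddMeas.const 1).indicator hA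
  have h := integral_mul_le_sqrt μ h1 (hg.indicator hA).abs
  have e1 : ∀ v, A.indicator (fun _ => (1 : ℝ)) v * |A.indicator g v| = |A.indicator g v| := by
    intro v; by_cases hv : v ∈ A <;> simp [hv]
  have e2 : ∀ v, A.indicator (fun _ => (1 : ℝ)) v ^ 2 = A.indicator (fun _ => (1 : ℝ)) v := by
    intro v; by_cases hv : v ∈ A <;> simp [hv]
  simp only [e1, e2, sq_abs] at h
  have e3 : ∫ v, A.indicator (fun _ => (1 : ℝ)) v ∂μ = μ.real A := by
    rw [integral_indicator hA]; simp
  rw [e3] at h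
  exact h.trans (by gcongr)

/-- The exponential moments of the deviations of the empirical inner products of features. -/
noncomputable def devMoment (ρ : Measure 𝒳) (μ : Measure 𝒱) (ψ : 𝒳 → 𝒱 → ℝ) (x : Fin n → 𝒳) : ℝ :=
  ∫ v, Real.exp (3 / 2 * n * featureDev ρ ψ x v v ^ 2) ∂μ +
    ∫ v, ∫ w, Real.exp (3 / 8 * n * featureDev ρ ψ x v w ^ 2) ∂μ ∂μ

theorem integral_ridgeRes_fluctuation_sq_le_of_half_le (hn : 0 < n) (hs : 0 < s)
    (hψ : Measurable (Function.uncurry ψ)) (hψ1 : ∀ z v, |ψ z v| ≤ 1) (hg : BddMeas g)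
    (hlam : 1 / 2 ≤ lam) (x : Fin n → 𝒳) :
    ∫ V, ∫ z, ridgeRes (fun z p => ψ z (V p)) lam x (fluctuation μ ψ g V) z ^ 2 ∂ρ
        ∂(Measure.pi fun _ : Fin s => μ) ≤ 4 / s * ∫ v, g v ^ 2 ∂μ := by
  have t := ((meanLE_integral_fluctuation_sq μ ρ hs hψ hψ1 hg).const_mul zero_le_two).add
    ((meanLE_mean_fluctuation_sq μ hn hs hψ hψ1 hg x).const_mul zero_le_two)
  refine (integral_mono_of_nonneg (Filter.Eventually.of_forall fun V =>
    integral_nonneg fun z => sq_nonneg _) (t.1.integrable _)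
    (Filter.Eventually.of_forall fun V => ?_)).trans (t.2.trans (le_of_eq (by ring)))
  have hφ : ∀ p, BddMeas fun z => ψ z (V p) := fun p => bddMeas_feature hψ hψ1 (V p)
  exact integral_ridgeRes_sq_le_two_mul ρ hn (by linarith) hφ
    (covExcessLE_of_half_le ρ hs hφ (fun z p => hψ1 z _) hlam) (bddMeas_fluctuation μ hψ hψ1 hg V)

/-- The data enter only through the moment bound `hx`, so the estimate holds for every coefficient
function g, including one that depends on the targets. -/
theorem integral_ridgeRes_fluctuation_sq_le_of_devMoment_le (hn : 0 < n) (hs : 0 < s)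
    (hψ : Measurable (Function.uncurry ψ)) (hψ1 : ∀ z v, |ψ z v| ≤ 1) (hg : BddMeas g)
    (hδ : 0 < δ) (hδ1 : δ < 1) (hsδ : 2 ≤ s ∨ δ ≤ 1 / 2) (hlam : 0 < lam)
    (hL : 4 * Real.log (s / δ) ≤ n * lam ^ 2) (x : Fin n → 𝒳)
    (hx : devMoment ρ μ ψ x ≤ 4 / δ) :
    ∫ V, ∫ z, ridgeRes (fun z p => ψ z (V p)) lam x (fluctuation μ ψ g V) z ^ 2 ∂ρ
        ∂(Measure.pi fun _ : Fin s => μ) ≤ 4 / s * ∫ v, g v ^ 2 ∂μ := by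
  rcases le_total (1 / 2) lam with hlam2 | hlam2
  · exact integral_ridgeRes_fluctuation_sq_le_of_half_le ρ μ hn hs hψ hψ1 hg hlam2 x
  have hs0 : (0 : ℝ) < s := by exact_mod_cast hs
  have hs1 : (1 : ℝ) ≤ s := by exact_mod_cast hs
  have hn0 : (0 : ℝ) < n := by exact_mod_cast hn
  have hδs : 2 * δ ≤ s := by
    rcases hsδ with h | h
    · have : (2 : ℝ) ≤ s := by exact_mod_cast h
      linarith
    · linarith
  set T := featureDev ρ ψ x with hTd
  have hT : BddMeas fun q : 𝒱 × 𝒱 => T q.1 q.2 := bddMeas_featureDev ρ hψ hψ1 x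
  have hTv : ∀ v, BddMeas fun w => T v w := fun v =>
    BddMeas.comp (h := fun w : 𝒱 => (v, w)) hT (measurable_const.prodMk measurable_id)
  have hTd' : BddMeas fun v => T v v :=
    BddMeas.comp (h := fun v : 𝒱 => (v, v)) hT (measurable_id.prodMk measurable_id)
  have hE1 : BddMeas fun v => Real.exp (3 / 2 * n * T v v ^ 2) := ((hTd'.pow 2).const_mul _).exp
  have hE2 : BddMeas fun v => ∫ w, Real.exp (3 / 8 * n * T v w ^ 2) ∂μ :=
    (bddMeas_kernel_exp hT _).integral_left μ
  have hp1 : 0 ≤ ∫ v, Real.exp (3 / 2 * n * T v v ^ 2) ∂μ :=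
    integral_nonneg fun v => (Real.exp_pos _).le
  have hp2 : 0 ≤ ∫ v, ∫ w, Real.exp (3 / 8 * n * T v w ^ 2) ∂μ ∂μ :=
    integral_nonneg fun v => integral_nonneg fun w => (Real.exp_pos _).le
  set h := 4 / δ with hh
  have hh0 : 0 < h := by positivity
  have hx' : ∫ v, Real.exp (3 / 2 * n * T v v ^ 2) ∂μ +
    ∫ v, ∫ w, Real.exp (3 / 8 * n * T v w ^ 2) ∂μ ∂μ ≤ h := hx
  -- The threshold balances two demands: h/Θ must be small, so that atypical features are rare,
  -- while `devScale s n lam Θ` must stay bounded.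
  set Θ := 256 / (δ / s) ^ 6 with hΘd
  have hΘ0 : 0 < Θ := by positivity
  have hΘ : h ≤ Θ := by
    rw [hh, hΘd, div_le_div_iff₀ hδ (by positivity)]
    have h1 : δ / s ≤ δ := div_le_self hδ.le hs1
    have h2 : (δ / s) ^ 6 ≤ δ := by
      calc (δ / s) ^ 6 ≤ δ ^ 6 := by gcongr
        _ ≤ δ ^ 1 := pow_le_pow_of_le_one hδ.le hδ1.le (by norm_num)
        _ = δ := pow_one δ
    linarith
  set A : Set 𝒱 := {v | Θ ≤ Real.exp (3 / 2 * n * T v v ^ 2) +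
    ∫ w, Real.exp (3 / 8 * n * T v w ^ 2) ∂μ} with hA
  have hAm : MeasurableSet A := measurableSet_le measurable_const (hE1.add hE2).1
  -- Markov's inequality in the feature variable.
  have hAμ : μ.real A ≤ h / Θ := by
    rw [le_div_iff₀ hΘ0, mul_comm]
    refine (mul_meas_ge_le_integral_of_nonneg (Filter.Eventually.of_forall fun v => ?_)
      ((hE1.add hE2).integrable μ) Θ).trans ?_
    · exact add_nonneg (Real.exp_pos _).le (integral_nonneg fun w => (Real.exp_pos _).le)
    · rw [integral_add (hE1.integrable μ) (hE2.integrable μ)]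
      exact hx'
  have hg₁ := hg.indicator hAm.compl
  have hg₂ := hg.indicator hAm
  have hsupp : ∀ v, Aᶜ.indicator g v ≠ 0 → Real.exp (3 / 2 * n * T v v ^ 2) ≤ Θ ∧
      ∫ w, Real.exp (3 / 8 * n * T v w ^ 2) ∂μ ≤ Θ := by
    intro v hv
    have hvA : v ∈ Aᶜ := by
      by_contra hc
      exact hv (by simp [Set.indicator, hc])
    have hlt : Real.exp (3 / 2 * n * T v v ^ 2) +
      ∫ w, Real.exp (3 / 8 * n * T v w ^ 2) ∂μ < Θ := not_le.1 hvA
    have a1 := Real.exp_pos (3 / 2 * n * T v v ^ 2)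
    have a2 : 0 ≤ ∫ w, Real.exp (3 / 8 * n * T v w ^ 2) ∂μ :=
      integral_nonneg fun w => (Real.exp_pos _).le
    constructor <;> linarith
  have hb := integral_integral_ridgeRes_fluctuation_sq_le ρ μ hn hs hψ hψ1 hg₁ hg₂
    (fun v => by by_cases hv : v ∈ A <;> simp [hv]) hlam hlam2
    (one_le_devRate_mul hs hδ hδs hL) x hh0.le hΘ (q := √(h / Θ)) (Real.sqrt_nonneg _)
    -- Second moments of the deviations follow from the exponential moments by Jensen's inequality;
    -- the diagonal bound τ' holds pointwise.
    (τ := Real.log Θ / (3 / 8 * n)) (τ' := Real.log Θ / (3 / 2 * n))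
    (H := Real.log h / (3 / 8 * n)) (by linarith) (by linarith)
    (fun v hv => (hsupp v hv).1) (fun v hv => (hsupp v hv).2)
    (fun v hv => by
      rw [le_div_iff₀ (by positivity), mul_comm, ← integral_const_mul]
      exact integral_le_log_of_integral_exp_le μ (((hTv v).pow 2).const_mul _) (hsupp v hv).2)
    (fun v hv => by
      rw [le_div_iff₀ (by positivity), mul_comm]
      exact (Real.le_log_iff_exp_le hΘ0).2 (hsupp v hv).1)
    (by
      rw [le_div_iff₀ (by positivity), mul_comm, ← integral_const_mul]
      simp only [← integral_const_mul]
      have hc := (hT.pow 2).const_mul (3 / 8 * n)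
      rw [← integral_prod (fun q : 𝒱 × 𝒱 => 3 / 8 * n * T q.1 q.2 ^ 2) (hc.integrable _)]
      refine integral_le_log_of_integral_exp_le _ hc ?_
      rw [integral_prod _ (hc.exp.integrable _)]
      linarith)
    (integral_abs_indicator_le μ hg hAm hAμ)
  have e1 : ∀ (V : Fin s → 𝒱), (fun z => fluctuation μ ψ (Aᶜ.indicator g) V z +
      fluctuation μ ψ (A.indicator g) V z) = fluctuation μ ψ g V := by
    intro V
    funext z
    rw [← fluctuation_add μ hψ hψ1 hg₁ hg₂]
    congr 1
    exact Set.indicator_compl_add_self A g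
  simp only [e1] at hb
  have hc := error_constants_le hs hδ hδ1 hsδ hn0 hlam hlam2 hL
    (√(∫ v, Aᶜ.indicator g v ^ 2 ∂μ)) (√(∫ v, A.indicator g v ^ 2 ∂μ)) (by positivity)
  rw [Real.sq_sqrt (integral_nonneg fun v => sq_nonneg _),
    Real.sq_sqrt (integral_nonneg fun v => sq_nonneg _)] at hc
  refine hb.trans ((mul_le_mul_of_nonneg_left hc (by positivity)).trans (le_of_eq ?_))
  rw [← integral_add ((hg₁.pow 2).integrable μ) ((hg₂.pow 2).integrable μ)]
  have e2 : ∀ v, Aᶜ.indicator g v ^ 2 + A.indicator g v ^ 2 = g v ^ 2 := by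
    intro v; by_cases hv : v ∈ A <;> simp [hv]
  simp only [e2]
  ring

end Normalized

/-! ### Concentration of the empirical inner products. -/

section Concentration

theorem lintegral_exp_mul_sq_gaussianReal :
    ∫⁻ t, ENNReal.ofReal (Real.exp (3 / 8 * t ^ 2)) ∂(gaussianReal 0 1) = 2 := by
  rw [gaussianReal_of_var_ne_zero 0 one_ne_zero,
    lintegral_withDensity_eq_lintegral_mul _ (measurable_gaussianPDF 0 1) (by fun_prop)]
  have e : ∀ t : ℝ, (gaussianPDF 0 1 * fun t => ENNReal.ofReal (Real.exp (3 / 8 * t ^ 2))) t =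
      ENNReal.ofReal ((√(2 * Real.pi))⁻¹ * Real.exp (-(1 / 8) * t ^ 2)) := by
    intro t
    rw [Pi.mul_apply, gaussianPDF, ← ENNReal.ofReal_mul (gaussianPDFReal_nonneg _ _ _),
      gaussianPDFReal, mul_assoc, ← Real.exp_add]
    simp only [NNReal.coe_one, mul_one, sub_zero]
    congr 3
    ring
  simp only [e]
  rw [← ofReal_integral_eq_lintegral_ofReal
    ((integrable_exp_neg_mul_sq (by norm_num : (0 : ℝ) < 1 / 8)).const_mul _)
    (Filter.Eventually.of_forall fun t => by positivity), integral_const_mul, integral_gaussian]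
  have : √(Real.pi / (1 / 8)) = 2 * √(2 * Real.pi) := by
    rw [show Real.pi / (1 / 8) = 2 ^ 2 * (2 * Real.pi) by ring,
      Real.sqrt_mul (by positivity), Real.sqrt_sq (by norm_num)]
  have hpos : 0 < √(2 * Real.pi) := by positivity
  rw [this, show (√(2 * Real.pi))⁻¹ * (2 * √(2 * Real.pi)) = 2 by field_simp]
  simp

theorem lintegral_exp_mul_gaussianReal (b : ℝ) :
    ∫⁻ t, ENNReal.ofReal (Real.exp (b * t)) ∂(gaussianReal 0 1) =
      ENNReal.ofReal (Real.exp (b ^ 2 / 2)) := by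
  rw [← ofReal_integral_eq_lintegral_ofReal (integrable_exp_mul_gaussianReal b)
    (Filter.Eventually.of_forall fun t => (Real.exp_pos _).le)]
  have := congrFun (mgf_id_gaussianReal (μ := 0) (v := 1)) b
  simp only [mgf, id, zero_mul, zero_add, NNReal.coe_one, one_mul] at this
  rw [this]

/-- The square of a sub-Gaussian variable has an exponential moment. -/
theorem integral_exp_mul_sq_le_two {Ω : Type*} [MeasurableSpace Ω] (P : Measure Ω)
    [IsProbabilityMeasure P] {Z : Ω → ℝ} (hZ : BddMeas Z) {c : ℝ} (hc : 0 < c)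
    (h : ∀ t, ∫ ω, Real.exp (t * Z ω) ∂P ≤ Real.exp (c * t ^ 2 / 2)) :
    ∫ ω, Real.exp (3 / (8 * c) * Z ω ^ 2) ∂P ≤ 2 := by
  -- Linearization: exp(a²Z²/2) is the Gaussian mean of exp(aZt). After exchanging integrals, the
  -- sub-Gaussian bound yields exp(ca²t²/2) = exp(3t²/8), whose Gaussian mean is (1 - 3/4)^(-1/2) =
  -- 2.
  set a := √(3 / (4 * c)) with ha
  have ha2 : a ^ 2 = 3 / (4 * c) := Real.sq_sqrt (by positivity)
  have key : ∫⁻ ω, ENNReal.ofReal (Real.exp (3 / (8 * c) * Z ω ^ 2)) ∂P ≤ 2 := by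
    calc ∫⁻ ω, ENNReal.ofReal (Real.exp (3 / (8 * c) * Z ω ^ 2)) ∂P =
        ∫⁻ ω, ∫⁻ t, ENNReal.ofReal (Real.exp (a * Z ω * t)) ∂(gaussianReal 0 1) ∂P := by
          refine lintegral_congr fun ω => ?_
          rw [lintegral_exp_mul_gaussianReal, mul_pow, ha2]
          congr 2
          field_simp
          ring
      _ = ∫⁻ t, ∫⁻ ω, ENNReal.ofReal (Real.exp (a * Z ω * t)) ∂P ∂(gaussianReal 0 1) := by
          refine lintegral_lintegral_swap (Measurable.aemeasurable ?_)
          have := hZ.1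
          fun_prop
      _ ≤ ∫⁻ t, ENNReal.ofReal (Real.exp (3 / 8 * t ^ 2)) ∂(gaussianReal 0 1) := by
          refine lintegral_mono fun t => ?_
          have e : ∀ ω, a * Z ω * t = a * t * Z ω := fun ω => by ring
          simp only [e]
          rw [← ofReal_integral_eq_lintegral_ofReal ((hZ.const_mul _).exp.integrable P)
            (Filter.Eventually.of_forall fun ω => (Real.exp_pos _).le)]
          refine ENNReal.ofReal_le_ofReal ((h (a * t)).trans (le_of_eq ?_))
          rw [mul_pow, ha2]
          congr 1
          field_simp
          ring
      _ = 2 := lintegral_exp_mul_sq_gaussianReal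
  rw [integral_eq_lintegral_of_nonneg_ae (Filter.Eventually.of_forall fun ω => (Real.exp_pos _).le)
    ((hZ.pow 2).const_mul _).exp.1.aestronglyMeasurable]
  exact ENNReal.toReal_le_of_le_ofReal (by norm_num) (by simpa using key)

variable {𝒳 Ω : Type*} [MeasurableSpace 𝒳] [MeasurableSpace Ω] {n : ℕ} (ρ : Measure 𝒳)
  (P : Measure Ω) [IsProbabilityMeasure P] {x : Fin n → Ω → 𝒳}

/-- By Hoeffding's lemma and independence the deviation is sub-Gaussian with variance proxy c = (b -
a)²/(4n), and 3/(8c) is the stated exponent. -/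
theorem integral_exp_mul_sampleDev_sq_le_two (hn : 0 < n) (hx : ∀ i, Measurable (x i))
    (hindep : iIndepFun x P) (hlaw : ∀ i, P.map (x i) = ρ) {h k : 𝒳 → ℝ} (hh : BddMeas h)
    (hk : BddMeas k) {a b : ℝ} (hab : a < b) (hbd : ∀ z, h z * k z ∈ Set.Icc a b) :
    ∫ ω, Real.exp (3 / 2 / (b - a) ^ 2 * n * sampleDev ρ (fun i => x i ω) h k ^ 2) ∂P ≤ 2 := by
  have hn0 : (0 : ℝ) < n := by exact_mod_cast hn
  have hr : 0 < b - a := sub_pos.2 hab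
  have hhk := hh.mul hk
  set m := ∫ z, h z * k z ∂ρ with hm
  have hZ : BddMeas fun ω => sampleDev ρ (fun i => x i ω) h k :=
    (BddMeas.const _).sub (BddMeas.const_mul _ (BddMeas.sum _ fun i => hhk.comp (hx i)))
  have hmean : ∀ i, ∫ ω, h (x i ω) * k (x i ω) ∂P = m := by
    intro i
    rw [hm, ← hlaw i, integral_map (hx i).aemeasurable hhk.1.aestronglyMeasurable]
  have hsub := HasSubgaussianMGF.sum_of_iIndepFun (s := Finset.univ)
    (hindep.comp (fun _ z => h z * k z - m) fun _ => hhk.1.sub measurable_const)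
    (c := fun _ => (‖b - a‖₊ / 2) ^ 2) fun i _ => by
      have := hasSubgaussianMGF_of_mem_Icc (μ := P) (X := fun ω => h (x i ω) * k (x i ω))
        (hhk.1.comp (hx i)).aemeasurable (Filter.Eventually.of_forall fun ω => hbd _)
      rw [hmean i] at this
      exact this
  have hmgf : ∀ t, ∫ ω, Real.exp (t * sampleDev ρ (fun i => x i ω) h k) ∂P ≤
      Real.exp ((b - a) ^ 2 / (4 * n) * t ^ 2 / 2) := by
    intro t
    refine le_trans (le_of_eq ?_) ((hsub.mgf_le (-(t / n))).trans (le_of_eq ?_))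
    · rw [mgf]
      congr 1
      funext ω
      congr 1
      simp only [sampleDev, ← hm, Function.comp, Finset.sum_sub_distrib, Finset.sum_const,
        Finset.card_univ, Fintype.card_fin, nsmul_eq_mul]
      field_simp
      ring
    · congr 1
      simp only [Finset.sum_const, Finset.card_univ, Fintype.card_fin, nsmul_eq_mul]
      push_cast
      rw [Real.norm_of_nonneg hr.le]
      field_simp
      ring
  have := integral_exp_mul_sq_le_two P hZ (by positivity) hmgf
  refine le_trans (le_of_eq ?_) this
  congr 1
  funext ω
  congr 2
  field_simp
  norm_num

variable [IsProbabilityMeasure ρ] {𝒱 : Type*} [MeasurableSpace 𝒱] (μ : Measure 𝒱)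
  [IsProbabilityMeasure μ] {ψ : 𝒳 → 𝒱 → ℝ}

theorem bddMeas_featureDev_sample (hψ : Measurable (Function.uncurry ψ)) (hψ1 : ∀ z v, |ψ z v| ≤ 1)
    (hx : ∀ i, Measurable (x i)) :
    BddMeas fun q : Ω × (𝒱 × 𝒱) => featureDev ρ ψ (fun i => x i q.1) q.2.1 q.2.2 := by
  have hb := bddMeas_uncurry hψ hψ1
  have h0 : BddMeas fun q : 𝒱 × 𝒱 => ∫ z, ψ z q.1 * ψ z q.2 ∂ρ :=
    BddMeas.integral_left (f := fun q : (𝒱 × 𝒱) × 𝒳 => ψ q.2 q.1.1 * ψ q.2 q.1.2)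
      (BddMeas.mul
        (BddMeas.comp (h := fun q : (𝒱 × 𝒱) × 𝒳 => (q.2, q.1.1)) hb (by fun_prop))
        (BddMeas.comp (h := fun q : (𝒱 × 𝒱) × 𝒳 => (q.2, q.1.2)) hb (by fun_prop))) ρ
  refine BddMeas.sub (h0.comp measurable_snd)
    (BddMeas.const_mul _ (BddMeas.sum _ fun i => BddMeas.mul ?_ ?_))
  · exact BddMeas.comp (h := fun q : Ω × (𝒱 × 𝒱) => (x i q.1, q.2.1)) hb
      (((hx i).comp measurable_fst).prodMk (by fun_prop))
  · exact BddMeas.comp (h := fun q : Ω × (𝒱 × 𝒱) => (x i q.1, q.2.2)) hb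
      (((hx i).comp measurable_fst).prodMk (by fun_prop))

/-- Squares ψ² lie in [0, 1] and products in [-1, 1]. Intervals of lengths 1 and 2 give the
exponents 3/2 and 3/8, each with mean at most 2. -/
theorem meanLE_devMoment (hn : 0 < n) (hψ : Measurable (Function.uncurry ψ))
    (hψ1 : ∀ z v, |ψ z v| ≤ 1) (hx : ∀ i, Measurable (x i))
    (hindep : iIndepFun x P) (hlaw : ∀ i, P.map (x i) = ρ) :
    MeanLE P (fun ω => devMoment ρ μ ψ (fun i => x i ω)) 4 := by
  have hT := bddMeas_featureDev_sample ρ hψ hψ1 hx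
  have hf : ∀ v, BddMeas fun z => ψ z v := bddMeas_feature hψ hψ1
  have h1 : BddMeas fun q : Ω × 𝒱 =>
      Real.exp (3 / 2 * n * featureDev ρ ψ (fun i => x i q.1) q.2 q.2 ^ 2) :=
    BddMeas.exp (BddMeas.const_mul _ (BddMeas.pow (BddMeas.comp
      (h := fun q : Ω × 𝒱 => (q.1, (q.2, q.2))) hT (by fun_prop)) 2))
  have h2 : BddMeas fun q : Ω × (𝒱 × 𝒱) =>
      Real.exp (3 / 8 * n * featureDev ρ ψ (fun i => x i q.1) q.2.1 q.2.2 ^ 2) :=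
    ((hT.pow 2).const_mul _).exp
  have m1 : MeanLE P (fun ω => ∫ v, Real.exp (3 / 2 * n *
      featureDev ρ ψ (fun i => x i ω) v v ^ 2) ∂μ) 2 := by
    refine ⟨h1.integral_left μ, ?_⟩
    rw [integral_integral_swap (h1.integrable _)]
    have := integral_mono (μ := μ) ((BddMeas.integral_left (f := fun q : 𝒱 × Ω =>
      Real.exp (3 / 2 * n * featureDev ρ ψ (fun i => x i q.2) q.1 q.1 ^ 2))
      (h1.comp measurable_swap) P).integrable μ) (integrable_const 2) fun v => by
        have := integral_exp_mul_sampleDev_sq_le_two ρ P hn hx hindep hlaw (hf v) (hf v)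
          zero_lt_one fun z => ⟨mul_self_nonneg _, by
            rw [← sq]; exact (sq_le_one_iff_abs_le_one _).2 (hψ1 z v)⟩
        simp only [sub_zero, one_pow, div_one] at this
        exact this
    simpa using this
  have m2 : MeanLE P (fun ω => ∫ v, ∫ w, Real.exp (3 / 8 * n *
      featureDev ρ ψ (fun i => x i ω) v w ^ 2) ∂μ ∂μ) 2 := by
    have e : ∀ ω, ∫ v, ∫ w, Real.exp (3 / 8 * n *
        featureDev ρ ψ (fun i => x i ω) v w ^ 2) ∂μ ∂μ = ∫ q : 𝒱 × 𝒱, Real.exp (3 / 8 * n *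
        featureDev ρ ψ (fun i => x i ω) q.1 q.2 ^ 2) ∂(μ.prod μ) := fun ω =>
      (integral_prod (fun q : 𝒱 × 𝒱 => Real.exp (3 / 8 * n *
        featureDev ρ ψ (fun i => x i ω) q.1 q.2 ^ 2)) ((BddMeas.comp
        (h := fun q : 𝒱 × 𝒱 => (ω, q)) h2 (by fun_prop)).integrable _)).symm
    simp only [e]
    refine ⟨h2.integral_left _, ?_⟩
    rw [integral_integral_swap (h2.integrable _)]
    have := integral_mono (μ := μ.prod μ) ((BddMeas.integral_left (f := fun q : (𝒱 × 𝒱) × Ω =>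
      Real.exp (3 / 8 * n * featureDev ρ ψ (fun i => x i q.2) q.1.1 q.1.2 ^ 2))
      (h2.comp measurable_swap) P).integrable _) (integrable_const 2) fun q => by
        have := integral_exp_mul_sampleDev_sq_le_two ρ P hn hx hindep hlaw (hf q.1) (hf q.2)
          (by norm_num : (-1 : ℝ) < 1) fun z => abs_le.1 (by
            rw [abs_mul]; exact mul_le_one₀ (hψ1 z _) (abs_nonneg _) (hψ1 z _))
        norm_num at this
        exact this
    simpa using this
  have := m1.add m2
  norm_num at this
  exact this

theorem one_sub_le_measureReal_devMoment (hn : 0 < n) (hψ : Measurable (Function.uncurry ψ))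
    (hψ1 : ∀ z v, |ψ z v| ≤ 1) (hx : ∀ i, Measurable (x i))
    (hindep : iIndepFun x P) (hlaw : ∀ i, P.map (x i) = ρ) {δ : ℝ} (hδ : 0 < δ) :
    1 - δ ≤ P.real {ω | devMoment ρ μ ψ (fun i => x i ω) ≤ 4 / δ} := by
  have h := meanLE_devMoment ρ P μ hn hψ hψ1 hx hindep hlaw
  have hmarkov := (mul_meas_ge_le_integral_of_nonneg (μ := P)
    (f := fun ω => devMoment ρ μ ψ (fun i => x i ω)) (Filter.Eventually.of_forall fun ω =>
      add_nonneg (integral_nonneg fun v => (Real.exp_pos _).le)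
        (integral_nonneg fun v => integral_nonneg fun w => (Real.exp_pos _).le))
    (h.1.integrable P) (4 / δ)).trans h.2
  have h1 : P.real {ω | 4 / δ ≤ devMoment ρ μ ψ (fun i => x i ω)} ≤ δ := by
    rw [div_mul_eq_mul_div, div_le_iff₀ hδ] at hmarkov
    linarith
  have h2 : P.real {ω | 4 / δ ≤ devMoment ρ μ ψ (fun i => x i ω)}ᶜ ≤
      P.real {ω | devMoment ρ μ ψ (fun i => x i ω) ≤ 4 / δ} :=
    measureReal_mono fun ω hω => 
      (not_le.1 (show ¬4 / δ ≤ devMoment ρ μ ψ fun i => x i ω from hω)).le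
  rw [probReal_compl_eq_one_sub (measurableSet_le measurable_const h.1.1)] at h2
  linarith

end Concentration

/-! ### Kernel ridge regression identities and scaling. -/

section Reduction

variable {𝒳 𝒱 : Type*} {n s : ℕ} {κ : 𝒳 → 𝒳 → ℝ} {lam : ℝ}

theorem krrComplexity_eq_dotProduct {x : Fin n → 𝒳} (hK : (kernelMatrix κ x).PosSemidef)
    (y : Fin n → ℝ) : krrComplexity κ lam x y =
      dualCoeff κ lam x y ⬝ᵥ (kernelMatrix κ x *ᵥ dualCoeff κ lam x y) := by
  set K := kernelMatrix κ x with hKd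
  set α := dualCoeff κ lam x y with hα
  have h1 : CFC.sqrt K * CFC.sqrt K = K :=
    CFC.sqrt_mul_sqrt_self K (Matrix.nonneg_iff_posSemidef.2 hK)
  have h2 : (CFC.sqrt K)ᵀ = CFC.sqrt K := by
    have := (Matrix.nonneg_iff_posSemidef.1 (CFC.sqrt_nonneg K)).isHermitian.eq
    simpa [Matrix.conjTranspose_eq_transpose_of_trivial] using this
  calc krrComplexity κ lam x y = (CFC.sqrt K *ᵥ α) ⬝ᵥ (CFC.sqrt K *ᵥ α) := by
        rw [krrComplexity, EuclideanSpace.real_norm_sq_eq]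
        simp [dotProduct, sq, hKd, hα]
    _ = α ⬝ᵥ (K *ᵥ α) := by
        nth_rewrite 3 [← h1]
        rw [← Matrix.mulVec_mulVec, Matrix.dotProduct_mulVec α, ← Matrix.mulVec_transpose, h2]

theorem regularized_mulVec_dualCoeff (hn : 0 < n) (hlam : 0 < lam) {x : Fin n → 𝒳}
    (hK : (kernelMatrix κ x).PosSemidef) (y : Fin n → ℝ) :
    (kernelMatrix κ x + ((n : ℝ) * lam) • (1 : Matrix (Fin n) (Fin n) ℝ)) *ᵥ
      dualCoeff κ lam x y = y := by
  have hn' : (0 : ℝ) < n := by exact_mod_cast hn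
  have hpd := Matrix.PosDef.posSemidef_add hK
    (Matrix.PosDef.one.smul (mul_pos hn' hlam) :
      (((n : ℝ) * lam) • (1 : Matrix (Fin n) (Fin n) ℝ)).PosDef)
  rw [dualCoeff, Matrix.mulVec_mulVec, Matrix.mul_nonsing_inv _
    ((Matrix.isUnit_iff_isUnit_det _).1 hpd.isUnit), Matrix.one_mulVec]

theorem krrPredict_add_dualCoeff (hn : 0 < n) (hlam : 0 < lam) {x : Fin n → 𝒳}
    (hK : (kernelMatrix κ x).PosSemidef) (y : Fin n → ℝ) (i : Fin n) :
    krrPredict κ lam x y (x i) + n * lam * dualCoeff κ lam x y i = y i := by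
  have h := congrFun (regularized_mulVec_dualCoeff hn hlam hK y) i
  rw [Matrix.add_mulVec, Matrix.smul_mulVec, Matrix.one_mulVec] at h
  simpa [krrPredict, kernelMatrix, Matrix.mulVec] using h

theorem rfmPredict_eq_ridgeFit (ψ : 𝒳 → 𝒱 → ℝ) (x : Fin n → 𝒳) (y : Fin n → ℝ) (V : Fin s → 𝒱)
    (z : 𝒳) : rfmPredict ψ lam x y V z = ridgeFit (fun z p => ψ z (V p)) lam x y z :=
  ridgeFit_eq_krrPredict (fun z p => ψ z (V p)) lam x y z

/-- A factor b in the kernel is absorbed by dividing the regularization by b. The relation is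
required only at the training points, since for random features it holds only almost surely. If the
matrix is singular, both inverses are zero by convention. -/
theorem dualCoeff_smul_kernel {κ' : 𝒳 → 𝒳 → ℝ} {b : ℝ} (hb : b ≠ 0) {x : Fin n → 𝒳}
    (h : ∀ i j, κ (x i) (x j) = b * κ' (x i) (x j)) (y : Fin n → ℝ) :
    dualCoeff κ lam x y = b⁻¹ • dualCoeff κ' (lam / b) x y := by
  have e : kernelMatrix κ x + ((n : ℝ) * lam) • (1 : Matrix (Fin n) (Fin n) ℝ) =
      b • (kernelMatrix κ' x + ((n : ℝ) * (lam / b)) • (1 : Matrix (Fin n) (Fin n) ℝ)) := by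
    rw [smul_add, smul_smul]
    congr 1
    · ext i j
      simp [kernelMatrix, h]
    · congr 1
      field_simp
  set M := kernelMatrix κ' x + ((n : ℝ) * (lam / b)) • (1 : Matrix (Fin n) (Fin n) ℝ) with hM
  rw [dualCoeff, dualCoeff, e, ← hM, ← Matrix.smul_mulVec]
  congr 1
  by_cases hdet : IsUnit M.det
  · exact Matrix.inv_smul' M (Units.mk0 b hb) hdet
  · rw [Matrix.nonsing_inv_apply_not_isUnit M hdet, smul_zero,
      Matrix.nonsing_inv_apply_not_isUnit]
    rw [Matrix.det_smul]
    intro hc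
    exact hdet (isUnit_of_mul_isUnit_right hc)

theorem krrPredict_smul_kernel {κ' : 𝒳 → 𝒳 → ℝ} {b : ℝ} (hb : b ≠ 0) {x : Fin n → 𝒳} {z : 𝒳}
    (h : ∀ i j, κ (x i) (x j) = b * κ' (x i) (x j)) (hz : ∀ i, κ z (x i) = b * κ' z (x i))
    (y : Fin n → ℝ) : krrPredict κ lam x y z = krrPredict κ' (lam / b) x y z := by
  rw [krrPredict, dualCoeff_smul_kernel hb h, krrPredict]
  simp only [dotProduct, hz, Pi.smul_apply, smul_eq_mul]
  exact Finset.sum_congr rfl fun i _ => by field_simp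

end Reduction

/-! ### The prediction error for fixed training data. -/

section FixedData

variable {𝒳 𝒱 : Type*} [MeasurableSpace 𝒳] [MeasurableSpace 𝒱] {n s : ℕ} (μ : Measure 𝒱)
  [IsProbabilityMeasure μ] {κ : 𝒳 → 𝒳 → ℝ} {ψ : 𝒳 → 𝒱 → ℝ} {lam : ℝ}

theorem bddMeas_sum_feature (hψ : Measurable (Function.uncurry ψ)) (hψ1 : ∀ z v, |ψ z v| ≤ 1)
    (x : Fin n → 𝒳) (α : Fin n → ℝ) : BddMeas fun v => ∑ i, α i * ψ (x i) v :=
  BddMeas.sum _ fun i => (bddMeas_feature' hψ hψ1 (x i)).const_mul _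

theorem dotProduct_kernelMatrix_mulVec (hψ : Measurable (Function.uncurry ψ))
    (hψ1 : ∀ z v, |ψ z v| ≤ 1) (hκ : ∀ z z', κ z z' = ∫ v, ψ z v * ψ z' v ∂μ) (x : Fin n → 𝒳)
    (α : Fin n → ℝ) :
    α ⬝ᵥ (kernelMatrix κ x *ᵥ α) = ∫ v, (∑ i, α i * ψ (x i) v) ^ 2 ∂μ := by
  have hb : ∀ i, BddMeas fun v => ψ (x i) v := fun i => bddMeas_feature' hψ hψ1 (x i)
  have e : ∀ v, (∑ i, α i * ψ (x i) v) ^ 2 =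
      ∑ i, ∑ j, α i * α j * (ψ (x i) v * ψ (x j) v) := by
    intro v
    rw [sq, Finset.sum_mul_sum]
    exact Finset.sum_congr rfl fun i _ => Finset.sum_congr rfl fun j _ => by ring
  simp only [e]
  rw [integral_finsetSum _ fun i _ => (BddMeas.sum Finset.univ fun j =>
    ((hb i).mul (hb j)).const_mul (α i * α j)).integrable μ]
  simp only [dotProduct, Matrix.mulVec, kernelMatrix, Matrix.of_apply, hκ, Finset.mul_sum]
  refine Finset.sum_congr rfl fun i _ => ?_
  rw [integral_finsetSum _ fun j _ => (((hb i).mul (hb j)).const_mul (α i * α j)).integrable μ]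
  refine Finset.sum_congr rfl fun j _ => ?_
  rw [integral_const_mul]
  ring

theorem kernelMatrix_posSemidef_of_integral (hψ : Measurable (Function.uncurry ψ))
    (hψ1 : ∀ z v, |ψ z v| ≤ 1) (hκ : ∀ z z', κ z z' = ∫ v, ψ z v * ψ z' v ∂μ) (x : Fin n → 𝒳) :
    (kernelMatrix κ x).PosSemidef := by
  refine Matrix.PosSemidef.of_dotProduct_mulVec_nonneg ?_ fun α => ?_
  · ext i j
    simp [kernelMatrix, hκ, mul_comm]
  · simp only [star_trivial]
    rw [dotProduct_kernelMatrix_mulVec μ hψ hψ1 hκ]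
    exact integral_nonneg fun v => sq_nonneg _

theorem krrPredict_eq_featureMean (hψ : Measurable (Function.uncurry ψ))
    (hψ1 : ∀ z v, |ψ z v| ≤ 1) (hκ : ∀ z z', κ z z' = ∫ v, ψ z v * ψ z' v ∂μ) (x : Fin n → 𝒳)
    (y : Fin n → ℝ) (z : 𝒳) : krrPredict κ lam x y z =
      featureMean μ ψ (fun v => ∑ i, dualCoeff κ lam x y i * ψ (x i) v) z := by
  simp only [krrPredict, dotProduct, featureMean, Finset.sum_mul, hκ]
  rw [integral_finsetSum _ fun i _ => (((bddMeas_feature' hψ hψ1 (x i)).const_mul _).mul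
    (bddMeas_feature' hψ hψ1 z)).integrable μ]
  refine Finset.sum_congr rfl fun i _ => ?_
  rw [← integral_mul_const]
  congr 1
  funext v
  ring

/-- The error of the random feature approximation is the ridge residual of a fluctuation. -/
theorem rfmPredict_sub_krrPredict (hn : 0 < n) (hψ : Measurable (Function.uncurry ψ))
    (hψ1 : ∀ z v, |ψ z v| ≤ 1) (hκ : ∀ z z', κ z z' = ∫ v, ψ z v * ψ z' v ∂μ) (hlam : 0 < lam)
    (x : Fin n → 𝒳) (y : Fin n → ℝ) (V : Fin s → 𝒱) (z : 𝒳) :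
    rfmPredict ψ lam x y V z - krrPredict κ lam x y z = ridgeRes (fun z p => ψ z (V p)) lam x
      (fluctuation μ ψ (fun v => ∑ i, dualCoeff κ lam x y i * ψ (x i) v) V) z := by
  set α := dualCoeff κ lam x y with hα
  set φ : 𝒳 → Fin s → ℝ := fun z p => ψ z (V p) with hφ
  have hf := krrPredict_eq_featureMean (lam := lam) μ hψ hψ1 hκ x y
  rw [← hα] at hf
  set f := krrPredict κ lam x y with hfd
  set k : 𝒳 → ℝ := fun z => (s : ℝ)⁻¹ * ∑ q, (∑ i, α i * ψ (x i) (V q)) * ψ z (V q) with hk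
  have ha : fluctuation μ ψ (fun v => ∑ i, α i * ψ (x i) v) V = fun z => k z - f z := by
    funext z
    simp only [fluctuation, ← hf, hk]
  -- The residual of kernel ridge regression at the training points is nλα.
  have hy : y = fun i => f (x i) + n * lam * α i := by
    funext i
    exact (krrPredict_add_dualCoeff hn hlam
      (kernelMatrix_posSemidef_of_integral μ hψ hψ1 hκ x) y i).symm
  have hsum : (fun i => y i + (k (x i) - f (x i))) = fun i => k (x i) + n * lam * α i := by
    funext i
    rw [congrFun hy i]
    ring
  have hcoef : ∀ p, ∑ j, φ (x j) p * α j = ∑ i, α i * ψ (x i) (V p) := fun p =>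
    Finset.sum_congr rfl fun i _ => by rw [mul_comm]
  -- At the training points k takes the values K̃α, so α solves the random feature system for these
  -- targets, and the resulting fit is k at every z.
  have hdual : dualCoeff (rfmKernel φ id) lam x (fun i => k (x i) + n * lam * α i) = α := by
    refine dualCoeff_eq_of_solves hn φ hlam x _ α fun i => ?_
    simp only [hk, hcoef]
    congr 2
    exact Finset.sum_congr rfl fun p _ => mul_comm _ _
  have hfit : ridgeFit φ lam x (fun i => k (x i) + n * lam * α i) z = k z := by
    have hc : ∀ p, ridgeCoef φ lam x (fun i => k (x i) + n * lam * α i) p =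
        ∑ i, α i * ψ (x i) (V p) := fun p => by rw [ridgeCoef, hdual, hcoef]
    rw [ridgeFit]
    simp only [hc]
    simp only [hk]
    congr 1
    exact Finset.sum_congr rfl fun p _ => mul_comm _ _
  rw [rfmPredict_eq_ridgeFit, ridgeRes, ha]
  have := ridgeFit_add φ lam x y (fun i => k (x i) - f (x i)) z
  rw [hsum, hfit] at this
  linarith

theorem measurable_matrix_inv_apply {α : Type*} [MeasurableSpace α]
    {M : α → Matrix (Fin n) (Fin n) ℝ}
    (hM : ∀ i j, Measurable fun a => M a i j) (i j : Fin n) :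
    Measurable fun a => (M a)⁻¹ i j := by
  have hM' : Measurable fun a => (fun i j => M a i j : Fin n → Fin n → ℝ) :=
    measurable_pi_lambda _ fun i => measurable_pi_lambda _ fun j => hM i j
  have hof : Continuous fun A : Fin n → Fin n → ℝ => Matrix.of A := continuous_id
  have hdet : Continuous fun A : Fin n → Fin n → ℝ => (Matrix.of A).det := hof.matrix_det
  have hadj : Continuous fun A : Fin n → Fin n → ℝ => (Matrix.of A).adjugate i j :=
    hof.matrix_adjugate.matrix_elem i j
  have e : ∀ a, (M a)⁻¹ i j = ((Matrix.of fun i j => M a i j).det)⁻¹ *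
      (Matrix.of fun i j => M a i j).adjugate i j := by
    intro a
    rw [Matrix.inv_def, Ring.inverse_eq_inv']
    rfl
  simp only [e]
  exact (hdet.measurable.comp hM').inv.mul (hadj.measurable.comp hM')

/-- Regularization bounds the fitted weight vector by the targets uniformly in V, through the last
inequality of `ridge_energy`, and the features are bounded by 1. -/
theorem bddMeas_rfmPredict (hn : 0 < n) (hψ : Measurable (Function.uncurry ψ))
    (hψ1 : ∀ z v, |ψ z v| ≤ 1) (hlam : 0 < lam) (x : Fin n → 𝒳) (y : Fin n → ℝ) :
    BddMeas fun q : 𝒳 × (Fin s → 𝒱) => rfmPredict ψ lam x y q.2 q.1 := by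
  refine ⟨?_, √((n : ℝ)⁻¹ * ∑ i, y i ^ 2 / (4 * lam)), fun q => ?_⟩
  · have hker : ∀ (u w : 𝒳 × (Fin s → 𝒱) → 𝒳), Measurable u → Measurable w →
        Measurable fun q : 𝒳 × (Fin s → 𝒱) => rfmKernel ψ q.2 (u q) (w q) := by
      intro u w hu hw
      simp only [rfmKernel_eq]
      refine measurable_const.mul (Finset.measurable_sum _ fun p _ => ?_)
      exact (hψ.comp (hu.prodMk (by fun_prop))).mul (hψ.comp (hw.prodMk (by fun_prop)))
    simp only [rfmPredict, krrPredict, dualCoeff, dotProduct, Matrix.mulVec]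
    refine Finset.measurable_sum _ fun i _ => (hker _ _ measurable_fst measurable_const).mul
      (Finset.measurable_sum _ fun j _ => ?_)
    refine (measurable_matrix_inv_apply (fun k l => ?_) i j).mul measurable_const
    simp only [kernelMatrix, Matrix.add_apply, Matrix.of_apply]
    exact (hker _ _ measurable_const measurable_const).add measurable_const
  · apply Real.abs_le_sqrt
    change rfmPredict ψ lam x y q.2 q.1 ^ 2 ≤ _
    rw [rfmPredict_eq_ridgeFit]
    have h1 := ridgeFit_sq_le (fun z p => ψ z (q.2 p)) lam x y q.1 fun p => hψ1 _ _
    have h2 := (ridge_energy hn (fun z p => ψ z (q.2 p)) hlam x y le_rfl).2.2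
    rw [← Finset.sum_div, ← mul_div_assoc, le_div_iff₀ (by positivity)]
    nlinarith

variable (ρ : Measure 𝒳) [IsProbabilityMeasure ρ] {δ : ℝ}

theorem integral_rfmPredict_sub_sq_le_of_abs_le_one (hn : 0 < n) (hs : 0 < s)
    (hψ : Measurable (Function.uncurry ψ)) (hψ1 : ∀ z v, |ψ z v| ≤ 1)
    (hκ : ∀ z z', κ z z' = ∫ v, ψ z v * ψ z' v ∂μ) (hδ : 0 < δ) (hδ1 : δ < 1)
    (hsδ : 2 ≤ s ∨ δ ≤ 1 / 2) (hlam : 0 < lam) (hL : 4 * Real.log (s / δ) ≤ n * lam ^ 2)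
    (x : Fin n → 𝒳) (y : Fin n → ℝ) (hx : devMoment ρ μ ψ x ≤ 4 / δ) :
    Integrable (fun q : 𝒳 × (Fin s → 𝒱) =>
      (rfmPredict ψ lam x y q.2 q.1 - krrPredict κ lam x y q.1) ^ 2)
      (ρ.prod (Measure.pi fun _ : Fin s => μ)) ∧
    ∫ q : 𝒳 × (Fin s → 𝒱), (rfmPredict ψ lam x y q.2 q.1 - krrPredict κ lam x y q.1) ^ 2
      ∂(ρ.prod (Measure.pi fun _ : Fin s => μ)) ≤ 4 / s * krrComplexity κ lam x y := by
  have hg := bddMeas_sum_feature hψ hψ1 x (dualCoeff κ lam x y)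
  have hkrr : BddMeas (krrPredict κ lam x y) := by
    have := bddMeas_featureMean μ hψ hψ1 hg
    rwa [show featureMean μ ψ _ = krrPredict κ lam x y from
      funext fun z => (krrPredict_eq_featureMean μ hψ hψ1 hκ x y z).symm] at this
  have hb : BddMeas fun q : 𝒳 × (Fin s → 𝒱) =>
      (rfmPredict ψ lam x y q.2 q.1 - krrPredict κ lam x y q.1) ^ 2 :=
    ((bddMeas_rfmPredict hn hψ hψ1 hlam x y).sub (hkrr.comp measurable_fst)).pow 2
  refine ⟨hb.integrable _, ?_⟩
  rw [integral_prod_symm _ (hb.integrable _)]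
  simp only [rfmPredict_sub_krrPredict μ hn hψ hψ1 hκ hlam]
  rw [krrComplexity_eq_dotProduct (kernelMatrix_posSemidef_of_integral μ hψ hψ1 hκ x),
    dotProduct_kernelMatrix_mulVec μ hψ hψ1 hκ]
  exact integral_ridgeRes_fluctuation_sq_le_of_devMoment_le ρ μ hn hs hψ hψ1 hg hδ hδ1 hsδ hlam hL
    x hx

end FixedData

/-- The dual coefficients scale by b and enter quadratically, while the kernel scales by b⁻¹. The
resulting factor b is the one in the final bound. -/
theorem krrComplexity_smul_kernel {𝒳 : Type*} {b : ℝ} {n : ℕ} {κ κ' : 𝒳 → 𝒳 → ℝ} (hb : 0 < b)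
    {x : Fin n → 𝒳} (h : ∀ i j, κ (x i) (x j) = b * κ' (x i) (x j)) (hK : (kernelMatrix κ' x).PosSemidef)
    (lam : ℝ) (y : Fin n → ℝ) :
    krrComplexity κ' (lam / b) x y = b * krrComplexity κ lam x y := by
  have e : kernelMatrix κ x = b • kernelMatrix κ' x := by
    ext i j
    simp [kernelMatrix, h]
  have hK' : (kernelMatrix κ x).PosSemidef := by rw [e]; exact hK.smul hb.le
  rw [krrComplexity_eq_dotProduct hK, krrComplexity_eq_dotProduct hK',
    dualCoeff_smul_kernel hb.ne' h, e]
  simp only [Matrix.smul_mulVec, Matrix.mulVec_smul, dotProduct_smul, smul_dotProduct, smul_eq_mul]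
  field_simp

/-! ### Reduction to features bounded by one. -/

section Normalization

variable {𝒳 𝒱 : Type*}

/-- The feature map truncated to absolute value `√b` and scaled to absolute value at most `1`. -/
noncomputable def unitFeature (ψ : 𝒳 → 𝒱 → ℝ) (b : ℝ) (z : 𝒳) (v : 𝒱) : ℝ :=
  max (-1) (min 1 (ψ z v / √b))

theorem abs_unitFeature_le (ψ : 𝒳 → 𝒱 → ℝ) (b : ℝ) (z : 𝒳) (v : 𝒱) :
    |unitFeature ψ b z v| ≤ 1 :=
  abs_le.2 ⟨le_max_left _ _, max_le (by norm_num) (min_le_left _ _)⟩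

theorem eq_sqrt_mul_unitFeature {ψ : 𝒳 → 𝒱 → ℝ} {b : ℝ} (hb : 0 < b) {z : 𝒳} {v : 𝒱}
    (h : ψ z v ^ 2 ≤ b) : ψ z v = √b * unitFeature ψ b z v := by
  have hb' : 0 < √b := Real.sqrt_pos.2 hb
  have h1 : |ψ z v / √b| ≤ 1 := by
    rw [abs_div, abs_of_pos hb', div_le_one hb']
    exact Real.abs_le_sqrt h
  rw [unitFeature, min_eq_right (abs_le.1 h1).2, max_eq_right (abs_le.1 h1).1]
  field_simp

variable [MeasurableSpace 𝒱] {ψ : 𝒳 → 𝒱 → ℝ} {b : ℝ}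

theorem kernel_eq_mul_integral_unitFeature (μ : Measure 𝒱) (hb : 0 < b)
    (hbound : ∀ z, ∀ᵐ v ∂μ, ψ z v ^ 2 ≤ b) (z z' : 𝒳) :
    ∫ v, ψ z v * ψ z' v ∂μ = b * ∫ v, unitFeature ψ b z v * unitFeature ψ b z' v ∂μ := by
  rw [← integral_const_mul]
  refine integral_congr_ae ?_
  filter_upwards [hbound z, hbound z'] with v hv hv'
  rw [eq_sqrt_mul_unitFeature hb hv, eq_sqrt_mul_unitFeature hb hv']
  linear_combination (unitFeature ψ b z v * unitFeature ψ b z' v) * Real.mul_self_sqrt hb.le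

variable [MeasurableSpace 𝒳]

theorem measurable_unitFeature (hψ : Measurable (Function.uncurry ψ)) :
    Measurable (Function.uncurry (unitFeature ψ b)) :=
  measurable_const.max (measurable_const.min (hψ.div_const _))

/-- The null set where ψ(z; ·)² exceeds b may depend on z. Finitely many training points cause no
difficulty, and Fubini's theorem handles the test point. -/
theorem rfmPredict_ae_eq (ρ : Measure 𝒳) (μ : Measure 𝒱) [IsProbabilityMeasure ρ]
    [IsProbabilityMeasure μ] {n s : ℕ} (hψ : Measurable (Function.uncurry ψ)) (hb : 0 < b)
    (hbound : ∀ z, ∀ᵐ v ∂μ, ψ z v ^ 2 ≤ b) (lam : ℝ) (x : Fin n → 𝒳) (y : Fin n → ℝ) :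
    ∀ᵐ q : 𝒳 × (Fin s → 𝒱) ∂(ρ.prod (Measure.pi fun _ : Fin s => μ)),
      rfmPredict ψ lam x y q.2 q.1 = rfmPredict (unitFeature ψ b) (lam / b) x y q.2 q.1 := by
  have hpi : ∀ z, ∀ᵐ V : Fin s → 𝒱 ∂(Measure.pi fun _ : Fin s => μ),
      ∀ p, ψ z (V p) = √b * unitFeature ψ b z (V p) := fun z => ae_all_iff.2 fun p =>
    (Measure.quasiMeasurePreserving_eval (fun _ : Fin s => μ) p).ae
      ((hbound z).mono fun v hv => eq_sqrt_mul_unitFeature hb hv)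
  have h1 : ∀ᵐ q : 𝒳 × (Fin s → 𝒱) ∂(ρ.prod (Measure.pi fun _ : Fin s => μ)),
      ∀ i p, ψ (x i) (q.2 p) = √b * unitFeature ψ b (x i) (q.2 p) :=
    Measure.quasiMeasurePreserving_snd.ae (ae_all_iff.2 fun i => hpi (x i))
  have h2 : ∀ᵐ q : 𝒳 × (Fin s → 𝒱) ∂(ρ.prod (Measure.pi fun _ : Fin s => μ)),
      ∀ p, ψ q.1 (q.2 p) = √b * unitFeature ψ b q.1 (q.2 p) := by
    refine (Measure.ae_prod_iff_ae_ae ?_).2 (Filter.Eventually.of_forall fun z => hpi z)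
    rw [Set.ofPred_forall]
    refine MeasurableSet.iInter fun p => ?_
    have hp : Measurable fun q : 𝒳 × (Fin s → 𝒱) => (q.1, q.2 p) := by fun_prop
    exact measurableSet_eq_fun (hψ.comp hp)
      (((measurable_unitFeature hψ).comp hp).const_mul (√b))
  filter_upwards [h1, h2] with q hq1 hq2
  have hk : ∀ u w, (∀ p, ψ u (q.2 p) = √b * unitFeature ψ b u (q.2 p)) →
      (∀ p, ψ w (q.2 p) = √b * unitFeature ψ b w (q.2 p)) →
      rfmKernel ψ q.2 u w = b * rfmKernel (unitFeature ψ b) q.2 u w := by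
    intro u w hu hw
    rw [rfmKernel_eq, rfmKernel_eq, mul_left_comm, Finset.mul_sum Finset.univ _ b]
    congr 1
    refine Finset.sum_congr rfl fun p _ => ?_
    rw [hu, hw]
    linear_combination (unitFeature ψ b u (q.2 p) * unitFeature ψ b w (q.2 p)) *
      Real.mul_self_sqrt hb.le
  exact krrPredict_smul_kernel hb.ne' (fun i j => hk _ _ (hq1 i) (hq1 j))
    (fun i => hk _ _ hq2 (hq1 i)) y

end Normalization

/-! ### The main theorem. -/

theorem theorem1 {𝒳 𝒱 Ω : Type*} [MeasurableSpace 𝒳] [MeasurableSpace 𝒱] [MeasurableSpace Ω]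
    (ρ : Measure 𝒳) [IsProbabilityMeasure ρ] (μ : Measure 𝒱) [IsProbabilityMeasure μ]
    (P : Measure Ω) [IsProbabilityMeasure P]
    (κ : 𝒳 → 𝒳 → ℝ) (ψ : 𝒳 → 𝒱 → ℝ) (hψ : Measurable (Function.uncurry ψ))
    (hunbiased : ∀ x x', κ x x' = ∫ v, ψ x v * ψ x' v ∂μ)
    (b : ℝ) (hb : 0 < b) (hbound : ∀ x, ∀ᵐ v ∂μ, ψ x v ^ 2 ≤ b)
    (n s : ℕ) (hn : 0 < n) (hs : 0 < s) (δ : ℝ) (hδ0 : 0 < δ) (hδ1 : δ < 1)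
    (hsδ : 2 ≤ s ∨ δ ≤ 1 / 2)
    (lam : ℝ) (hlam : 2 * b / √(n : ℝ) * √(Real.log ((s : ℝ) / δ)) ≤ lam)
    (x : Fin n → Ω → 𝒳) (hx : ∀ i, Measurable (x i)) (hindep : iIndepFun x P)
    (hlaw : ∀ i, P.map (x i) = ρ)
    (y : Fin n → Ω → ℝ) (hy : ∀ i, Measurable (y i)) :
    1 - δ ≤ P.real {ω |
      Integrable (fun q : 𝒳 × (Fin s → 𝒱) =>
        (rfmPredict ψ lam (fun i => x i ω) (fun i => y i ω) q.2 q.1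
          - krrPredict κ lam (fun i => x i ω) (fun i => y i ω) q.1) ^ 2)
        (ρ.prod (Measure.pi fun _ : Fin s => μ)) ∧
      ∫ q : 𝒳 × (Fin s → 𝒱),
        (rfmPredict ψ lam (fun i => x i ω) (fun i => y i ω) q.2 q.1
          - krrPredict κ lam (fun i => x i ω) (fun i => y i ω) q.1) ^ 2
        ∂(ρ.prod (Measure.pi fun _ : Fin s => μ))
        ≤ 4 * b / s * krrComplexity κ lam (fun i => x i ω) (fun i => y i ω)} := by
  have hn0 : (0 : ℝ) < n := by exact_mod_cast hn
  have hs1 : (1 : ℝ) ≤ s := by exact_mod_cast hs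
  have hsδ' : 1 < s / δ := by
    rw [one_lt_div hδ0]
    linarith
  have hlog : 0 < Real.log (s / δ) := Real.log_pos hsδ'
  have hlam0 : 0 < lam := lt_of_lt_of_le (by positivity) hlam
  have hL : 4 * Real.log (s / δ) ≤ n * (lam / b) ^ 2 := by
    have h1 : 2 / √(n : ℝ) * √(Real.log (s / δ)) ≤ lam / b := by
      rw [le_div_iff₀ hb]
      exact le_trans (le_of_eq (by ring)) hlam
    have h2 : (2 / √(n : ℝ) * √(Real.log (s / δ))) ^ 2 ≤ (lam / b) ^ 2 := by gcongr
    rw [mul_pow, div_pow, Real.sq_sqrt hn0.le, Real.sq_sqrt hlog.le] at h2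
    calc 4 * Real.log (s / δ) = n * (2 ^ 2 / n * Real.log (s / δ)) := by field_simp; norm_num
      _ ≤ _ := by gcongr
  set φ := unitFeature ψ b with hφ
  have hφm : Measurable (Function.uncurry φ) := measurable_unitFeature hψ
  have hφ1 : ∀ z v, |φ z v| ≤ 1 := abs_unitFeature_le ψ b
  set κ' : 𝒳 → 𝒳 → ℝ := fun z z' => ∫ v, φ z v * φ z' v ∂μ with hκ'
  have hκκ' : ∀ z z', κ z z' = b * κ' z z' := fun z z' =>
    (hunbiased z z').trans (kernel_eq_mul_integral_unitFeature μ hb hbound z z')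
  -- The good event involves only the inputs, so the targets may depend on them arbitrarily.
  -- Monotonicity of the measure does not require measurability of the event in the conclusion.
  refine (one_sub_le_measureReal_devMoment ρ P μ hn hφm hφ1 hx hindep hlaw hδ0).trans
    (measureReal_mono fun ω hω => ?_)
  obtain ⟨hint, hle⟩ := integral_rfmPredict_sub_sq_le_of_abs_le_one μ ρ hn hs hφm hφ1
    (fun z z' => rfl) hδ0 hδ1 hsδ (div_pos hlam0 hb) hL (fun i => x i ω) (fun i => y i ω) hω
  have hae : (fun q : 𝒳 × (Fin s → 𝒱) =>
      (rfmPredict φ (lam / b) (fun i => x i ω) (fun i => y i ω) q.2 q.1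
        - krrPredict κ' (lam / b) (fun i => x i ω) (fun i => y i ω) q.1) ^ 2)
      =ᵐ[ρ.prod (Measure.pi fun _ : Fin s => μ)] fun q =>
      (rfmPredict ψ lam (fun i => x i ω) (fun i => y i ω) q.2 q.1
        - krrPredict κ lam (fun i => x i ω) (fun i => y i ω) q.1) ^ 2 := by
    filter_upwards [rfmPredict_ae_eq ρ μ hψ hb hbound lam (fun i => x i ω) (fun i => y i ω)] with
      q hq
    rw [hq, krrPredict_smul_kernel (κ := κ) hb.ne' (fun i j => hκκ' _ _) (fun i => hκκ' _ _)]
  refine ⟨hint.congr hae, ?_⟩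
  rw [← integral_congr_ae hae]
  refine hle.trans (le_of_eq ?_)
  rw [krrComplexity_smul_kernel hb (fun i j => hκκ' _ _)
    (kernelMatrix_posSemidef_of_integral μ hφm hφ1 (fun z z' => rfl) _)]
  ring
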